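/- Let $V$ be a (real or complex) Banach space and let $p>0$. Recall that $V$ is called UMD if for some (equivalently, for all) $r\in(1,\infty)$ there exists a constant $\beta>0$ such that for every probability space $(\Omega,\mathcal F,\mathbb P)$, every $N\ge 1$, every martingale difference sequence $(d_n)_{n=1}^N$ in $L^r(\Omega;V)$ (with respect to some filtration) and all scalars $\varepsilon_1,\dots,\varepsilon_N$ with $|\varepsilon_n|=1$ one has \[ \Bigl(\mathbb E\Bigl\|\sum_{n=1}^N\varepsilon_n d_n\Bigr\|^r\Bigr)^{1/r}\le \beta\,\Bigl(\mathbb E\Bigl\|\sum_{n=1}^N d_n\Bigr\|^r\Bigr)^{1/r}. \] Let $(\mathcal F_n)_{n\ge 0}$ be a filtration on a probability space $(\Omega,\mathcal F,\mathbb P)$. Two adapted $V$-valued discrete-time processes $f=(f_n)_{n\ge1}$ and $g=(g_n)_{n\ge 1}$ are called tangent if, with the convention $f_0=g_0=0$, \[ \mathbb P(f_n-f_{n-1}\in B\mid\mathcal F_{n-1})=\mathbb P(g_n-g_{n-1}\in B\mid\mathcal F_{n-1})\quad\text{a.s.} \] for all $n\ge 1$ and all Borel sets $B\subseteq V$; $f$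 is called conditionally symmetric if $f$ and $-f$ are tangent. (No integrability of $f_n$ or $g_n$ is assumed.) Then $V$ is UMD if and only if there exists a constant $\widetilde C_{p,V}>0$ depending only on $p$ and $V$ such that for any filtered probability space and any $V$-valued tangent conditionally symmetric discrete-time processes $(f_n)_{n\ge1}$ and $(g_n)_{n\ge1}$ on it one has \[ \mathbb P(g^*>t)\le \widetilde C_{p,V}\Bigl(\frac{s^p}{t^p}+\mathbb P(f^*>s)\Bigr)\qquad\text{for all } s,t>0, \] where $f^*:=\sup_{n\ge1}\|f_n\|$ and $g^*:=\sup_{n\ge1}\|g_n\|$. -/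

import Mathlib

open MeasureTheory ProbabilityTheory
open scoped ENNReal

universe u v w

/-- A `V`-valued martingale difference sequence `d 0, d 1, d 2, …` with respect to `ℱ`, i.e. the
sequence of differences of the martingale `n ↦ d 0 + ⋯ + d n` (the first difference is the first
term of the martingale). -/
structure IsMartingaleDifference {Ω V : Type*} [NormedAddCommGroup V] [NormedSpace ℝ V]
    [CompleteSpace V] {mΩ : MeasurableSpace Ω} (ℱ : Filtration ℕ mΩ) (μ : Measure Ω)
    (d : ℕ → Ω → V) : Prop where
  adapted : StronglyAdapted ℱ d
  integrable : ∀ n, Integrable (d n) μ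
  condExp_succ : ∀ n, μ[d (n + 1) | ℱ n] =ᵐ[μ] 0

/-- The UMD property of a Banach space `V` over `𝕜` (the real or complex numbers): for some
`r ∈ (1, ∞)` there is a constant `β > 0` such that all `L^r`-martingale difference sequences, on all
filtered probability spaces, satisfy
`(𝔼 ‖∑_{n < N} ε_n d_n‖^r)^{1/r} ≤ β (𝔼 ‖∑_{n < N} d_n‖^r)^{1/r}` for every `N` and all scalars
`ε_n` of modulus one. -/
def IsUMD.{w₁, v₁, u₁} (𝕜 : Type v₁) (V : Type u₁) [RCLike 𝕜] [NormedAddCommGroup V]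
    [NormedSpace ℝ V] [NormedSpace 𝕜 V] [CompleteSpace V] : Prop :=
  ∃ r : ℝ, 1 < r ∧ ∃ β : ℝ, 0 < β ∧
    ∀ (Ω : Type w₁) (mΩ : MeasurableSpace Ω) (μ : Measure Ω) (_ : IsProbabilityMeasure μ)
      (ℱ : Filtration ℕ mΩ) (d : ℕ → Ω → V),
      IsMartingaleDifference ℱ μ d → (∀ n, MemLp (d n) (ENNReal.ofReal r) μ) →
      ∀ (N : ℕ) (ε : ℕ → 𝕜), (∀ n, ‖ε n‖ = 1) →
        eLpNorm (fun ω => ∑ n ∈ Finset.range N, ε n • d n ω) (ENNReal.ofReal r) μ ≤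
          ENNReal.ofReal β *
            eLpNorm (fun ω => ∑ n ∈ Finset.range N, d n ω) (ENNReal.ofReal r) μ

section Discrete

variable {Ω V : Type*} [NormedAddCommGroup V] {mΩ : MeasurableSpace Ω}

/-- An adapted `V`-valued discrete-time process `(f n)_{n ≥ 1}`, with the convention `f 0 = 0`. No
integrability is required. -/
structure IsDiscreteProcess (ℱ : Filtration ℕ mΩ) (f : ℕ → Ω → V) : Prop where
  zero : f 0 = 0
  adapted : StronglyAdapted ℱ f

/-- Two discrete-time processes are tangent if for every `n ≥ 1` their `n`-th increments have the
same conditional law given `ℱ (n - 1)`. -/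
def Tangent [MeasurableSpace V] (ℱ : Filtration ℕ mΩ) (μ : Measure Ω) (f g : ℕ → Ω → V) : Prop :=
  ∀ n : ℕ, ∀ B : Set V, MeasurableSet B →
    μ⟦(f (n + 1) - f n) ⁻¹' B | ℱ n⟧ =ᵐ[μ] μ⟦(g (n + 1) - g n) ⁻¹' B | ℱ n⟧

/-- A discrete-time process `f` is conditionally symmetric if `f` and `-f` are tangent. -/
def ConditionallySymmetric [MeasurableSpace V] (ℱ : Filtration ℕ mΩ) (μ : Measure Ω)
    (f : ℕ → Ω → V) : Prop :=
  Tangent ℱ μ f (-f)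

/-- The maximal function `f* = sup_{n ≥ 1} ‖f n‖`, with values in `[0, ∞]`. -/
noncomputable def maximalFunction (f : ℕ → Ω → V) (ω : Ω) : ℝ≥0∞ :=
  ⨆ (n : ℕ) (_ : 1 ≤ n), ‖f n ω‖ₑ

end Discrete

/-! Both conditions are tied to the existence of a Burkholder function. A pair (process `x`, sign
transform `y`) is described by `a = (x + y) / 2` and `c = (x - y) / 2`; an increment with sign `+`
moves only `a`, and one with sign `-` moves only `c`. A function `U a c`, concave in each variable,
with `‖a - c‖ ^ r - B * ‖a + c‖ ^ r ≤ U a c` and `U 0 0 ≤ 0`, certifies an `L^r` bound for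
transforms: along the process the mean of `U` decreases. Such a `U` is the supremum of expected
payoffs over finite coin-flipping games (`exists_isBurkholderFunction`), so it exists as soon as
those games satisfy the `L^r` bound.

From UMD to the tail estimate: games are martingales on coin spaces, so UMD gives the bound for
games and hence `U`. The same `U` decouples. If `i`, `j` are independent copies of a mean-zero
vector, moving `(x, y)` to `(x + i, y + j)` does not raise the mean of `U` at the corresponding
point (`IsBurkholderFunction.sum_sum_le`). A sum is thus comparable in `L^r`, in both directions,
with one whose increments are drawn conditionally independently from the same conditional laws.
Tangent processes share this decoupled sum, so the `L^r` norm of one controls that of the other. The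
process `f` is stopped when it leaves the ball of radius `s`, and increments larger than `2 * s` are
deleted; only events governed by `P(f* > s)` are lost. For the remaining bounded increments, the
`L^r` bound on successive start-stop windows is multiplied `m` times and gives decay `(s / t) ^ (r *
m)`, which covers every exponent `p`.

From the tail estimate to UMD: a coin walk and its transform by alternating signs are tangent and
conditionally symmetric, so games inherit the tail estimate. Restarting the game when the transform
becomes large turns this into a good-`λ` inequality (`good_lambda`), and integration together with
Doob's inequality yields an `L²` bound for games (`exists_mean_sq_le`). The resulting `U` with `r =
2` bounds sign transforms of finite-valued martingales, then of all martingales by approximation,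
and unimodular multipliers follow by convexity. -/

/-! ### Finite games and their expected payoffs. -/

/-- A finite coin-flipping game: at a node a fair coin decides between the increments `v` (continue
with `l`) and `-v` (continue with `r`); `b` says whether the transformed process moves along or
against the increment. -/
inductive SignTree (V : Type u) : Type u
  | leaf : SignTree V
  | node (v : V) (b : Bool) (l r : SignTree V) : SignTree V

/-- `v` or `-v`. -/
def signed {V : Type*} [Neg V] (b : Bool) (v : V) : V := if b then v else -v

lemma norm_signed {V : Type*} [SeminormedAddCommGroup V] (b : Bool) (v : V) :
    ‖signed b v‖ = ‖v‖ := by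
  cases b <;> simp [signed]

namespace SignTree

section Mean

variable {V : Type u} [Neg V] {Z Z' : Type*}

/-- The expected value of `φ` at the final state of the game, where `step` updates the state. -/
noncomputable def mean (step : Z → V → Bool → Z) (φ : Z → ℝ) : SignTree V → Z → ℝ
  | leaf, z => φ z
  | node v b l r, z => (mean step φ l (step z v b) + mean step φ r (step z (-v) b)) / 2

variable {step : Z → V → Bool → Z} {φ ψ : Z → ℝ}

/-- The invariant encodes relations such as `‖z.y‖ ≤ z.M`, which hold at the states that a game
reaches but not at an arbitrary `MaxState`. -/
lemma mean_mono_of_invariant {P : Z → Prop} (hP : ∀ z v b, P z → P (step z v b))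
    (h : ∀ z, P z → φ z ≤ ψ z) (S : SignTree V) (z : Z) (hz : P z) :
    mean step φ S z ≤ mean step ψ S z := by
  induction S generalizing z with
  | leaf => exact h z hz
  | node v b l r hl hr =>
    have h1 := hl _ (hP z v b hz)
    have h2 := hr _ (hP z (-v) b hz)
    simp only [mean]
    linarith

lemma mean_mono (h : ∀ z, φ z ≤ ψ z) (S : SignTree V) (z : Z) :
    mean step φ S z ≤ mean step ψ S z :=
  mean_mono_of_invariant (P := fun _ => True) (fun _ _ _ _ => trivial) (fun z _ => h z) S z trivial

lemma mean_const (c : ℝ) (S : SignTree V) (z : Z) : mean step (fun _ => c) S z = c := by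
  induction S generalizing z with
  | leaf => rfl
  | node v b l r hl hr => simp [mean, hl, hr]

lemma mean_nonneg (h : ∀ z, 0 ≤ φ z) (S : SignTree V) (z : Z) : 0 ≤ mean step φ S z := by
  simpa [mean_const] using mean_mono (step := step) (φ := fun _ => 0) h S z

lemma mean_add (S : SignTree V) (z : Z) :
    mean step (fun z => φ z + ψ z) S z = mean step φ S z + mean step ψ S z := by
  induction S generalizing z with
  | leaf => rfl
  | node v b l r hl hr => simp only [mean, hl, hr]; ring

lemma mean_const_mul (c : ℝ) (S : SignTree V) (z : Z) :
    mean step (fun z => c * φ z) S z = c * mean step φ S z := by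
  induction S generalizing z with
  | leaf => rfl
  | node v b l r hl hr => simp only [mean, hl, hr]; ring

/-- Allows components of the state, such as the running maxima, to be forgotten when the payoff
ignores them. -/
lemma mean_comp {step' : Z' → V → Bool → Z'} (π : Z → Z')
    (hπ : ∀ z v b, π (step z v b) = step' (π z) v b) (φ : Z' → ℝ) (S : SignTree V) (z : Z) :
    mean step (fun z => φ (π z)) S z = mean step' φ S (π z) := by
  induction S generalizing z with
  | leaf => rfl
  | node v b l r hl hr => simp only [mean, hl, hr, hπ]

lemma measurable_mean {φ : ℝ → Z → ℝ} (h : ∀ z, Measurable fun a => φ a z) (S : SignTree V)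
    (z : Z) : Measurable fun a => mean step (φ a) S z := by
  induction S generalizing z with
  | leaf => exact h z
  | node v b l r hl hr => exact ((hl _).add (hr _)).div_const 2

lemma lintegral_indicator_lt (c : ℝ) :
    ∫⁻ a in Set.Ioi (0 : ℝ), ENNReal.ofReal (2 * a * if a < c then 1 else 0) =
      ENNReal.ofReal (max c 0 ^ 2) := by
  have h1 : ∀ a : ℝ, ENNReal.ofReal (2 * a * if a < c then 1 else 0) =
      (Set.Iio c).indicator (fun a => ENNReal.ofReal (2 * a)) a := by
    intro a
    by_cases h : a < c <;> simp [h]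
  simp_rw [h1]
  rw [lintegral_indicator measurableSet_Iio, Measure.restrict_restrict measurableSet_Iio]
  rcases le_or_gt c 0 with hc | hc
  · have : Set.Iio c ∩ Set.Ioi 0 = ∅ := by
      ext a
      simp only [Set.mem_inter_iff, Set.mem_Iio, Set.mem_Ioi, Set.mem_empty_iff_false, iff_false]
      intro h
      linarith [h.1, h.2]
    simp [this, hc]
  · have : Set.Iio c ∩ Set.Ioi 0 = Set.Ioo 0 c := by
      ext a; simp [and_comm]
    rw [this, ← ofReal_integral_eq_lintegral_ofReal, ← integral_Ioc_eq_integral_Ioo,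
      ← intervalIntegral.integral_of_le hc.le]
    · rw [max_eq_left hc.le]
      congr 1
      rw [intervalIntegral.integral_const_mul, integral_id]
      ring
    · exact (Continuous.integrableOn_Icc (by fun_prop)).mono_set Set.Ioo_subset_Icc_self
    · filter_upwards [ae_restrict_mem measurableSet_Ioo] with a ha
      have := ha.1
      simp only [Pi.zero_apply]
      linarith

/-- Layer-cake formula for games. -/
lemma lintegral_mean_lt (g : Z → ℝ) (S : SignTree V) (z : Z) :
    ∫⁻ a in Set.Ioi (0 : ℝ),
        ENNReal.ofReal (2 * a * mean step (fun z => if a < g z then 1 else 0) S z) =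
      ENNReal.ofReal (mean step (fun z => max (g z) 0 ^ 2) S z) := by
  have hmeas : ∀ z, Measurable fun a : ℝ => if a < g z then (1 : ℝ) else 0 := fun z =>
    Measurable.ite measurableSet_Iio measurable_const measurable_const
  induction S generalizing z with
  | leaf => exact lintegral_indicator_lt _
  | node v b l r hl hr =>
    have hnn : ∀ (a : ℝ) S z, 0 ≤ mean step (fun z => if a < g z then (1 : ℝ) else 0) S z :=
      fun a S z => mean_nonneg (fun z => by split_ifs <;> norm_num) S z
    have hnn2 : ∀ S z, 0 ≤ mean step (fun z => max (g z) 0 ^ 2) S z :=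
      fun S z => mean_nonneg (fun z => by positivity) S z
    have : ∀ a ∈ Set.Ioi (0 : ℝ), ENNReal.ofReal (2 * a *
        mean step (fun z => if a < g z then (1 : ℝ) else 0) (node v b l r) z) =
        ENNReal.ofReal (1 / 2) * (ENNReal.ofReal (2 * a *
          mean step (fun z => if a < g z then (1 : ℝ) else 0) l (step z v b)) +
        ENNReal.ofReal (2 * a *
          mean step (fun z => if a < g z then (1 : ℝ) else 0) r (step z (-v) b))) := by
      intro a ha
      have ha' : (0 : ℝ) < a := ha
      rw [← ENNReal.ofReal_add (mul_nonneg (by positivity) (hnn _ _ _))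
        (mul_nonneg (by positivity) (hnn _ _ _)), ← ENNReal.ofReal_mul (by norm_num)]
      congr 1
      simp only [mean]
      ring
    rw [setLIntegral_congr_fun measurableSet_Ioi this, lintegral_const_mul', lintegral_add_left,
      hl, hr, ← ENNReal.ofReal_add (hnn2 _ _) (hnn2 _ _), ← ENNReal.ofReal_mul (by norm_num)]
    · congr 1
      simp only [mean]
      ring
    · exact ((measurable_const.mul measurable_id).mul
        (measurable_mean hmeas l _)).ennreal_ofReal
    · exact ENNReal.ofReal_ne_top

end Mean

/-! ### Maximal functions, the good-`λ` inequality and the `L²` bound for games. -/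

section Maximal

variable {V : Type u} [NormedAddCommGroup V]

/-- The update of a process `x` and its transform `y`. -/
def pairStep (z : V × V) (v : V) (b : Bool) : V × V := (z.1 + v, z.2 + signed b v)

/-- A process `x`, its transform `y`, and upper bounds for the norms of their past values. -/
structure MaxState (V : Type u) where
  x : V
  y : V
  m : ℝ
  M : ℝ

/-- The update of a process, its transform and their maximal functions. -/
noncomputable def maxStep (z : MaxState V) (v : V) (b : Bool) : MaxState V :=
  ⟨z.x + v, z.y + signed b v, max z.m ‖z.x + v‖, max z.M ‖z.y + signed b v‖⟩

/-- The initial state. -/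
def start : MaxState V := ⟨0, 0, 0, 0⟩

/-- Doob's `L²` maximal inequality. -/
lemma mean_sq_max_le [NormedSpace ℝ V] (S : SignTree V) (z : MaxState V) (hz : ‖z.x‖ ≤ z.m) :
    mean maxStep (fun z => z.m ^ 2) S z ≤
      4 * mean maxStep (fun z => ‖z.x‖ ^ 2) S z + (2 * z.m ^ 2 - 4 * z.m * ‖z.x‖) := by
  induction S generalizing z with
  | leaf => simp only [mean]; nlinarith [sq_nonneg (z.m - 2 * ‖z.x‖)]
  | node v b l r hl hr =>
    -- The correction `2 * m ^ 2 - 4 * m * ‖x‖` is a supermartingale: for fixed `m` it is concave in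
    -- `‖x‖`, and raising `m` to `n = ‖x + v'‖` lowers it by `2 * (n - m) ^ 2`.
    have key : ∀ v' : V, 2 * (maxStep z v' b).m ^ 2 - 4 * (maxStep z v' b).m * ‖(maxStep z v' b).x‖
        ≤ 2 * z.m ^ 2 - 4 * z.m * ‖z.x + v'‖ := by
      intro v'
      simp only [maxStep]
      rcases le_total z.m ‖z.x + v'‖ with h | h
      · rw [max_eq_right h]
        nlinarith [sq_nonneg (z.m - ‖z.x + v'‖)]
      · rw [max_eq_left h]
    have h1 := hl (maxStep z v b) (le_max_right _ _)
    have h2 := hr (maxStep z (-v) b) (le_max_right _ _)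
    have h3 := key v
    have h4 := key (-v)
    have h5 : 2 * ‖z.x‖ ≤ ‖z.x + v‖ + ‖z.x + -v‖ := by
      have h6 : z.x + v + (z.x + -v) = (2 : ℝ) • z.x := by rw [two_smul]; abel
      calc 2 * ‖z.x‖ = ‖z.x + v + (z.x + -v)‖ := by rw [h6, norm_smul]; norm_num
        _ ≤ _ := norm_add_le _ _
    have hm : 0 ≤ z.m := (norm_nonneg _).trans hz
    simp only [mean]
    nlinarith [mul_le_mul_of_nonneg_left h5 hm]

/-- The tail estimate for games. -/
def TailBound (V : Type u) [NormedAddCommGroup V] (p C : ℝ) : Prop :=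
  ∀ (S : SignTree V) (s t : ℝ), 0 < s → 0 < t →
    mean maxStep (fun z => if t < z.M then 1 else 0) S start ≤
      C * (s ^ p / t ^ p + mean maxStep (fun z => if s < z.m then 1 else 0) S start)

/-- Stop the game before the norm of an increment exceeds `2 * a`, and after the norm of the
process exceeds `a`. -/
noncomputable def prune (a : ℝ) : SignTree V → V → SignTree V
  | leaf, _ => leaf
  | node v b l r, x =>
    open Classical in
    if ‖x‖ ≤ a ∧ ‖v‖ ≤ 2 * a then node v b (prune a l (x + v)) (prune a r (x + -v)) else leaf

/-- `x` is the position in the original game and `z.x` that in the restarted one; their difference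
stays constant. A move is made only from `‖x‖ ≤ a`, so the new position has norm at most `a + a + 2
* a`. -/
lemma mean_prune_eq_zero (a : ℝ) (S : SignTree V) (x : V) (z : MaxState V)
    (hx : ‖x - z.x‖ ≤ a) (hm : z.m ≤ 4 * a) :
    mean maxStep (fun z => if 4 * a < z.m then (1 : ℝ) else 0) (prune a S x) z = 0 := by
  induction S generalizing x z with
  | leaf => simp [prune, mean, hm]
  | node v b l r hl hr =>
    by_cases h : ‖x‖ ≤ a ∧ ‖v‖ ≤ 2 * a
    · have key : ∀ v' : V, ‖v'‖ ≤ 2 * a → (maxStep z v' b).m ≤ 4 * a := by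
        intro v' hv'
        refine max_le hm ?_
        have h6 : z.x + v' = x - (x - z.x) + v' := by abel
        rw [h6]
        linarith [norm_add_le (x - (x - z.x)) v', norm_sub_le x (x - z.x)]
      simp only [prune, h, and_self, if_true, mean]
      rw [hl _ _ _ (key v h.2), hr _ _ _ (key (-v) (by rw [norm_neg]; exact h.2))]
      · simp
      · simpa [maxStep] using hx
      · simpa [maxStep] using hx
    · simp only [prune, h, if_false, mean]
      simp [hm]

lemma mean_eq_zero_of_lt (a t : ℝ) (S : SignTree V) (z : MaxState V) (hz : a < z.m) :
    mean maxStep (fun z => if t < z.M ∧ z.m ≤ a then (1 : ℝ) else 0) S z ≤ 0 := by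
  refine (mean_mono_of_invariant (P := fun z : MaxState V => a < z.m) (ψ := fun _ => 0)
    (fun z v b hz => lt_max_of_lt_left hz) (fun z hz => ?_) S z hz).trans_eq (mean_const 0 S z)
  exact (if_neg fun h => absurd h.2 (not_le.2 hz)).le

/-- On the event that the maximum stays below `a`, pruning changes nothing, because an increment
larger than `2 * a` from inside the ball leads out of it. The two transforms differ by a constant of
norm at most `2 * t`, so crossing `3 * t` in the original forces crossing `t` in the restarted game.
-/
lemma mean_le_mean_prune (a t : ℝ) (S : SignTree V) (z z' : MaxState V) (hm : ‖z.x‖ ≤ z.m)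
    (hy : ‖z.y - z'.y‖ ≤ 2 * t) (hM : 3 * t < z.M → t < z'.M) :
    mean maxStep (fun z => if 3 * t < z.M ∧ z.m ≤ a then (1 : ℝ) else 0) S z ≤
      mean maxStep (fun z => if t < z.M then (1 : ℝ) else 0) (prune a S z.x) z' := by
  have hnn : ∀ S (z : MaxState V),
      0 ≤ mean maxStep (fun z => if t < z.M then (1 : ℝ) else 0) S z :=
    fun S z => mean_nonneg (fun z => by split_ifs <;> norm_num) S z
  induction S generalizing z z' with
  | leaf =>
    simp only [prune, mean]
    split_ifs with h1 h2 h2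
    · exact le_rfl
    · exact absurd (hM h1.1) h2
    · norm_num
    · exact le_rfl
  | node v b l r hl hr =>
    by_cases h : ‖z.x‖ ≤ a ∧ ‖v‖ ≤ 2 * a
    · have key : ∀ v' : V, 3 * t < (maxStep z v' b).M → t < (maxStep z' v' b).M := by
        intro v' h3
        simp only [maxStep] at h3 ⊢
        rcases lt_max_iff.1 h3 with h3 | h3
        · exact lt_max_of_lt_left (hM h3)
        · refine lt_max_of_lt_right ?_
          have h6 : z.y + signed b v' = (z.y - z'.y) + (z'.y + signed b v') := by abel
          rw [h6] at h3
          linarith [norm_add_le (z.y - z'.y) (z'.y + signed b v')]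
      simp only [prune, h, and_self, if_true, mean]
      have h1 := hl (maxStep z v b) (maxStep z' v b) (le_max_right _ _)
        (by simpa [maxStep] using hy) (key v)
      have h2 := hr (maxStep z (-v) b) (maxStep z' (-v) b) (le_max_right _ _)
        (by simpa [maxStep] using hy) (key (-v))
      simp only [maxStep] at h1 h2 ⊢
      linarith
    · refine le_trans ?_ (hnn _ _)
      rw [not_and_or, not_le, not_le] at h
      rcases h with h | h
      · exact mean_eq_zero_of_lt _ _ _ _ (h.trans_le hm)
      · by_cases h' : a < z.m
        · exact mean_eq_zero_of_lt _ _ _ _ h'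
        have key : ∀ v' : V, 2 * a < ‖v'‖ → a < (maxStep z v' b).m := by
          intro v' hv'
          refine lt_max_of_lt_right ?_
          have h6 : v' = (z.x + v') - z.x := by abel
          rw [h6] at hv'
          linarith [norm_sub_le (z.x + v') z.x, not_lt.1 h']
        simp only [mean]
        linarith [mean_eq_zero_of_lt a (3 * t) l _ (key v h),
          mean_eq_zero_of_lt a (3 * t) r _ (key (-v) (by rwa [norm_neg]))]

/-- The good-`λ` inequality. -/
lemma good_lambda {p C : ℝ} (hT : TailBound V p C) {a t : ℝ} (ha : 0 < a) (hat : 2 * a ≤ t)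
    (S : SignTree V) (z : MaxState V) (hm : ‖z.x‖ ≤ z.m) (hy : ‖z.y‖ ≤ z.M) (hM : z.M ≤ 2 * t) :
    mean maxStep (fun z => if 3 * t < z.M ∧ z.m ≤ a then (1 : ℝ) else 0) S z ≤
      C * ((4 * a) ^ p / t ^ p) *
        mean maxStep (fun z => if t < z.M then (1 : ℝ) else 0) S z := by
  have ht : 0 < t := by linarith
  -- On the trivial game both tail probabilities vanish, so the estimate itself gives the sign.
  have hC : 0 ≤ C * ((4 * a) ^ p / t ^ p) := by
    have := hT leaf (4 * a) t (by positivity) ht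
    simpa [mean, start, not_lt.2 ht.le, not_lt.2 (by positivity : 0 ≤ 4 * a)] using this
  have hnn : ∀ S (z : MaxState V),
      0 ≤ mean maxStep (fun z => if t < z.M then (1 : ℝ) else 0) S z :=
    fun S z => mean_nonneg (fun z => by split_ifs <;> norm_num) S z
  -- Once `M` has passed `t`, the remaining game is pruned and restarted from zero. The tail
  -- estimate at level `4 * a` then has no probability term on its right-hand side.
  have large : ∀ (S : SignTree V) (z : MaxState V), ‖z.x‖ ≤ z.m → ‖z.y‖ ≤ z.M → z.M ≤ 2 * t →
      t < z.M → mean maxStep (fun z => if 3 * t < z.M ∧ z.m ≤ a then (1 : ℝ) else 0) S z ≤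
      C * ((4 * a) ^ p / t ^ p) *
        mean maxStep (fun z => if t < z.M then (1 : ℝ) else 0) S z := by
    intro S z hm hy hM htM
    have h1 : mean maxStep (fun z => if t < z.M then (1 : ℝ) else 0) S z = 1 := by
      refine le_antisymm ?_ ?_
      · exact (mean_mono (fun z => by split_ifs <;> norm_num) S z).trans_eq
          (mean_const (step := maxStep) 1 S z)
      · refine (mean_const (step := maxStep) 1 S z).symm.trans_le ?_
        refine mean_mono_of_invariant (P := fun z : MaxState V => t < z.M) ?_ ?_ S z htM
        · intro z v b hz
          exact lt_max_of_lt_left hz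
        · intro z hz
          rw [if_pos hz]
    rw [h1, mul_one]
    by_cases hma : a < z.m
    · exact (mean_eq_zero_of_lt _ _ _ _ hma).trans hC
    · have h2 := mean_le_mean_prune a t S z start hm (by simpa [start] using hy.trans hM)
        (fun h => by linarith)
      have h3 := hT (prune a S z.x) (4 * a) t (by positivity) ht
      rw [mean_prune_eq_zero a S z.x start
        (by simpa [start] using hm.trans (not_lt.1 hma)) (by simp [start]; positivity)] at h3
      linarith
  induction S generalizing z with
  | leaf =>
    by_cases h : t < z.M
    · exact large _ _ hm hy hM h
    · refine le_trans (le_of_eq ?_) (mul_nonneg hC (hnn _ _))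
      simp only [mean]
      rw [if_neg]
      intro h'
      linarith [h'.1]
  | node v b l r hl hr =>
    by_cases h : t < z.M
    · exact large _ _ hm hy hM h
    by_cases hma : a < z.m
    · exact (mean_eq_zero_of_lt _ _ _ _ hma).trans (mul_nonneg hC (hnn _ _))
    by_cases hv : 2 * a < ‖v‖
    · have key : ∀ v' : V, 2 * a < ‖v'‖ → a < (maxStep z v' b).m := by
        intro v' hv'
        refine lt_max_of_lt_right ?_
        have h6 : v' = (z.x + v') - z.x := by abel
        rw [h6] at hv'
        linarith [norm_sub_le (z.x + v') z.x, not_lt.1 hma]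
      refine le_trans ?_ (mul_nonneg hC (hnn _ _))
      simp only [mean]
      linarith [mean_eq_zero_of_lt a (3 * t) l _ (key v hv),
        mean_eq_zero_of_lt a (3 * t) r _ (key (-v) (by rwa [norm_neg]))]
    -- Before the crossing of `t`, a relevant increment has norm at most `2 * a ≤ t`, so `M`
    -- overshoots to at most `2 * t`.
    · have key : ∀ v' : V, ‖v'‖ ≤ 2 * a → (maxStep z v' b).M ≤ 2 * t := by
        intro v' hv'
        refine max_le hM ?_
        have := norm_add_le z.y (signed b v')
        rw [norm_signed] at this
        linarith [not_lt.1 h]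
      have h1 := hl (maxStep z v b) (le_max_right _ _) (le_max_right _ _) (key v (not_lt.1 hv))
      have h2 := hr (maxStep z (-v) b) (le_max_right _ _) (le_max_right _ _)
        (key (-v) (by rw [norm_neg]; exact not_lt.1 hv))
      simp only [mean]
      linarith

/-- The tail estimate for games implies an `L²` estimate for games. -/
lemma exists_mean_sq_le [NormedSpace ℝ V] {p C : ℝ} (hp : 0 < p) (hC : 0 < C) (hT : TailBound V p C) :
    ∃ B : ℝ, 0 < B ∧ ∀ S : SignTree V,
      mean pairStep (fun z => ‖z.2‖ ^ 2 - B * ‖z.1‖ ^ 2) S (0, 0) ≤ 0 := by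
  -- Comparing `M / 3` with `M` costs the factor `1 / 9` in `L²`; making the good-`λ` constant `1 /
  -- 18` allows half of it to be absorbed. All means over a finite game are finite, so the
  -- absorption is legitimate. With Doob's factor `4` this gives `18 * 4 / δ ^ 2`.
  obtain ⟨δ, hδ, hδ2, hδC⟩ : ∃ δ : ℝ, 0 < δ ∧ 2 * δ ≤ 1 ∧ C * (4 * δ) ^ p ≤ 1 / 18 := by
    refine ⟨min (1 / 2) ((1 / (18 * C)) ^ (1 / p) / 4), by positivity, ?_, ?_⟩
    · linarith [min_le_left (1 / 2) ((1 / (18 * C)) ^ (1 / p) / 4)]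
    · calc C * (4 * min (1 / 2) ((1 / (18 * C)) ^ (1 / p) / 4)) ^ p
          ≤ C * ((1 / (18 * C)) ^ (1 / p)) ^ p := by
            gcongr
            linarith [min_le_right (1 / 2) ((1 / (18 * C)) ^ (1 / p) / 4)]
        _ = 1 / 18 := by
            rw [← Real.rpow_mul (by positivity), one_div_mul_cancel hp.ne', Real.rpow_one]
            field_simp
  refine ⟨72 / δ ^ 2, by positivity, fun S => ?_⟩
  have hpt : ∀ a : ℝ, 0 < a → mean maxStep (fun z => if a < z.M / 3 then (1 : ℝ) else 0) S start ≤
      mean maxStep (fun z => if a < z.m / δ then (1 : ℝ) else 0) S start +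
        1 / 18 * mean maxStep (fun z => if a < z.M then (1 : ℝ) else 0) S start := by
    intro a ha
    have h1 := good_lambda hT (a := δ * a) (t := a) (by positivity) (by nlinarith) S start
      (by simp [start]) (by simp [start]) (by simp [start]; positivity)
    have h2 : (4 * (δ * a)) ^ p / a ^ p = (4 * δ) ^ p := by
      rw [← mul_assoc, Real.mul_rpow (by positivity) ha.le]
      field_simp
    rw [h2] at h1
    have h3 : mean maxStep (fun z => if a < z.M / 3 then (1 : ℝ) else 0) S start ≤
        mean maxStep (fun z => (if a < z.m / δ then (1 : ℝ) else 0) +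
          if 3 * a < z.M ∧ z.m ≤ δ * a then 1 else 0) S start := by
      refine mean_mono (fun z => ?_) S start
      by_cases h : z.m ≤ δ * a
      · have h' : ¬ a < z.m / δ := by rw [not_lt, div_le_iff₀ hδ]; linarith
        have h'' : a < z.M / 3 ↔ 3 * a < z.M := by rw [lt_div_iff₀ (by norm_num), mul_comm]
        simp [h, h', h'']
      · have h' : a < z.m / δ := by rw [lt_div_iff₀ hδ]; linarith
        simp only [h', h, if_true, and_false, if_false]
        split_ifs <;> norm_num
    rw [mean_add] at h3
    have h4 : 0 ≤ mean maxStep (fun z => if a < z.M then (1 : ℝ) else 0) S start :=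
      mean_nonneg (fun z => by split_ifs <;> norm_num) S _
    nlinarith
  have hint : ENNReal.ofReal (mean maxStep (fun z => max (z.M / 3) 0 ^ 2) S start) ≤
      ENNReal.ofReal (mean maxStep (fun z => max (z.m / δ) 0 ^ 2) S start) +
      ENNReal.ofReal (1 / 18) *
        ENNReal.ofReal (mean maxStep (fun z => max z.M 0 ^ 2) S start) := by
    have hmeas : ∀ c : ℝ, Measurable fun a : ℝ => if a < c then (1 : ℝ) else 0 := fun c =>
      Measurable.ite measurableSet_Iio measurable_const measurable_const
    rw [← lintegral_mean_lt, ← lintegral_mean_lt, ← lintegral_mean_lt,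
      ← lintegral_const_mul' _ _ ENNReal.ofReal_ne_top, ← lintegral_add_left]
    · refine setLIntegral_mono' measurableSet_Ioi fun a ha => ?_
      have ha' : (0 : ℝ) < a := ha
      have hnn : ∀ g : MaxState V → ℝ,
          0 ≤ mean maxStep (fun z => if a < g z then (1 : ℝ) else 0) S start :=
        fun g => mean_nonneg (fun z => by split_ifs <;> norm_num) S _
      rw [← ENNReal.ofReal_mul (by norm_num), ← ENNReal.ofReal_add
        (mul_nonneg (by positivity) (hnn _))
        (mul_nonneg (by norm_num) (mul_nonneg (by positivity) (hnn _)))]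
      refine ENNReal.ofReal_le_ofReal ?_
      nlinarith [hpt a ha']
    · exact ((measurable_const.mul measurable_id).mul
        (measurable_mean (fun z => hmeas _) S _)).ennreal_ofReal
  have hsq : ∀ g : MaxState V → ℝ, 0 ≤ mean maxStep (fun z => max (g z) 0 ^ 2) S start :=
    fun g => mean_nonneg (fun z => by positivity) S _
  rw [← ENNReal.ofReal_mul (by norm_num), ← ENNReal.ofReal_add (hsq _)
    (mul_nonneg (by norm_num) (hsq _)), ENNReal.ofReal_le_ofReal_iff
    (add_nonneg (hsq _) (mul_nonneg (by norm_num) (hsq _)))] at hint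
  have h3 : mean maxStep (fun z : MaxState V => max (z.M / 3) 0 ^ 2) S start =
      1 / 9 * mean maxStep (fun z => max z.M 0 ^ 2) S start := by
    rw [← mean_const_mul]
    congr 1
    ext z
    rcases le_total z.M 0 with h | h
    · rw [max_eq_right h, max_eq_right (by linarith)]; ring
    · rw [max_eq_left h, max_eq_left (by linarith)]; ring
  have h4 : mean maxStep (fun z => max (z.m / δ) 0 ^ 2) S start ≤
      1 / δ ^ 2 * mean maxStep (fun z => z.m ^ 2) S start := by
    rw [← mean_const_mul]
    refine mean_mono (fun z => ?_) S start
    rcases le_total z.m 0 with h | h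
    · rw [max_eq_right (div_nonpos_of_nonpos_of_nonneg h hδ.le), zero_pow two_ne_zero]; positivity
    · rw [max_eq_left (div_nonneg h hδ.le)]; apply le_of_eq; field_simp
  have h5 := mean_sq_max_le S start (by simp [start])
  have h6 : mean maxStep (fun z => ‖z.y‖ ^ 2) S start ≤
      mean maxStep (fun z => max z.M 0 ^ 2) S start := by
    refine mean_mono_of_invariant (P := fun z : MaxState V => ‖z.y‖ ≤ z.M)
      (fun z v b _ => le_max_right _ _) (fun z hz => ?_) S start (by simp [start])
    gcongr
    exact hz.trans (le_max_left _ _)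
  have h7 := mean_comp (step := maxStep) (step' := pairStep) (fun z : MaxState V => (z.x, z.y))
    (fun _ _ _ => rfl) (fun z => ‖z.2‖ ^ 2 - 72 / δ ^ 2 * ‖z.1‖ ^ 2) S start
  have h8 : mean maxStep (fun z : MaxState V => ‖z.y‖ ^ 2 - 72 / δ ^ 2 * ‖z.x‖ ^ 2) S start =
      mean maxStep (fun z => ‖z.y‖ ^ 2) S start -
        72 / δ ^ 2 * mean maxStep (fun z => ‖z.x‖ ^ 2) S start := by
    rw [sub_eq_add_neg, ← neg_mul, ← mean_const_mul, ← mean_add]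
    congr 1
    ext z
    ring
  have h9 : mean pairStep (fun z : V × V => ‖z.2‖ ^ 2 - 72 / δ ^ 2 * ‖z.1‖ ^ 2) S (0, 0) =
    mean maxStep (fun z => ‖z.y‖ ^ 2) S start -
        72 / δ ^ 2 * mean maxStep (fun z => ‖z.x‖ ^ 2) S start := by
    rw [← h8]
    exact h7.symm
  rw [h9, sub_nonpos]
  have h10 : mean maxStep (fun z => z.m ^ 2) S start ≤
      4 * mean maxStep (fun z : MaxState V => ‖z.x‖ ^ 2) S start := by
    simpa [start] using h5
  have h11 : 1 / δ ^ 2 * mean maxStep (fun z : MaxState V => z.m ^ 2) S start ≤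
      1 / δ ^ 2 * (4 * mean maxStep (fun z : MaxState V => ‖z.x‖ ^ 2) S start) := by gcongr
  have h12 : 72 / δ ^ 2 * mean maxStep (fun z : MaxState V => ‖z.x‖ ^ 2) S start =
      18 * (1 / δ ^ 2 * (4 * mean maxStep (fun z : MaxState V => ‖z.x‖ ^ 2) S start)) := by ring
  linarith

end Maximal

end SignTree

/-! ### Coin-tossing spaces and the measure-preserving reversal of one toss. -/

/-- The space of `K` fair coin tosses. -/
def Coins (K : ℕ) : Type w := ULift.{w} (Fin K → Bool)

namespace Coins

variable {K : ℕ}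

instance : Finite (Coins.{w} K) := inferInstanceAs (Finite (ULift.{w} (Fin K → Bool)))

instance : Nonempty (Coins.{w} K) := inferInstanceAs (Nonempty (ULift.{w} (Fin K → Bool)))

instance : MeasurableSpace (Coins.{w} K) := ⊤

instance : DiscreteMeasurableSpace (Coins.{w} K) := ⟨fun _ => trivial⟩

/-- The law of `K` fair coin tosses. -/
noncomputable def law (K : ℕ) : Measure (Coins.{w} K) := uniformOn Set.univ

instance : IsProbabilityMeasure (law.{w} K) :=
  isProbabilityMeasure_uniformOn Set.finite_univ Set.univ_nonempty

/-- The result of the `k`-th toss. -/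
def coin (k : ℕ) (ω : Coins.{w} K) : Bool := if h : k < K then ω.down ⟨k, h⟩ else false

/-- Reverse the result of the `k`-th toss. -/
def flip (k : ℕ) (ω : Coins.{w} K) : Coins.{w} K :=
  ⟨fun j => if (j : ℕ) = k then !ω.down j else ω.down j⟩

/-- Forget the results of the tosses from the `k`-th one on. -/
def truncate (k : ℕ) (ω : Coins.{w} K) : Coins.{w} K :=
  ⟨fun j => if (j : ℕ) < k then ω.down j else false⟩

lemma coin_flip_of_ne {j k : ℕ} (h : j ≠ k) (ω : Coins.{w} K) : coin j (flip k ω) = coin j ω := by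
  simp [coin, flip, h]

lemma coin_flip {k : ℕ} (h : k < K) (ω : Coins.{w} K) : coin k (flip k ω) = !coin k ω := by
  simp [coin, flip, h]

lemma coin_truncate {j k : ℕ} (h : j < k) (ω : Coins.{w} K) :
    coin j (truncate k ω) = coin j ω := by
  simp [coin, truncate, h]

lemma flip_flip (k : ℕ) (ω : Coins.{w} K) : flip k (flip k ω) = ω := by
  refine ULift.down_injective (funext fun j => ?_)
  by_cases h : (j : ℕ) = k <;> simp [flip, h]

lemma truncate_flip {j k : ℕ} (h : j ≤ k) (ω : Coins.{w} K) :
    truncate j (flip k ω) = truncate j ω := by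
  refine ULift.down_injective (funext fun i => ?_)
  by_cases hi : (i : ℕ) < j
  · have : (i : ℕ) ≠ k := by omega
    simp [flip, truncate, this]
  · simp [truncate, hi]

lemma truncate_truncate {j k : ℕ} (h : j ≤ k) (ω : Coins.{w} K) :
    truncate j (truncate k ω) = truncate j ω := by
  refine ULift.down_injective (funext fun i => ?_)
  by_cases hi : (i : ℕ) < j
  · have : (i : ℕ) < k := by omega
    simp [truncate, this]
  · simp [truncate, hi]

lemma measurePreserving_flip (k : ℕ) :
    MeasurePreserving (flip k) (law.{w} K) (law.{w} K) := by
  have hinv : Function.Involutive (flip k : Coins.{w} K → Coins.{w} K) := flip_flip k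
  cases nonempty_fintype (Coins.{w} K)
  refine ⟨Measurable.of_discrete, Measure.ext fun s _ => ?_⟩
  rw [Measure.map_apply Measurable.of_discrete .of_discrete, law, uniformOn_univ, uniformOn_univ]
  congr 1
  rw [Measure.count_apply .of_discrete, Measure.count_apply .of_discrete,
    ← hinv.image_eq_preimage_symm, hinv.injective.encard_image]

lemma integral_flip {E : Type*} [NormedAddCommGroup E] [NormedSpace ℝ E] (k : ℕ)
    (F : Coins.{w} K → E) :
    ∫ ω, F (flip k ω) ∂law K = ∫ ω, F ω ∂law K := by
  have h := (measurePreserving_flip.{w} (K := K) k).map_eq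
  conv_rhs => rw [← h]
  rw [integral_map Measurable.of_discrete.aemeasurable
    StronglyMeasurable.of_discrete.aestronglyMeasurable]

/-- The filtration generated by the tosses; at time `k` the tosses `0, …, k - 1` are known. -/
def filtration (K : ℕ) : Filtration ℕ (inferInstance : MeasurableSpace (Coins.{w} K)) where
  seq k := MeasurableSpace.comap (truncate k) ⊤
  mono' := by
    rintro i j h _ ⟨B, -, rfl⟩
    refine ⟨truncate i ⁻¹' B, trivial, ?_⟩
    ext ω
    simp [truncate_truncate h]
  le' _ _ _ := trivial

lemma flip_mem_iff {j k : ℕ} (h : j ≤ k) {A : Set (Coins.{w} K)}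
    (hA : MeasurableSet[filtration K j] A) (ω : Coins.{w} K) : flip k ω ∈ A ↔ ω ∈ A := by
  obtain ⟨B, -, rfl⟩ := hA
  simp [truncate_flip h]

lemma stronglyMeasurable_of_truncate {E : Type*} [TopologicalSpace E] {k : ℕ}
    {F : Coins.{w} K → E} (h : ∀ ω, F (truncate k ω) = F ω) :
    StronglyMeasurable[filtration K k] F := by
  have h1 : F = F ∘ truncate k := funext fun ω => (h ω).symm
  rw [h1]
  exact (StronglyMeasurable.of_discrete (f := F)).comp_measurable
    (Measurable.of_comap_le le_rfl)

/-- A function whose conditional expectation is odd in the `k`-th toss. -/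
lemma condExp_eq_zero_of_flip {E : Type*} [NormedAddCommGroup E] [NormedSpace ℝ E]
    [CompleteSpace E] (k : ℕ) (F : Coins.{w} K → E) (hF : ∀ ω, F (flip k ω) = -F ω) :
    (law K)[F | filtration K k] =ᵐ[law K] 0 := by
  symm
  refine ae_eq_condExp_of_forall_setIntegral_eq ((filtration K).le k) Integrable.of_finite
    (fun _ _ _ => Integrable.of_finite.integrableOn) (fun A hA _ => ?_)
    stronglyMeasurable_zero.aestronglyMeasurable
  -- An event known at time `k` is invariant under reversing toss `k`, while `F` changes sign.
  have h1 : ∫ ω in A, F ω ∂law K = -∫ ω in A, F ω ∂law K := by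
    rw [← integral_neg, ← integral_indicator .of_discrete, ← integral_indicator .of_discrete,
      ← integral_flip k]
    congr 1
    ext ω
    by_cases h : ω ∈ A
    · rw [Set.indicator_of_mem h, Set.indicator_of_mem ((flip_mem_iff le_rfl hA ω).2 h), hF]
    · rw [Set.indicator_of_notMem h,
        Set.indicator_of_notMem (fun h' => h ((flip_mem_iff le_rfl hA ω).1 h'))]
  have h2 : (2 : ℝ) • ∫ ω in A, F ω ∂law K = 0 := by
    rw [two_smul]
    nth_rewrite 1 [h1]
    exact neg_add_cancel _
  rw [(smul_eq_zero_iff_right two_ne_zero).1 h2]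
  simp

lemma condExp_preimage_eq_of_flip {E : Type*} (k : ℕ) (F G : Coins.{w} K → E)
    (hF : ∀ ω, F (flip k ω) = G ω) (B : Set E) :
    (law K)⟦F ⁻¹' B | filtration K k⟧ =ᵐ[law K] (law K)⟦G ⁻¹' B | filtration K k⟧ := by
  refine ae_eq_condExp_of_forall_setIntegral_eq ((filtration K).le k) Integrable.of_finite
    (fun _ _ _ => integrable_condExp.integrableOn) (fun A hA _ => ?_)
    stronglyMeasurable_condExp.aestronglyMeasurable
  rw [setIntegral_condExp _ Integrable.of_finite hA, ← integral_indicator .of_discrete,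
    ← integral_indicator .of_discrete, ← integral_flip k]
  congr 1
  ext ω
  have h1 : flip k ω ∈ A ↔ ω ∈ A := flip_mem_iff le_rfl hA ω
  have h2 : flip k ω ∈ F ⁻¹' B ↔ ω ∈ G ⁻¹' B := by simp [hF]
  by_cases hA' : ω ∈ A <;> by_cases hB' : ω ∈ G ⁻¹' B <;>
    simp only [Set.indicator, h1, h2, hA', hB', if_true, if_false]

end Coins

/-! ### Games played in real time with deterministic alternating signs. -/

namespace SignTree

variable {V : Type u}

/-- The number of rounds of a game. -/
def depth : SignTree V → ℕ
  | leaf => 0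
  | node _ _ l r => max l.depth r.depth + 1

/-- Whether a node with sign `b` is played at time `k`: signs alternate in time, and only `K` coins
are available. -/
def Active (K k : ℕ) (b : Bool) : Prop := b = k.bodd ∧ k < K

instance (K k : ℕ) (b : Bool) : Decidable (Active K k b) :=
  inferInstanceAs (Decidable (_ ∧ _))

/-- The game that remains after time `k` when the toss is `c`. -/
def advance (K k : ℕ) (c : Bool) : SignTree V → SignTree V
  | leaf => leaf
  | node v b l r => if Active K k b then (if c then l else r) else node v b l r

/-- The increment at time `k` when the toss is `c`. -/
def increment [NegZeroClass V] (K k : ℕ) (c : Bool) : SignTree V → V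
  | leaf => 0
  | node v b _ _ => if Active K k b then signed c v else 0

variable {K : ℕ}

/-- The game that remains at time `k`. -/
def remaining (S : SignTree V) (ω : Coins.{w} K) : ℕ → SignTree V
  | 0 => S
  | k + 1 => advance K k (Coins.coin k ω) (remaining S ω k)

/-- The increment of the game at time `k`. -/
def inc [NegZeroClass V] (S : SignTree V) (k : ℕ) (ω : Coins.{w} K) : V :=
  increment K k (Coins.coin k ω) (remaining S ω k)

lemma remaining_congr (S : SignTree V) {ω ω' : Coins.{w} K} (k : ℕ)
    (h : ∀ j < k, Coins.coin j ω = Coins.coin j ω') : remaining S ω k = remaining S ω' k := by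
  induction k with
  | zero => rfl
  | succ k ih => rw [remaining, remaining, ih fun j hj => h j (hj.trans k.lt_succ_self),
      h k k.lt_succ_self]

lemma inc_truncate [NegZeroClass V] (S : SignTree V) {j k : ℕ} (h : j < k) (ω : Coins.{w} K) :
    inc S j (Coins.truncate k ω) = inc S j ω := by
  rw [inc, inc, Coins.coin_truncate h,
    remaining_congr S j fun i hi => Coins.coin_truncate (hi.trans h) ω]

lemma remaining_flip (S : SignTree V) (k : ℕ) (ω : Coins.{w} K) :
    remaining S (Coins.flip k ω) k = remaining S ω k :=
  remaining_congr S k fun _ hj => Coins.coin_flip_of_ne hj.ne ω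

lemma inc_flip_of_lt [NegZeroClass V] (S : SignTree V) {j k : ℕ} (h : j < k) (ω : Coins.{w} K) :
    inc S j (Coins.flip k ω) = inc S j ω := by
  rw [inc, inc, Coins.coin_flip_of_ne h.ne,
    remaining_congr S j fun i hi => Coins.coin_flip_of_ne (hi.trans h).ne ω]

lemma inc_flip [AddGroup V] (S : SignTree V) (k : ℕ) (ω : Coins.{w} K) :
    inc S k (Coins.flip k ω) = -inc S k ω := by
  rw [inc, inc, remaining_flip]
  cases h : remaining S ω k with
  | leaf => simp [increment]
  | node v b l r =>
    by_cases ha : Active K k b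
    · simp only [increment, ha, if_true, Coins.coin_flip ha.2]
      cases Coins.coin k ω <;> simp [signed]
    · simp [increment, ha]

lemma depth_advance_le (k : ℕ) (c : Bool) (S : SignTree V) : (advance K k c S).depth ≤ S.depth := by
  cases S with
  | leaf => exact le_rfl
  | node v b l r =>
    by_cases ha : Active K k b
    · simp only [advance, ha, if_true, depth]
      split_ifs <;> omega
    · simp only [advance, ha, if_false]; exact le_rfl

/-- A node waits until the parity of time agrees with its sign. Two consecutive times have both
parities, so within them at least one round is played; this is how signs depending on the node
become signs depending only on time. -/
lemma depth_advance_advance (k : ℕ) (hk : k + 1 < K) (c c' : Bool) (S : SignTree V) :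
    (advance K (k + 1) c' (advance K k c S)).depth ≤ S.depth - 1 := by
  cases S with
  | leaf => exact le_rfl
  | node v b l r =>
    by_cases hb : b = k.bodd
    · refine (depth_advance_le _ _ _).trans ?_
      have ha : Active K k b := ⟨hb, by omega⟩
      simp only [advance, ha, if_true, depth]
      split_ifs <;> omega
    · have ha : ¬ Active K k b := fun h => hb h.1
      have ha' : Active K (k + 1) b :=
        ⟨by rw [Nat.bodd_succ]; revert hb; cases b <;> cases k.bodd <;> simp, hk⟩
      simp only [advance, ha, ha', if_true, if_false, depth]
      split_ifs <;> omega

lemma depth_remaining_le (S : SignTree V) (ω : Coins.{w} K) (n : ℕ) (hn : 2 * n ≤ K) :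
    (remaining S ω (2 * n)).depth ≤ S.depth - n := by
  induction n with
  | zero => simp [remaining]
  | succ n ih =>
    have h1 := depth_advance_advance (K := K) (2 * n) (by omega) (Coins.coin (2 * n) ω)
      (Coins.coin (2 * n + 1) ω) (remaining S ω (2 * n))
    have h2 := ih (by omega)
    have h3 : remaining S ω (2 * (n + 1)) = advance K (2 * n + 1) (Coins.coin (2 * n + 1) ω)
      (advance K (2 * n) (Coins.coin (2 * n) ω) (remaining S ω (2 * n))) := rfl
    rw [h3]
    omega

lemma remaining_eq_leaf (S : SignTree V) (ω : Coins.{w} (2 * S.depth)) :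
    remaining S ω (2 * S.depth) = leaf := by
  have h := depth_remaining_le S ω S.depth le_rfl
  cases h' : remaining S ω (2 * S.depth) with
  | leaf => rfl
  | node v b l r => rw [h'] at h; simp [depth] at h

section Realization

variable [AddGroup V] {Z : Type*}

/-- The state at time `k`. -/
def state (step : Z → V → Bool → Z) (z : Z) (S : SignTree V) (ω : Coins.{w} K) : ℕ → Z
  | 0 => z
  | k + 1 => step (state step z S ω k) (inc S k ω) k.bodd

lemma state_flip (step : Z → V → Bool → Z) (z : Z) (S : SignTree V) (ω : Coins.{w} K) {j k : ℕ}
    (h : j ≤ k) : state step z S (Coins.flip k ω) j = state step z S ω j := by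
  induction j with
  | zero => rfl
  | succ j ih => rw [state, state, ih (by omega), inc_flip_of_lt S (by omega)]

/-- At an active node, the two outcomes of toss `k` are the two branches, so averaging over them is
the recursion for `mean`. At an inactive time the increment is `0`, and `hz` ensures that a null
move keeps the state; for `maxStep` this holds only where the maxima dominate the current norms. -/
lemma mean_remaining_add (step : Z → V → Bool → Z) (φ : Z → ℝ) (z : Z) (S : SignTree V) (k : ℕ)
    (hz : ∀ (ω : Coins.{w} K) b, step (state step z S ω k) 0 b = state step z S ω k)
    (ω : Coins.{w} K) :
    mean step φ (remaining S ω (k + 1)) (state step z S ω (k + 1)) +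
      mean step φ (remaining S (Coins.flip k ω) (k + 1)) (state step z S (Coins.flip k ω) (k + 1)) =
    2 * mean step φ (remaining S ω k) (state step z S ω k) := by
  simp only [remaining, state, inc, remaining_flip, state_flip step z S ω (le_refl k)]
  cases h : remaining S ω k with
  | leaf => simp only [advance, increment, hz]; ring
  | node v b l r =>
    by_cases ha : Active K k b
    · simp only [increment, advance, ha, if_true, Coins.coin_flip ha.2, mean]
      rw [← ha.1]
      cases Coins.coin k ω <;> simp [signed] <;> ring
    · simp only [increment, advance, ha, if_false, hz]; ring

/-- The expected value of a game is an expected value over coin tosses. -/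
lemma mean_eq_integral (step : Z → V → Bool → Z) (φ : Z → ℝ) (z : Z) (S : SignTree V)
    (hz : ∀ k (ω : Coins.{w} (2 * S.depth)) b,
      step (state step z S ω k) 0 b = state step z S ω k) :
    mean step φ S z = ∫ ω, φ (state step z S ω (2 * S.depth)) ∂Coins.law.{w} (2 * S.depth) := by
  have key : ∀ k, ∫ ω, mean step φ (remaining S ω k) (state step z S ω k)
      ∂Coins.law.{w} (2 * S.depth) = mean step φ S z := by
    intro k
    induction k with
    | zero => simp [remaining, state]
    | succ k ih =>
      rw [← ih]
      have h1 := integral_congr_ae (μ := Coins.law.{w} (2 * S.depth))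
        (ae_of_all _ (mean_remaining_add step φ z S k (hz k)))
      rw [integral_add Integrable.of_finite Integrable.of_finite, integral_const_mul,
        Coins.integral_flip k (fun ω => mean step φ (remaining S ω (k + 1))
          (state step z S ω (k + 1)))] at h1
      linarith
  rw [← key (2 * S.depth)]
  simp only [remaining_eq_leaf, mean]

end Realization

end SignTree

/-! ### Estimates for games deduced from the tail estimate and from UMD. -/

lemma eLpNorm_le_ofReal_mul_iff {Ω E F : Type*} {mΩ : MeasurableSpace Ω} {μ : Measure Ω}
    [NormedAddCommGroup E] [NormedAddCommGroup F] {r β : ℝ} (hr : 0 < r) (hβ : 0 ≤ β)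
    {f : Ω → E} {g : Ω → F} (hf : MemLp f (ENNReal.ofReal r) μ) (hg : MemLp g (ENNReal.ofReal r) μ) :
    eLpNorm f (ENNReal.ofReal r) μ ≤ ENNReal.ofReal β * eLpNorm g (ENNReal.ofReal r) μ ↔
      ∫ ω, ‖f ω‖ ^ r ∂μ ≤ β ^ r * ∫ ω, ‖g ω‖ ^ r ∂μ := by
  have h0 : ENNReal.ofReal r ≠ 0 := by simpa using hr
  have hF : 0 ≤ ∫ ω, ‖f ω‖ ^ r ∂μ := integral_nonneg fun _ => by positivity
  have hG : 0 ≤ ∫ ω, ‖g ω‖ ^ r ∂μ := integral_nonneg fun _ => by positivity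
  rw [hf.eLpNorm_eq_integral_rpow_norm h0 ENNReal.ofReal_ne_top,
    hg.eLpNorm_eq_integral_rpow_norm h0 ENNReal.ofReal_ne_top, ENNReal.toReal_ofReal hr.le,
    ← ENNReal.ofReal_mul hβ, ENNReal.ofReal_le_ofReal_iff (by positivity)]
  constructor
  · intro h
    have h1 := Real.rpow_le_rpow (by positivity) h hr.le
    rwa [Real.mul_rpow hβ (by positivity), ← Real.rpow_mul hF, ← Real.rpow_mul hG,
      inv_mul_cancel₀ hr.ne', Real.rpow_one, Real.rpow_one] at h1
  · intro h
    have h1 := Real.rpow_le_rpow hF h (inv_nonneg.2 hr.le)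
    rwa [Real.mul_rpow (by positivity) hG, ← Real.rpow_mul hβ, mul_inv_cancel₀ hr.ne',
      Real.rpow_one] at h1

lemma ofReal_lt_maximalFunction_iff {Ω V : Type*} [NormedAddCommGroup V] {f : ℕ → Ω → V}
    (h0 : f 0 = 0) {s : ℝ} (hs : 0 < s) (ω : Ω) :
    ENNReal.ofReal s < maximalFunction f ω ↔ ∃ n, s < ‖f n ω‖ := by
  simp only [maximalFunction, lt_iSup_iff, ← ofReal_norm,
    ENNReal.ofReal_lt_ofReal_iff_of_nonneg hs.le]
  constructor
  · rintro ⟨n, -, h⟩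
    exact ⟨n, h⟩
  · rintro ⟨n, h⟩
    refine ⟨n, Nat.one_le_iff_ne_zero.2 ?_, h⟩
    rintro rfl
    simp [h0] at h
    linarith

namespace SignTree

section

variable {V : Type u} [NormedAddCommGroup V] {K : ℕ}

lemma inc_eq_zero_of_le (S : SignTree V) {k : ℕ} (h : K ≤ k) (ω : Coins.{w} K) :
    inc S k ω = 0 := by
  rw [inc]
  cases remaining S ω k with
  | leaf => rfl
  | node v b l r => exact if_neg fun h' => absurd h'.2 (not_lt.2 h)

lemma signed_zero (b : Bool) : signed b (0 : V) = 0 := by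
  cases b <;> simp [signed]

/-- The process of partial sums of the increments. -/
def walk (S : SignTree V) (n : ℕ) (ω : Coins.{w} K) : V := ∑ j ∈ Finset.range n, inc S j ω

/-- The transform of `walk` by alternating signs. -/
def transformedWalk (S : SignTree V) (n : ℕ) (ω : Coins.{w} K) : V :=
  ∑ j ∈ Finset.range n, signed j.bodd (inc S j ω)

lemma state_pairStep (S : SignTree V) (ω : Coins.{w} K) (k : ℕ) :
    state pairStep (0, 0) S ω k = (walk S k ω, transformedWalk S k ω) := by
  induction k with
  | zero => simp [state, walk, transformedWalk]
  | succ k ih =>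
    simp [state, ih, pairStep, walk, transformedWalk, Finset.sum_range_succ]

lemma state_maxStep_x (S : SignTree V) (ω : Coins.{w} K) (k : ℕ) :
    (state maxStep start S ω k).x = walk S k ω := by
  induction k with
  | zero => simp [state, walk, start]
  | succ k ih => simp [state, maxStep, walk, Finset.sum_range_succ, ih]

lemma state_maxStep_y (S : SignTree V) (ω : Coins.{w} K) (k : ℕ) :
    (state maxStep start S ω k).y = transformedWalk S k ω := by
  induction k with
  | zero => simp [state, transformedWalk, start]
  | succ k ih => simp [state, maxStep, transformedWalk, Finset.sum_range_succ, ih]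

lemma lt_state_m_iff (S : SignTree V) (ω : Coins.{w} K) (k : ℕ) {s : ℝ} :
    s < (state maxStep start S ω k).m ↔ ∃ n ≤ k, s < ‖walk S n ω‖ := by
  induction k with
  | zero => simp [state, walk, start]
  | succ k ih =>
    have h : (state maxStep start S ω (k + 1)).m =
        max (state maxStep start S ω k).m ‖walk S (k + 1) ω‖ := by
      rw [← state_maxStep_x]; rfl
    rw [h, lt_max_iff, ih]
    constructor
    · rintro (⟨n, hn, h⟩ | h)
      · exact ⟨n, by omega, h⟩
      · exact ⟨k + 1, le_rfl, h⟩
    · rintro ⟨n, hn, h⟩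
      rcases Nat.le_succ_iff.1 hn with hn | rfl
      · exact Or.inl ⟨n, hn, h⟩
      · exact Or.inr h

lemma lt_state_M_iff (S : SignTree V) (ω : Coins.{w} K) (k : ℕ) {s : ℝ} :
    s < (state maxStep start S ω k).M ↔ ∃ n ≤ k, s < ‖transformedWalk S n ω‖ := by
  induction k with
  | zero => simp [state, transformedWalk, start]
  | succ k ih =>
    have h : (state maxStep start S ω (k + 1)).M =
        max (state maxStep start S ω k).M ‖transformedWalk S (k + 1) ω‖ := by
      rw [← state_maxStep_y]; rfl
    rw [h, lt_max_iff, ih]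
    constructor
    · rintro (⟨n, hn, h⟩ | h)
      · exact ⟨n, by omega, h⟩
      · exact ⟨k + 1, le_rfl, h⟩
    · rintro ⟨n, hn, h⟩
      rcases Nat.le_succ_iff.1 hn with hn | rfl
      · exact Or.inl ⟨n, hn, h⟩
      · exact Or.inr h

lemma maxStep_zero_state (S : SignTree V) (k : ℕ) (ω : Coins.{w} K) (b : Bool) :
    maxStep (state maxStep start S ω k) 0 b = state maxStep start S ω k := by
  have h : ‖(state maxStep start S ω k).x‖ ≤ (state maxStep start S ω k).m ∧
      ‖(state maxStep start S ω k).y‖ ≤ (state maxStep start S ω k).M := by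
    cases k with
    | zero => simp [state, start]
    | succ k => exact ⟨le_max_right _ _, le_max_right _ _⟩
  simp [maxStep, signed_zero, h.1, h.2]

lemma walk_eq_of_le (S : SignTree V) {n : ℕ} (h : K ≤ n) (ω : Coins.{w} K) :
    walk S n ω = walk S K ω := by
  rw [walk, walk]
  symm
  refine Finset.sum_subset (Finset.range_mono h) fun j _ hj => inc_eq_zero_of_le S ?_ ω
  simpa using hj

lemma exists_lt_walk_iff (S : SignTree V) (ω : Coins.{w} K) (s : ℝ) :
    (∃ n, s < ‖walk S n ω‖) ↔ ∃ n ≤ K, s < ‖walk S n ω‖ := by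
  constructor
  · rintro ⟨n, h⟩
    rcases le_total n K with hn | hn
    · exact ⟨n, hn, h⟩
    · exact ⟨K, le_rfl, by rwa [walk_eq_of_le S hn] at h⟩
  · rintro ⟨n, -, h⟩
    exact ⟨n, h⟩

lemma isDiscreteProcess_walk (S : SignTree V) :
    IsDiscreteProcess (Coins.filtration.{w} K) (walk S) where
  zero := by ext ω; simp [walk]
  adapted n := Coins.stronglyMeasurable_of_truncate fun ω =>
    Finset.sum_congr rfl fun j hj => inc_truncate S (Finset.mem_range.1 hj) ω

lemma isDiscreteProcess_transformedWalk (S : SignTree V) :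
    IsDiscreteProcess (Coins.filtration.{w} K) (transformedWalk S) where
  zero := by ext ω; simp [transformedWalk]
  adapted n := Coins.stronglyMeasurable_of_truncate fun ω =>
    Finset.sum_congr rfl fun j hj => by rw [inc_truncate S (Finset.mem_range.1 hj) ω]

/-- Reversing toss `n` negates the increment and fixes the past, so its conditional law is
symmetric; hence any predictable choice of signs gives tangent processes. -/
lemma condExp_inc_eq (S : SignTree V) (n : ℕ) (b b' : Bool) (B : Set V) :
    (Coins.law.{w} K)⟦(fun ω => signed b (inc S n ω)) ⁻¹' B | Coins.filtration K n⟧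
      =ᵐ[Coins.law K]
    (Coins.law.{w} K)⟦(fun ω => signed b' (inc S n ω)) ⁻¹' B | Coins.filtration K n⟧ := by
  have h := Coins.condExp_preimage_eq_of_flip.{w} (K := K) n (fun ω => signed true (inc S n ω))
    (fun ω => signed false (inc S n ω)) (fun ω => by rw [inc_flip]; simp [signed]) B
  cases b <;> cases b'
  · rfl
  · exact h.symm
  · exact h
  · rfl

lemma tangent_of_increments [MeasurableSpace V] (S : SignTree V)
    {f g : ℕ → Coins.{w} K → V} {b b' : ℕ → Bool}
    (hf : ∀ n ω, f (n + 1) ω - f n ω = signed (b n) (inc S n ω))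
    (hg : ∀ n ω, g (n + 1) ω - g n ω = signed (b' n) (inc S n ω)) :
    Tangent (Coins.filtration.{w} K) (Coins.law K) f g := by
  intro n B _
  have h1 : f (n + 1) - f n = fun ω => signed (b n) (inc S n ω) := funext (hf n)
  have h2 : g (n + 1) - g n = fun ω => signed (b' n) (inc S n ω) := funext (hg n)
  rw [h1, h2]
  exact condExp_inc_eq S n _ _ B

lemma walk_succ_sub (S : SignTree V) (n : ℕ) (ω : Coins.{w} K) :
    walk S (n + 1) ω - walk S n ω = signed true (inc S n ω) := by
  simp [walk, Finset.sum_range_succ, signed]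

lemma transformedWalk_succ_sub (S : SignTree V) (n : ℕ) (ω : Coins.{w} K) :
    transformedWalk S (n + 1) ω - transformedWalk S n ω = signed n.bodd (inc S n ω) := by
  simp [transformedWalk, Finset.sum_range_succ]

lemma signed_not (b : Bool) (v : V) : signed (!b) v = -signed b v := by
  cases b <;> simp [signed]

/-- The tail estimate for tangent conditionally symmetric processes gives one for games. -/
lemma tailBound_of_tangent [MeasurableSpace V] {p C : ℝ}
    (h : ∀ (Ω : Type w) (mΩ : MeasurableSpace Ω) (μ : Measure Ω) (_ : IsProbabilityMeasure μ)
          (ℱ : Filtration ℕ mΩ) (f g : ℕ → Ω → V),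
          IsDiscreteProcess ℱ f → IsDiscreteProcess ℱ g →
          ConditionallySymmetric ℱ μ f → ConditionallySymmetric ℱ μ g → Tangent ℱ μ f g →
          ∀ s t : ℝ, 0 < s → 0 < t →
            μ.real {ω | ENNReal.ofReal t < maximalFunction g ω} ≤
              C * (s ^ p / t ^ p + μ.real {ω | ENNReal.ofReal s < maximalFunction f ω})) :
    TailBound V p C := by
  intro S s t hs ht
  have h1 := h (Coins.{w} (2 * S.depth)) _ (Coins.law _) inferInstance (Coins.filtration _)
    (walk S) (transformedWalk S) (isDiscreteProcess_walk S) (isDiscreteProcess_transformedWalk S)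
    (tangent_of_increments S (b := fun _ => true) (b' := fun _ => false) (walk_succ_sub S)
      (fun n ω => by
        have := walk_succ_sub S n ω
        simp only [Pi.neg_apply, signed, if_true] at this ⊢
        rw [← this]
        simp only [Bool.false_eq_true, if_false]
        abel))
    (tangent_of_increments S (b := fun n => n.bodd) (b' := fun n => !n.bodd)
      (transformedWalk_succ_sub S)
      (fun n ω => by
        rw [signed_not, ← transformedWalk_succ_sub]
        simp only [Pi.neg_apply]
        abel))
    (tangent_of_increments S (b := fun _ => true) (b' := fun n => n.bodd) (walk_succ_sub S)
      (transformedWalk_succ_sub S)) s t hs ht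
  have h3 : ∀ P : Coins.{w} (2 * S.depth) → Prop, ∀ [DecidablePred P],
      ∫ ω, (if P ω then (1 : ℝ) else 0) ∂Coins.law _ = (Coins.law _).real {ω | P ω} := by
    intro P _
    rw [← integral_indicator_one .of_discrete]
    refine integral_congr_ae (ae_of_all _ fun ω => ?_)
    by_cases h : P ω <;> simp [h]
  have hz := fun k (ω : Coins.{w} (2 * S.depth)) b => maxStep_zero_state S k ω b
  rw [mean_eq_integral.{u, w} maxStep _ start S hz, mean_eq_integral.{u, w} maxStep _ start S hz, h3, h3]
  -- For the walk, which sits on the larger side, the maximum over finitely many times must equal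
  -- the full supremum: this uses that the walk is constant after the last toss. For the transform
  -- an inclusion suffices.
  simp only [lt_state_M_iff S, lt_state_m_iff S, ← exists_lt_walk_iff]
  simp only [ofReal_lt_maximalFunction_iff (isDiscreteProcess_walk S).zero hs,
    ofReal_lt_maximalFunction_iff (isDiscreteProcess_transformedWalk S).zero ht] at h1
  refine le_trans (measureReal_mono ?_) h1
  rintro ω ⟨n, -, hn⟩
  exact ⟨n, hn⟩

end

/-- The UMD property gives an `L^r` estimate for games. -/
lemma mean_le_zero_of_isUMD {𝕜 : Type v} {V : Type u} [RCLike 𝕜] [NormedAddCommGroup V]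
    [NormedSpace ℝ V] [NormedSpace 𝕜 V] [CompleteSpace V] (h : IsUMD.{w} 𝕜 V) :
    ∃ r : ℝ, 1 < r ∧ ∃ B : ℝ, 0 < B ∧ ∀ S : SignTree V,
      mean pairStep (fun z => ‖z.2‖ ^ r - B * ‖z.1‖ ^ r) S (0, 0) ≤ 0 := by
  obtain ⟨r, hr, β, hβ, h⟩ := h
  refine ⟨r, hr, β ^ r, by positivity, fun S => ?_⟩
  have hmem : ∀ f : Coins.{w} (2 * S.depth) → V, MemLp f (ENNReal.ofReal r) (Coins.law _) := by
    intro f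
    cases nonempty_fintype (Coins.{w} (2 * S.depth))
    refine MemLp.of_bound StronglyMeasurable.of_discrete.aestronglyMeasurable (∑ ω, ‖f ω‖)
      (ae_of_all _ fun ω => ?_)
    exact Finset.single_le_sum (f := fun ω => ‖f ω‖) (fun _ _ => norm_nonneg _)
      (Finset.mem_univ ω)
  -- The increment at time `n` uses toss `n`, which the coin filtration reveals only at time `n +
  -- 1`; hence the shift.
  let ℱ : Filtration ℕ (inferInstance : MeasurableSpace (Coins.{w} (2 * S.depth))) :=
    { seq := fun n => Coins.filtration _ (n + 1)
      mono' := fun i j hij => (Coins.filtration _).mono (by omega)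
      le' := fun n => (Coins.filtration _).le _ }
  have hd : IsMartingaleDifference ℱ (Coins.law _) (inc S) :=
    { adapted := fun n => Coins.stronglyMeasurable_of_truncate fun ω =>
        inc_truncate S n.lt_succ_self ω
      integrable := fun n => Integrable.of_finite
      condExp_succ := fun n => Coins.condExp_eq_zero_of_flip (n + 1) _ (inc_flip S (n + 1)) }
  have h1 := h _ _ (Coins.law _) inferInstance ℱ (inc S) hd (fun n => hmem _) (2 * S.depth)
    (fun n => if n.bodd then 1 else -1) (fun n => by split_ifs <;> simp)
  rw [eLpNorm_le_ofReal_mul_iff (by linarith) hβ.le (hmem _) (hmem _)] at h1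
  rw [mean_eq_integral.{u, w} pairStep _ (0, 0) S
    (fun k ω b => by simp [pairStep, signed_zero])]
  simp only [state_pairStep]
  rw [integral_sub Integrable.of_finite Integrable.of_finite, integral_const_mul, sub_nonpos]
  refine (integral_congr_ae (ae_of_all _ fun ω => ?_)).trans_le h1
  have h2 : transformedWalk S (2 * S.depth) ω = ∑ n ∈ Finset.range (2 * S.depth),
      (if n.bodd = true then (1 : 𝕜) else -1) • inc S n ω :=
    Finset.sum_congr rfl fun j _ => by cases j.bodd <;> simp [signed]
  simp only [h2]

end SignTree

/-! ### Burkholder functions. -/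

/-- A midpoint concave function that is bounded below on segments is concave. -/
lemma concaveOn_of_midpoint {E : Type*} [AddCommGroup E] [Module ℝ E] {f : E → ℝ}
    (hmid : ∀ x v, f (x + v) + f (x - v) ≤ 2 * f x)
    (hbdd : ∀ x y, ∃ c, ∀ t ∈ Set.Icc (0 : ℝ) 1, c ≤ f (x + t • (y - x))) :
    ConcaveOn ℝ Set.univ f := by
  refine ⟨convex_univ, fun x _ y _ a b ha hb hab => ?_⟩
  obtain ⟨c, hc⟩ := hbdd x y
  set h : ℝ → ℝ := fun t => f (x + t • (y - x)) - (1 - t) * f x - t * f y with hh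
  have h0 : h 0 = 0 := by simp [hh]
  have h1 : h 1 = 0 := by simp [hh]
  have hm : ∀ s d : ℝ, h (s + d) + h (s - d) ≤ 2 * h s := by
    intro s d
    have := hmid (x + s • (y - x)) (d • (y - x))
    have e1 : x + s • (y - x) + d • (y - x) = x + (s + d) • (y - x) := by rw [add_smul, add_assoc]
    have e2 : x + s • (y - x) - d • (y - x) = x + (s - d) • (y - x) := by
      rw [sub_smul, add_sub_assoc]
    rw [e1, e2] at this
    simp only [hh]
    linarith
  have hlow : ∀ t ∈ Set.Icc (0 : ℝ) 1, c - |f x| - |f y| ≤ h t := by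
    intro t ht
    have h2 := hc t ht
    have h3 : (1 - t) * f x ≤ |f x| := by
      nlinarith [le_abs_self (f x), abs_nonneg (f x), ht.1, ht.2]
    have h4 : t * f y ≤ |f y| := by nlinarith [le_abs_self (f y), abs_nonneg (f y), ht.1, ht.2]
    simp only [hh]
    linarith
  have hnn : 0 ≤ h b := by
    by_contra hneg
    rw [not_le] at hneg
    -- After subtraction of the chord, `h` vanishes at both ends. Reflecting the nearer endpoint
    -- through `t` stays in the interval and at least doubles a negative value, which contradicts
    -- the lower bound.
    have step : ∀ n : ℕ, ∃ t ∈ Set.Icc (0 : ℝ) 1, h t ≤ 2 ^ n * h b := by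
      intro n
      induction n with
      | zero => exact ⟨b, ⟨hb, by linarith⟩, by simp⟩
      | succ n ih =>
        obtain ⟨t, ht, hle⟩ := ih
        rcases le_total t (1 / 2) with h2 | h2
        · refine ⟨t + t, ⟨by linarith [ht.1], by linarith⟩, ?_⟩
          have := hm t t
          rw [sub_self, h0] at this
          rw [pow_succ]
          linarith
        · refine ⟨t - (1 - t), ⟨by linarith, by linarith [ht.2]⟩, ?_⟩
          have := hm t (1 - t)
          rw [add_sub_cancel, h1] at this
          rw [pow_succ]
          linarith
    obtain ⟨n, hn⟩ := pow_unbounded_of_one_lt ((c - |f x| - |f y|) / h b) (one_lt_two (α := ℝ))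
    obtain ⟨t, ht, hle⟩ := step n
    rw [div_lt_iff_of_neg hneg] at hn
    linarith [hlow t ht]
  have e : a • x + b • y = x + b • (y - x) := by
    rw [eq_sub_of_add_eq hab, sub_smul, one_smul, smul_sub]; abel
  rw [e, smul_eq_mul, smul_eq_mul, eq_sub_of_add_eq hab]
  simp only [hh] at hnn
  linarith

section

variable {V : Type u} [NormedAddCommGroup V] [NormedSpace ℝ V]

/-- A Burkholder function for the `L^r` estimate, in the coordinates in which a transform by signs
moves only one of the two arguments. -/
structure IsBurkholderFunction (r B : ℝ) (U : V → V → ℝ) : Prop where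
  concave_left : ∀ c, ConcaveOn ℝ Set.univ fun a => U a c
  concave_right : ∀ a, ConcaveOn ℝ Set.univ fun c => U a c
  le : ∀ a c, ‖a - c‖ ^ r - B * ‖a + c‖ ^ r ≤ U a c
  zero_le : U 0 0 ≤ 0

/-- An `L^r` estimate for games produces a Burkholder function. -/
lemma exists_isBurkholderFunction {r B : ℝ} (hr : 0 < r)
    (h : ∀ S : SignTree V,
      SignTree.mean SignTree.pairStep (fun z => ‖z.2‖ ^ r - B * ‖z.1‖ ^ r) S (0, 0) ≤ 0) :
    ∃ U : V → V → ℝ, IsBurkholderFunction r B U := by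
  set φ : V × V → ℝ := fun z => ‖z.2‖ ^ r - B * ‖z.1‖ ^ r with hφ
  set J : SignTree V → V → V → ℝ :=
    fun S a c => SignTree.mean SignTree.pairStep φ S (a + c, a - c) with hJ
  have hbdd : ∀ a c, BddAbove (Set.range fun S => J S a c) := by
    intro a c
    -- Two preliminary rounds, moving by `a` with sign `+` and then by `c` with sign `-`, lead from
    -- `(0, 0)` to `(a + c, a - c)` with probability `1 / 4`. Playing `S` there and stopping on the
    -- other branches bounds its payoff independently of `S`.
    refine ⟨-2 * φ (-a, -a) - φ (a - c, a + c), ?_⟩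
    rintro _ ⟨S, rfl⟩
    have := h (.node a true (.node c false S .leaf) .leaf)
    simp only [SignTree.mean, SignTree.pairStep, signed, zero_add, if_true, Bool.false_eq_true,
      if_false, neg_neg, ← sub_eq_add_neg, zero_sub] at this
    simp only [hJ]
    linarith
  have hle : ∀ S a c, J S a c ≤ ⨆ S, J S a c := fun S a c => le_ciSup (hbdd a c) S
  have : Nonempty (SignTree V) := ⟨.leaf⟩
  have hleaf : ∀ a c, φ (a + c, a - c) ≤ ⨆ S, J S a c := fun a c => hle .leaf a c
  have hcont : ∀ a c v v' : V, ∃ b, ∀ t ∈ Set.Icc (0 : ℝ) 1,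
      b ≤ ⨆ S, J S (a + t • v) (c + t • v') := by
    intro a c v v'
    have hc : Continuous fun t : ℝ =>
        φ ((a + t • v) + (c + t • v'), (a + t • v) - (c + t • v')) := by
      simp only [hφ]
      refine Continuous.sub (Continuous.rpow_const (by fun_prop) fun _ => Or.inr hr.le)
        (continuous_const.mul (Continuous.rpow_const (by fun_prop) fun _ => Or.inr hr.le))
    obtain ⟨b, hb⟩ := (isCompact_Icc (a := (0 : ℝ)) (b := 1)).bddBelow_image hc.continuousOn
    exact ⟨b, fun t ht => (hb ⟨t, ht, rfl⟩).trans (hleaf _ _)⟩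
  refine ⟨fun a c => ⨆ S, J S a c, fun c => ?_, fun a => ?_, fun a c => hleaf a c, ?_⟩
  · refine concaveOn_of_midpoint (fun x v => ?_) fun x y => ?_
    -- Joining two games under a new root gives midpoint concavity of the supremum.
    · refine ciSup_add_ciSup_le fun S S' => ?_
      have h1 := hle (.node v true S S') x c
      have e1 : x + c + v = x + v + c := by abel
      have e2 : x - c + v = x + v - c := by abel
      have e3 : x + c + -v = x - v + c := by abel
      have e4 : x - c + -v = x - v - c := by abel
      simp only [hJ, SignTree.mean, SignTree.pairStep, signed, if_true, e1, e2, e3, e4] at h1 ⊢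
      linarith
    · simpa using hcont x c (y - x) 0
  · refine concaveOn_of_midpoint (fun x v => ?_) fun x y => ?_
    · refine ciSup_add_ciSup_le fun S S' => ?_
      have h1 := hle (.node v false S S') a x
      have e1 : a + x + v = a + (x + v) := by abel
      have e2 : a - x + -v = a - (x + v) := by abel
      have e3 : a + x + -v = a + (x - v) := by abel
      have e4 : a - x + v = a - (x - v) := by abel
      simp only [hJ, SignTree.mean, SignTree.pairStep, signed, Bool.false_eq_true, if_false,
        neg_neg, e1, e2, e3, e4] at h1 ⊢
      linarith
    · simpa using hcont a x 0 (y - x)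
  · refine ciSup_le fun S => ?_
    simpa [hJ] using h S

/-- A Burkholder function may be assumed to be nonpositive on the coordinate axis. -/
lemma IsBurkholderFunction.exists_nonpos {r B : ℝ} {U : V → V → ℝ}
    (hU : IsBurkholderFunction r B U) :
    ∃ U' : V → V → ℝ, IsBurkholderFunction r B U' ∧ (∀ a, U' a 0 ≤ 0) ∧ ∀ c, U' 0 c ≤ 0 := by
  have hneg : ∀ f : V → ℝ, ConcaveOn ℝ Set.univ f → ConcaveOn ℝ Set.univ fun a => f (-a) := by
    intro f hf
    exact hf.comp_linearMap (-LinearMap.id : V →ₗ[ℝ] V)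
  have hmid : ∀ f : V → ℝ, ConcaveOn ℝ Set.univ f → (∀ a, f (-a) = f a) → f 0 ≤ 0 →
      ∀ a, f a ≤ 0 := by
    intro f hf he h0 a
    have := hf.2 (Set.mem_univ a) (Set.mem_univ (-a))
      (by norm_num : (0 : ℝ) ≤ 1 / 2) (by norm_num : (0 : ℝ) ≤ 1 / 2) (by norm_num)
    rw [he, smul_neg, add_neg_cancel, smul_eq_mul] at this
    linarith
  have hU' : IsBurkholderFunction r B fun a c => min (U a c) (U (-a) (-c)) := by
    refine ⟨fun c => (hU.concave_left c).inf (hneg _ (hU.concave_left (-c))),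
      fun a => (hU.concave_right a).inf (hneg _ (hU.concave_right (-a))),
      fun a c => le_min (hU.le a c) ?_, min_le_of_left_le hU.zero_le⟩
    have := hU.le (-a) (-c)
    rwa [← neg_add, norm_neg, neg_sub_neg, norm_sub_rev] at this
  refine ⟨_, hU', hmid _ (hU'.concave_left 0) (fun a => ?_) hU'.zero_le,
    hmid _ (hU'.concave_right 0) (fun a => ?_) hU'.zero_le⟩
  · simp [min_comm]
  · simp [min_comm]

end

/-! ### Conditional laws of finite-valued increments and Jensen's inequality for them. -/

/-- Bounded functions that are measurable with respect to `m`. -/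
def BoundedMeasurable {Ω : Type*} (m : MeasurableSpace Ω) (H : Ω → ℝ) : Prop :=
  StronglyMeasurable[m] H ∧ ∃ C, ∀ ω, |H ω| ≤ C

namespace BoundedMeasurable

variable {Ω : Type*} {m m' : MeasurableSpace Ω} {H H' : Ω → ℝ}

lemma mul (h : BoundedMeasurable m H) (h' : BoundedMeasurable m H') :
    BoundedMeasurable m fun ω => H ω * H' ω := by
  obtain ⟨C, hC⟩ := h.2
  obtain ⟨C', hC'⟩ := h'.2
  refine ⟨h.1.mul h'.1, C * C', fun ω => ?_⟩
  rw [abs_mul]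
  exact mul_le_mul (hC ω) (hC' ω) (abs_nonneg _) ((abs_nonneg _).trans (hC ω))

lemma sum {ι : Type*} (T : Finset ι) {H : ι → Ω → ℝ} (h : ∀ i ∈ T, BoundedMeasurable m (H i)) :
    BoundedMeasurable m fun ω => ∑ i ∈ T, H i ω := by
  choose! C hC using fun i hi => (h i hi).2
  refine ⟨Finset.stronglyMeasurable_fun_sum T fun i hi => (h i hi).1, ∑ i ∈ T, C i, fun ω => ?_⟩
  exact (Finset.abs_sum_le_sum_abs _ _).trans (Finset.sum_le_sum fun i hi => hC i hi ω)

lemma mono (h : BoundedMeasurable m H) (hm : m ≤ m') : BoundedMeasurable m' H :=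
  ⟨h.1.mono hm, h.2⟩

lemma integrable {mΩ : MeasurableSpace Ω} {μ : Measure Ω} [IsFiniteMeasure μ] (hm : m ≤ mΩ)
    (h : BoundedMeasurable m H) : Integrable H μ := by
  obtain ⟨C, hC⟩ := h.2
  exact Integrable.of_bound (h.1.mono hm).aestronglyMeasurable C (ae_of_all _ hC)

lemma comp_of_finite {E : Type*} [TopologicalSpace E] [TopologicalSpace.MetrizableSpace E]
    {X : Ω → E} (hX : StronglyMeasurable[m] X) (hfin : (Set.range X).Finite) (F : E → ℝ) :
    BoundedMeasurable m fun ω => F (X ω) := by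
  refine ⟨?_, ?_⟩
  · refine Measurable.stronglyMeasurable fun B _ => ?_
    have : (fun ω => F (X ω)) ⁻¹' B = ⋃ v ∈ Set.range X ∩ F ⁻¹' B, {ω | X ω = v} := by
      ext ω
      simp
    rw [this]
    exact (hfin.inter_of_left _).measurableSet_biUnion fun v _ =>
      hX.measurableSet_eq_fun stronglyMeasurable_const
  · obtain ⟨C, hC⟩ := (hfin.image fun v => |F v|).bddAbove
    exact ⟨C, fun ω => hC ⟨X ω, ⟨ω, rfl⟩, rfl⟩⟩

end BoundedMeasurable

/-- Weights of random probability vectors on `T` with mean zero. -/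
structure IsMeanZeroWeight {Ω V : Type*} [NormedAddCommGroup V] [NormedSpace ℝ V]
    (m : MeasurableSpace Ω) (T : Finset V) (q : V → Ω → ℝ) : Prop where
  stronglyMeasurable : ∀ v, StronglyMeasurable[m] (q v)
  nonneg : ∀ v ∈ T, ∀ ω, 0 ≤ q v ω
  sum_eq_one : ∀ ω, ∑ v ∈ T, q v ω = 1
  sum_smul_eq_zero : ∀ ω, ∑ v ∈ T, q v ω • v = 0

section Weights

variable {Ω V : Type*} [NormedAddCommGroup V] [NormedSpace ℝ V] {m mΩ : MeasurableSpace Ω}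
  {μ : Measure Ω} {T : Finset V} {q : V → Ω → ℝ}

lemma IsMeanZeroWeight.boundedMeasurable (hq : IsMeanZeroWeight m T q) {v : V} (hv : v ∈ T) :
    BoundedMeasurable m (q v) := by
  refine ⟨hq.stronglyMeasurable v, 1, fun ω => ?_⟩
  rw [abs_of_nonneg (hq.nonneg v hv ω), ← hq.sum_eq_one ω]
  exact Finset.single_le_sum (f := fun v => q v ω) (fun v hv => hq.nonneg v hv ω) hv

/-- Conditional probabilities of the values of a finite-valued function can be modified on a null
set so as to have all their properties everywhere. -/
lemma exists_isMeanZeroWeight [IsProbabilityMeasure μ] (hm : m ≤ mΩ) {d : Ω → V}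
    (hd : StronglyMeasurable[mΩ] d) (hdT : ∀ ω, d ω ∈ T) (h0 : (0 : V) ∈ T)
    (hmean : ∀ᵐ ω ∂μ, ∑ v ∈ T, (μ⟦d ⁻¹' {v} | m⟧) ω • v = 0) :
    ∃ q : V → Ω → ℝ, IsMeanZeroWeight m T q ∧ ∀ v ∈ T, q v =ᵐ[μ] μ⟦d ⁻¹' {v} | m⟧ := by
  classical
  set q₀ : V → Ω → ℝ := fun v => μ⟦d ⁻¹' {v} | m⟧ with hq₀
  have hsm : ∀ v, StronglyMeasurable[m] (q₀ v) := fun v => stronglyMeasurable_condExp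
  have hmeas : ∀ v, MeasurableSet (d ⁻¹' {v}) := fun v =>
    hd.measurableSet_eq_fun stronglyMeasurable_const
  set G : Set Ω := {ω | (∀ v ∈ T, 0 ≤ q₀ v ω) ∧ ∑ v ∈ T, q₀ v ω = 1 ∧
    ∑ v ∈ T, q₀ v ω • v = 0} with hG
  have hGm : MeasurableSet[m] G := by
    have e : G = (⋂ v ∈ T, {ω | 0 ≤ q₀ v ω}) ∩ ({ω | ∑ v ∈ T, q₀ v ω = 1} ∩
        {ω | ∑ v ∈ T, q₀ v ω • v = 0}) := by
      ext ω; simp [hG]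
    rw [e]
    refine MeasurableSet.inter (T.measurableSet_biInter fun v _ => ?_)
      (MeasurableSet.inter ?_ ?_)
    · exact stronglyMeasurable_const.measurableSet_le (hsm v)
    · exact (Finset.stronglyMeasurable_fun_sum T fun v _ => hsm v).measurableSet_eq_fun
        stronglyMeasurable_const
    · exact (Finset.stronglyMeasurable_fun_sum T fun v _ =>
        (hsm v).smul_const v).measurableSet_eq_fun stronglyMeasurable_const
  have hint : ∀ v, Integrable ((d ⁻¹' {v}).indicator fun _ => (1 : ℝ)) μ := fun v =>
    (integrable_const _).indicator (hmeas v)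
  have hGae : ∀ᵐ ω ∂μ, ω ∈ G := by
    have h1 : ∀ᵐ ω ∂μ, ∀ v ∈ T, 0 ≤ q₀ v ω := by
      refine (ae_ball_iff T.countable_toSet).2 ?_
      intro v _
      exact condExp_nonneg (ae_of_all _ fun ω => Set.indicator_nonneg (fun _ _ => zero_le_one) ω)
    have h2 : ∀ᵐ ω ∂μ, ∑ v ∈ T, q₀ v ω = 1 := by
      have h3 := condExp_finsetSum (μ := μ) (s := T) (fun v _ => hint v) m
      have h4 : (∑ v ∈ T, (d ⁻¹' {v}).indicator fun _ => (1 : ℝ)) = fun _ => 1 := by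
        ext ω
        rw [Finset.sum_apply, Finset.sum_eq_single (d ω)]
        · simp
        · intro v _ hv
          exact Set.indicator_of_notMem (fun h => hv h.symm) _
        · intro h
          exact absurd (hdT ω) h
      rw [h4, condExp_const hm] at h3
      filter_upwards [h3] with ω hω
      rw [hω, Finset.sum_apply]
    filter_upwards [h1, h2, hmean] with ω w1 w2 w3
    exact ⟨w1, w2, w3⟩
  -- Off the good set the weights are those of the point mass at `0`, which has mean zero; this is
  -- why `0 ∈ T` is required.
  refine ⟨fun v ω => if ω ∈ G then q₀ v ω else if v = 0 then 1 else 0, ⟨fun v => ?_,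
    fun v hv ω => ?_, fun ω => ?_, fun ω => ?_⟩, fun v hv => ?_⟩
  · exact StronglyMeasurable.ite hGm (hsm v) stronglyMeasurable_const
  · by_cases h : ω ∈ G
    · simpa [h] using h.1 v hv
    · simp only [h, if_false]
      split_ifs <;> norm_num
  · by_cases h : ω ∈ G
    · simpa [h] using h.2.1
    · simp [h, h0]
  · by_cases h : ω ∈ G
    · simpa [h] using h.2.2
    · simp [h]
  · filter_upwards [hGae] with ω h
    simp [h, hq₀]

/-- Averaging out a finite-valued function by its conditional probabilities. -/
lemma integral_eq_integral_sum_weight [IsProbabilityMeasure μ] (hm : m ≤ mΩ) {d : Ω → V}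
    (hd : StronglyMeasurable[mΩ] d) (hdT : ∀ ω, d ω ∈ T) (hq : IsMeanZeroWeight m T q)
    (hqd : ∀ v ∈ T, q v =ᵐ[μ] μ⟦d ⁻¹' {v} | m⟧) {G : V → Ω → ℝ}
    (hG : ∀ v ∈ T, BoundedMeasurable m (G v)) :
    ∫ ω, G (d ω) ω ∂μ = ∫ ω, ∑ v ∈ T, q v ω * G v ω ∂μ := by
  classical
  have hmeas : ∀ v, MeasurableSet (d ⁻¹' {v}) := fun v =>
    hd.measurableSet_eq_fun stronglyMeasurable_const
  have hint : ∀ v, Integrable ((d ⁻¹' {v}).indicator fun _ => (1 : ℝ)) μ := fun v =>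
    (integrable_const _).indicator (hmeas v)
  have hint' : ∀ v ∈ T, Integrable (((d ⁻¹' {v}).indicator fun _ => (1 : ℝ)) * G v) μ := by
    intro v hv
    obtain ⟨C, hC⟩ := (hG v hv).2
    exact (hint v).mul_bdd ((hG v hv).1.mono hm).aestronglyMeasurable (ae_of_all _ hC)
  have h1 : ∀ ω, G (d ω) ω = ∑ v ∈ T, (((d ⁻¹' {v}).indicator fun _ => (1 : ℝ)) * G v) ω := by
    intro ω
    rw [Finset.sum_eq_single (d ω)]
    · simp
    · intro v _ hv
      rw [Pi.mul_apply, Set.indicator_of_notMem (fun h => hv h.symm), zero_mul]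
    · intro h
      exact absurd (hdT ω) h
  simp_rw [h1]
  rw [integral_finsetSum _ hint', integral_finsetSum _ fun v hv =>
    ((hq.boundedMeasurable hv).mul (hG v hv)).integrable hm]
  refine Finset.sum_congr rfl fun v hv => ?_
  rw [← integral_condExp hm]
  refine integral_congr_ae ?_
  filter_upwards [condExp_mul_of_stronglyMeasurable_right (hG v hv).1 (hint' v hv) (hint v),
    hqd v hv] with ω w1 w2
  rw [w1, Pi.mul_apply, w2]

lemma condExp_eq_sum_smul [IsProbabilityMeasure μ] [CompleteSpace V] {d : Ω → V}
    (hd : StronglyMeasurable[mΩ] d) (hdT : ∀ ω, d ω ∈ T) :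
    μ[d | m] =ᵐ[μ] fun ω => ∑ v ∈ T, (μ⟦d ⁻¹' {v} | m⟧) ω • v := by
  classical
  have hmeas : ∀ v, MeasurableSet (d ⁻¹' {v}) := fun v =>
    hd.measurableSet_eq_fun stronglyMeasurable_const
  have hint : ∀ v, Integrable ((d ⁻¹' {v}).indicator fun _ => (1 : ℝ)) μ := fun v =>
    (integrable_const _).indicator (hmeas v)
  have h1 : d = ∑ v ∈ T, fun ω => ((d ⁻¹' {v}).indicator fun _ => (1 : ℝ)) ω • v := by
    ext ω
    rw [Finset.sum_apply, Finset.sum_eq_single (d ω)]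
    · simp
    · intro v _ hv
      rw [Set.indicator_of_notMem (fun h => hv h.symm), zero_smul]
    · intro h
      exact absurd (hdT ω) h
  have h2 := condExp_finsetSum (μ := μ) (s := T)
    (f := fun v ω => ((d ⁻¹' {v}).indicator fun _ => (1 : ℝ)) ω • v)
    (fun v _ => (hint v).smul_const v) m
  rw [← h1] at h2
  have h3 : ∀ᵐ ω ∂μ, ∀ v ∈ T, (μ⟦d ⁻¹' {v} | m⟧) ω • v =
      (μ[fun ω => ((d ⁻¹' {v}).indicator fun _ => (1 : ℝ)) ω • v | m]) ω := by
    refine (ae_ball_iff T.countable_toSet).2 fun v _ => ?_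
    exact (ContinuousLinearMap.toSpanSingleton ℝ v).comp_condExp_comm (hint v)
  filter_upwards [h2, h3] with ω w2 w3
  rw [w2, Finset.sum_apply]
  exact Finset.sum_congr rfl fun v hv => (w3 v hv).symm

/-- Jensen's inequality for mean-zero weights. -/
lemma IsMeanZeroWeight.sum_mul_le (hq : IsMeanZeroWeight m T q) {f : V → ℝ}
    (hf : ConcaveOn ℝ Set.univ f) (t : ℝ) (a : V) (ω : Ω) :
    ∑ v ∈ T, q v ω * f (a + t • v) ≤ f a := by
  have h := hf.le_map_sum (t := T) (w := fun v => q v ω) (p := fun v => a + t • v)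
    (fun v hv => hq.nonneg v hv ω) (hq.sum_eq_one ω) (fun _ _ => Set.mem_univ _)
  have h1 : ∑ v ∈ T, q v ω • (a + t • v) = a := by
    simp_rw [smul_add, Finset.sum_add_distrib, ← Finset.sum_smul, hq.sum_eq_one, one_smul,
      smul_comm _ t, ← Finset.smul_sum, hq.sum_smul_eq_zero, smul_zero, add_zero]
  rw [h1] at h
  simpa using h

/-- The value of a Burkholder function decreases under independent identically distributed
mean-zero perturbations of the process and of its transform. -/
lemma IsBurkholderFunction.sum_sum_le {r B : ℝ} {U : V → V → ℝ} (hU : IsBurkholderFunction r B U)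
    (hq : IsMeanZeroWeight m T q) (ω : Ω) (x y : V) :
    ∑ i ∈ T, ∑ j ∈ T, q i ω * (q j ω *
      U ((1 / 2 : ℝ) • (x + i + (y + j))) ((1 / 2 : ℝ) • (x + i - (y + j)))) ≤
      U ((1 / 2 : ℝ) • (x + y)) ((1 / 2 : ℝ) • (x - y)) := by
  set a := (1 / 2 : ℝ) • (x + y) with ha
  set c := (1 / 2 : ℝ) • (x - y) with hc
  have e1 : ∀ i j : V, (1 / 2 : ℝ) • (x + i + (y + j)) =
      a + (1 / 2 : ℝ) • i + (1 / 2 : ℝ) • j := by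
    intro i j; rw [ha]; module
  have e2 : ∀ i j : V, (1 / 2 : ℝ) • (x + i - (y + j)) = c + (1 / 2 : ℝ) • (i - j) := by
    intro i j; rw [hc]; module
  simp_rw [e1, e2]
  set F : V → V → ℝ := fun i j => q i ω * (q j ω *
    U (a + (1 / 2 : ℝ) • i + (1 / 2 : ℝ) • j) (c + (1 / 2 : ℝ) • (i - j))) with hF
  -- Exchanging `i` and `j` fixes the first argument of `U` and reflects the second one about `c`,
  -- so concavity in the second variable removes its perturbation. What remains is a mean-zero
  -- perturbation of the first variable by `i / 2 + j / 2`, handled by Jensen twice.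
  have h1 : ∀ i ∈ T, ∀ j ∈ T, F i j + F j i ≤
      2 * (q i ω * (q j ω * U (a + (1 / 2 : ℝ) • i + (1 / 2 : ℝ) • j) c)) := by
    intro i hi j hj
    have h2 := (hU.concave_right (a + (1 / 2 : ℝ) • i + (1 / 2 : ℝ) • j)).2
      (Set.mem_univ (c + (1 / 2 : ℝ) • (i - j))) (Set.mem_univ (c + (1 / 2 : ℝ) • (j - i)))
      (by norm_num : (0 : ℝ) ≤ 1 / 2) (by norm_num : (0 : ℝ) ≤ 1 / 2) (by norm_num)
    have h3 : (1 / 2 : ℝ) • (c + (1 / 2 : ℝ) • (i - j)) +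
        (1 / 2 : ℝ) • (c + (1 / 2 : ℝ) • (j - i)) = c := by module
    rw [h3, smul_eq_mul, smul_eq_mul] at h2
    have h4 : a + (1 / 2 : ℝ) • j + (1 / 2 : ℝ) • i = a + (1 / 2 : ℝ) • i + (1 / 2 : ℝ) • j := by
      abel
    have h5 := mul_nonneg (hq.nonneg i hi ω) (hq.nonneg j hj ω)
    simp only [hF, h4]
    nlinarith [mul_le_mul_of_nonneg_left h2 h5]
  have h6 : ∑ i ∈ T, ∑ j ∈ T, F i j + ∑ i ∈ T, ∑ j ∈ T, F i j ≤
      2 * ∑ i ∈ T, ∑ j ∈ T,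
        q i ω * (q j ω * U (a + (1 / 2 : ℝ) • i + (1 / 2 : ℝ) • j) c) := by
    conv_lhs => arg 2; rw [Finset.sum_comm]
    simp_rw [Finset.mul_sum, ← Finset.sum_add_distrib]
    exact Finset.sum_le_sum fun i hi => Finset.sum_le_sum fun j hj => h1 i hi j hj
  have h7 : ∑ i ∈ T, ∑ j ∈ T, q i ω * (q j ω * U (a + (1 / 2 : ℝ) • i + (1 / 2 : ℝ) • j) c) ≤
      U a c := by
    refine le_trans (Finset.sum_le_sum fun i hi => ?_)
      (hq.sum_mul_le (hU.concave_left c) (1 / 2) a ω)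
    rw [← Finset.mul_sum]
    exact mul_le_mul_of_nonneg_left (hq.sum_mul_le (hU.concave_left c) (1 / 2) _ ω)
      (hq.nonneg i hi ω)
  linarith

end Weights

/-! ### Martingales: finite-valued approximation and the bound for their sign transforms. -/

section FiniteRange

variable {Ω V : Type*} [NormedAddCommGroup V] {mΩ : MeasurableSpace Ω} {μ : Measure Ω}

lemma MemLp.exists_finite_range_eLpNorm_sub_le {f : Ω → V} {p : ℝ≥0∞} (hf : MemLp f p μ)
    (hp : p ≠ ∞) {η : ℝ≥0∞} (hη : η ≠ 0) :
    ∃ s : Ω → V, StronglyMeasurable s ∧ (Set.range s).Finite ∧ MemLp s p μ ∧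
      eLpNorm (f - s) p μ ≤ η := by
  obtain ⟨g, hg, hgm⟩ := hf.exists_simpleFunc_eLpNorm_sub_lt hp hη
  exact ⟨g, g.stronglyMeasurable, g.finite_range, hgm, hg.le⟩

/-- A function measurable for the natural filtration factors through `(s 0, …, s n)`, which takes
finitely many values. Conditional expectations given this filtration are therefore finite-valued. -/
lemma Filtration.finite_range_of_natural [MeasurableSpace V] [BorelSpace V] {s : ℕ → Ω → V}
    (hs : ∀ n, StronglyMeasurable (s n)) (hfin : ∀ n, (Set.range (s n)).Finite) {n : ℕ}
    {h : Ω → V} (hh : StronglyMeasurable[Filtration.natural s hs n] h) :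
    (Set.range h).Finite := by
  set S : Ω → Set.Iic n → V := fun ω j => s j ω with hS
  have hSfin : (Set.range S).Finite := by
    refine (Set.Finite.pi' fun j : Set.Iic n => hfin j).subset ?_
    rintro _ ⟨ω, rfl⟩ j
    exact ⟨ω, rfl⟩
  have hfac : h.FactorsThrough S := by
    intro ω ω' hω
    have hmeas := hh.measurableSet_eq_fun (stronglyMeasurable_const (b := h ω'))
    rw [Filtration.natural_eq_comap] at hmeas
    obtain ⟨B, -, hB⟩ := hmeas
    have h1 : ω' ∈ {x | h x = h ω'} := rfl
    have h2 : ω ∈ {x | h x = h ω'} := by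
      rw [← hB] at h1 ⊢
      change S ω ∈ B
      rw [hω]
      exact h1
    exact h2
  have h3 := hfac.extend_comp (fun _ => 0)
  rw [← h3, Set.range_comp]
  exact hSfin.image _

end FiniteRange

section Martingale

variable {Ω V : Type*} [NormedAddCommGroup V] [NormedSpace ℝ V] [CompleteSpace V]
  {mΩ : MeasurableSpace Ω} {μ : Measure Ω}

lemma IsMartingaleDifference.martingale [IsProbabilityMeasure μ] {ℱ : Filtration ℕ mΩ}
    {d : ℕ → Ω → V} (hd : IsMartingaleDifference ℱ μ d) :
    Martingale (fun n ω => ∑ k ∈ Finset.range (n + 1), d k ω) ℱ μ := by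
  have hadp : StronglyAdapted ℱ (fun n ω => ∑ k ∈ Finset.range (n + 1), d k ω) := fun n =>
    Finset.stronglyMeasurable_fun_sum _ fun k hk =>
      (hd.adapted k).mono (ℱ.mono (Nat.lt_succ_iff.1 (Finset.mem_range.1 hk)))
  have hint : ∀ n, Integrable (fun ω => ∑ k ∈ Finset.range (n + 1), d k ω) μ := fun n =>
    integrable_finsetSum _ fun k _ => hd.integrable k
  refine martingale_nat hadp hint fun n => ?_
  have h1 : (fun ω => ∑ k ∈ Finset.range (n + 1 + 1), d k ω) =
      (fun ω => ∑ k ∈ Finset.range (n + 1), d k ω) + d (n + 1) := by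
    ext ω
    simp [Finset.sum_range_succ]
  rw [h1]
  filter_upwards [condExp_add (hint n) (hd.integrable (n + 1)) (ℱ n), hd.condExp_succ n]
    with ω w1 w2
  rw [w1, Pi.add_apply, w2, condExp_of_stronglyMeasurable (ℱ.le n) (hadp n) (hint n)]
  simp

/-- A martingale difference sequence can be approximated by finite-valued ones. -/
lemma IsMartingaleDifference.exists_finite_approx [IsProbabilityMeasure μ] {ℱ : Filtration ℕ mΩ}
    {d : ℕ → Ω → V} (hd : IsMartingaleDifference ℱ μ d) {r : ℝ} (hr : 1 ≤ r)
    (hLp : ∀ n, MemLp (d n) (ENNReal.ofReal r) μ) (N : ℕ) {η : ℝ≥0∞} (hη : η ≠ 0) :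
    ∃ (𝒢 : Filtration ℕ mΩ) (d' : ℕ → Ω → V), IsMartingaleDifference 𝒢 μ d' ∧
      (∀ n, (Set.range (d' n)).Finite) ∧
      ∀ n ≤ N, eLpNorm (fun ω => d' n ω - d n ω) (ENNReal.ofReal r) μ ≤ 4 * η := by
  borelize V
  have hp1 : (1 : ℝ≥0∞) ≤ ENNReal.ofReal r := by
    rw [← ENNReal.ofReal_one]; exact ENNReal.ofReal_le_ofReal hr
  set f : ℕ → Ω → V := fun n ω => ∑ k ∈ Finset.range (n + 1), d k ω with hf
  have hmart : Martingale f ℱ μ := hd.martingale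
  have hfLp : ∀ n, MemLp (f n) (ENNReal.ofReal r) μ := fun n =>
    memLp_finsetSum _ fun k _ => hLp k
  have hs : ∀ n, ∃ s : Ω → V, StronglyMeasurable[ℱ n] s ∧ (Set.range s).Finite ∧
      MemLp s (ENNReal.ofReal r) μ ∧ eLpNorm (f n - s) (ENNReal.ofReal r) μ ≤ η := by
    intro n
    -- Approximating in the trimmed measure keeps the approximants `ℱ n`-measurable, so their
    -- natural filtration is coarser than `ℱ`.
    have h1 : MemLp (f n) (ENNReal.ofReal r) (μ.trim (ℱ.le n)) :=
      ⟨(hmart.1 n).aestronglyMeasurable, by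
        rw [eLpNorm_trim (ℱ.le n) (hmart.1 n)]; exact (hfLp n).2⟩
    obtain ⟨g, hg1, hg2, hg3, hg4⟩ :=
      MemLp.exists_finite_range_eLpNorm_sub_le h1 ENNReal.ofReal_ne_top hη
    rw [eLpNorm_trim (ℱ.le n) ((hmart.1 n).sub hg1)] at hg4
    exact ⟨g, hg1, hg2, memLp_of_memLp_trim (ℱ.le n) hg3, hg4⟩
  choose s hsm hsfin hsLp hsη using hs
  have hsm' : ∀ n, StronglyMeasurable (s n) := fun n => (hsm n).mono (ℱ.le n)
  set 𝒢 := Filtration.natural s hsm' with h𝒢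
  have hle : ∀ n, 𝒢 n ≤ ℱ n := by
    intro n
    refine iSup₂_le fun j hj => ?_
    exact ((hsm j).mono (ℱ.mono hj)).measurable.comap_le
  set e : ℕ → Ω → V := fun n => μ[f N | 𝒢 n] with he
  have heη : ∀ n ≤ N, eLpNorm (e n - f n) (ENNReal.ofReal r) μ ≤ η + η := by
    intro n hn
    -- By the tower property `e n` is also the conditional expectation of `f n` given `𝒢 n`, and `s
    -- n` is fixed by this operator. Contractivity in `L^r` then bounds the error by `2 * η`, and
    -- the difference of two such errors by `4 * η`.
    have h1 : e n - f n =ᵐ[μ] μ[f n - s n | 𝒢 n] - (f n - s n) := by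
      have h2 : μ[μ[f N | ℱ n] | 𝒢 n] =ᵐ[μ] μ[f N | 𝒢 n] :=
        condExp_condExp_of_le (hle n) (ℱ.le n)
      have h3 : μ[μ[f N | ℱ n] | 𝒢 n] =ᵐ[μ] μ[f n | 𝒢 n] := condExp_congr_ae (hmart.2 n N hn)
      have hi := (hsLp n).integrable hp1
      have h4 := condExp_sub ((hfLp n).integrable hp1) hi (𝒢 n)
      have h5 := condExp_of_stronglyMeasurable (𝒢.le n)
        (Filtration.stronglyAdapted_natural hsm' n) hi
      filter_upwards [h2, h3, h4] with ω w2 w3 w4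
      simp only [Pi.sub_apply, he] at w4 ⊢
      rw [w4, h5, ← w2, w3]
      abel
    rw [eLpNorm_congr_ae h1]
    have h6 : MemLp (f n - s n) (ENNReal.ofReal r) μ := (hfLp n).sub (hsLp n)
    exact (eLpNorm_sub_le (h6.condExp hp1).1 h6.1 hp1).trans
      (add_le_add ((eLpNorm_condExp_le_eLpNorm _ hp1).trans (hsη n)) (hsη n))
  have heLp : ∀ n, MemLp (e n) (ENNReal.ofReal r) μ := fun n =>
    (hfLp N).condExp hp1
  have heint : ∀ n, Integrable (e n) μ := fun n => integrable_condExp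
  have hesm : ∀ n, StronglyMeasurable[𝒢 n] (e n) := fun n => stronglyMeasurable_condExp
  refine ⟨𝒢, fun n => Nat.casesOn n (e 0) fun k => e (k + 1) - e k, ⟨?_, ?_, ?_⟩, ?_, ?_⟩
  · rintro (_ | n)
    · exact hesm 0
    · exact (hesm (n + 1)).sub ((hesm n).mono (𝒢.mono n.le_succ))
  · rintro (_ | n)
    · exact heint 0
    · exact (heint (n + 1)).sub (heint n)
  · intro n
    have h1 : μ[e (n + 1) | 𝒢 n] =ᵐ[μ] e n :=
      condExp_condExp_of_le (𝒢.mono n.le_succ) (𝒢.le (n + 1))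
    have h2 := condExp_of_stronglyMeasurable (𝒢.le n) (hesm n) (heint n)
    filter_upwards [condExp_sub (heint (n + 1)) (heint n) (𝒢 n), h1] with ω w1 w2
    change (μ[e (n + 1) - e n | 𝒢 n]) ω = 0
    rw [w1, Pi.sub_apply, w2, h2, sub_self]
  · have hfin : ∀ n, (Set.range (e n)).Finite := fun n =>
      Filtration.finite_range_of_natural hsm' hsfin (hesm n)
    rintro (_ | n)
    · exact hfin 0
    · refine ((hfin (n + 1)).image2 (fun x y => x - y) (hfin n)).subset ?_
      rintro _ ⟨ω, rfl⟩
      exact ⟨_, ⟨ω, rfl⟩, _, ⟨ω, rfl⟩, rfl⟩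
  · have h4 : (η + η) + (η + η) = 4 * η := by ring
    rintro (_ | n) hn
    · have h1 : (fun ω => e 0 ω - d 0 ω) = e 0 - f 0 := by ext ω; simp [hf]
      change eLpNorm (fun ω => e 0 ω - d 0 ω) _ _ ≤ _
      rw [h1, ← h4]
      exact (heη 0 hn).trans le_self_add
    · have h1 : (fun ω => (e (n + 1) - e n) ω - d (n + 1) ω) =
          (e (n + 1) - f (n + 1)) - (e n - f n) := by
        ext ω
        simp only [hf, Pi.sub_apply, Finset.sum_range_succ _ (n + 1)]
        abel
      change eLpNorm (fun ω => (e (n + 1) - e n) ω - d (n + 1) ω) _ _ ≤ _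
      rw [h1, ← h4]
      exact (eLpNorm_sub_le ((heLp _).sub (hfLp _)).1 ((heLp _).sub (hfLp _)).1 hp1).trans
        (add_le_add (heη _ hn) (heη _ (by omega)))

/-- A Burkholder function gives the estimate for transforms by signs of finite-valued
martingales. -/
lemma IsBurkholderFunction.integral_transform_le_of_finite [IsProbabilityMeasure μ] {r B : ℝ}
    {U : V → V → ℝ} (hU : IsBurkholderFunction r B U) {ℱ : Filtration ℕ mΩ}
    {d : ℕ → Ω → V} (hd : IsMartingaleDifference ℱ μ d) (hfin : ∀ n, (Set.range (d n)).Finite)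
    (ε : ℕ → Bool) (N : ℕ) :
    ∫ ω, ‖∑ n ∈ Finset.range N, signed (ε n) (d n ω)‖ ^ r ∂μ ≤
      B * ∫ ω, ‖∑ n ∈ Finset.range N, d n ω‖ ^ r ∂μ := by
  classical
  obtain ⟨U, hU, hU1, hU2⟩ := hU.exists_nonpos
  -- The two coordinates collect the increments with sign `+` and with sign `-`: their sum is the
  -- martingale, their difference the transform, and each step moves one of them only.
  set X : ℕ → Ω → V × V := fun n ω => ∑ k ∈ Finset.range n,
    if ε k then (d k ω, 0) else (0, d k ω) with hX
  have hXsm : ∀ n, StronglyMeasurable[ℱ n] (X (n + 1)) := by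
    intro n
    refine Finset.stronglyMeasurable_fun_sum _ fun k hk => ?_
    have h1 : StronglyMeasurable[ℱ n] (d k) :=
      (hd.adapted k).mono (ℱ.mono (Nat.lt_succ_iff.1 (Finset.mem_range.1 hk)))
    cases ε k
    · exact stronglyMeasurable_const.prodMk h1
    · exact h1.prodMk stronglyMeasurable_const
  have hXfin : ∀ n, (Set.range (X n)).Finite := by
    intro n
    induction n with
    | zero =>
      refine (Set.finite_singleton (0 : V × V)).subset ?_
      rintro _ ⟨ω, rfl⟩
      simp [hX]
    | succ n ih =>
      refine (ih.image2 (fun x v => x + if ε n then (v, 0) else (0, v)) (hfin n)).subset ?_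
      rintro _ ⟨ω, rfl⟩
      exact ⟨_, ⟨ω, rfl⟩, _, ⟨ω, rfl⟩, by simp only [hX, Finset.sum_range_succ]⟩
  have hXint : ∀ n (F : V × V → ℝ), Integrable (fun ω => F (X n ω)) μ := by
    rintro (_ | n) F
    · simp [hX]
    · exact (BoundedMeasurable.comp_of_finite (hXsm n) (hXfin _) F).integrable (ℱ.le n)
  have key : ∀ n, ∫ ω, U (X n ω).1 (X n ω).2 ∂μ ≤ 0 := by
    intro n
    cases n with
    | zero => simpa [hX] using hU.zero_le
    | succ n =>
      induction n with
      | zero =>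
        -- The first difference need not have mean zero, so Jensen does not apply to it;
        -- nonpositivity of `U` on both axes is used instead.
        refine integral_nonpos fun ω => ?_
        simp only [hX, zero_add, Finset.sum_range_one]
        cases ε 0
        · exact hU2 _
        · exact hU1 _
      | succ n ih =>
        refine le_trans ?_ ih
        set T : Finset V := insert 0 (hfin (n + 1)).toFinset with hT
        have hdT : ∀ ω, d (n + 1) ω ∈ T := fun ω =>
          Finset.mem_insert_of_mem ((hfin (n + 1)).mem_toFinset.2 ⟨ω, rfl⟩)
        have hsm := (hd.adapted (n + 1)).mono (ℱ.le _)
        obtain ⟨q, hq, hqd⟩ := exists_isMeanZeroWeight (μ := μ) (ℱ.le n) hsm hdT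
          (Finset.mem_insert_self _ _) (by
            filter_upwards [condExp_eq_sum_smul (μ := μ) (m := ℱ n) hsm hdT, hd.condExp_succ n]
              with ω w1 w2
            rw [← w1, w2]
            rfl)
        set G : V → Ω → ℝ := fun v ω =>
          U ((X (n + 1) ω).1 + if ε (n + 1) then v else 0)
            ((X (n + 1) ω).2 + if ε (n + 1) then 0 else v) with hG
        have h1 : ∀ ω, U (X (n + 1 + 1) ω).1 (X (n + 1 + 1) ω).2 = G (d (n + 1) ω) ω := by
          intro ω
          simp only [hG, hX, Finset.sum_range_succ _ (n + 1)]
          cases ε (n + 1) <;> simp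
        have hGb : ∀ v ∈ T, BoundedMeasurable (ℱ n) (G v) := fun v _ =>
          BoundedMeasurable.comp_of_finite (hXsm n) (hXfin _) fun x =>
            U (x.1 + if ε (n + 1) then v else 0) (x.2 + if ε (n + 1) then 0 else v)
        simp_rw [h1]
        rw [integral_eq_integral_sum_weight (ℱ.le n) hsm hdT hq hqd hGb]
        refine integral_mono ((BoundedMeasurable.sum T fun v hv =>
          (hq.boundedMeasurable hv).mul (hGb v hv)).integrable (ℱ.le n))
          (hXint (n + 1) fun x => U x.1 x.2) fun ω => ?_
        simp only [hG]
        cases ε (n + 1)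
        · simpa using hq.sum_mul_le (hU.concave_right (X (n + 1) ω).1) 1 (X (n + 1) ω).2 ω
        · simpa using hq.sum_mul_le (hU.concave_left (X (n + 1) ω).2) 1 (X (n + 1) ω).1 ω
  have e1 : ∀ ω, ∑ n ∈ Finset.range N, d n ω = (X N ω).1 + (X N ω).2 := by
    intro ω
    simp only [hX, Prod.fst_sum, Prod.snd_sum, ← Finset.sum_add_distrib]
    refine Finset.sum_congr rfl fun n _ => ?_
    cases ε n <;> simp
  have e2 : ∀ ω, ∑ n ∈ Finset.range N, signed (ε n) (d n ω) = (X N ω).1 - (X N ω).2 := by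
    intro ω
    simp only [hX, Prod.fst_sum, Prod.snd_sum, ← Finset.sum_sub_distrib]
    refine Finset.sum_congr rfl fun n _ => ?_
    cases ε n <;> simp [signed]
  simp_rw [e1, e2]
  rw [← sub_nonpos, ← integral_const_mul, ← integral_sub
    (hXint N fun x => ‖x.1 - x.2‖ ^ r) (hXint N fun x => B * ‖x.1 + x.2‖ ^ r)]
  exact (integral_mono (hXint N fun x => ‖x.1 - x.2‖ ^ r - B * ‖x.1 + x.2‖ ^ r)
    (hXint N fun x => U x.1 x.2) fun ω => hU.le _ _).trans (key N)

end Martingale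

/-! ### Passage to general martingales and to unimodular scalars. -/

lemma ENNReal.exists_ne_zero_mul_le (c : ℝ≥0∞) (hc : c ≠ ∞) {δ : ℝ≥0∞} (hδ : δ ≠ 0) :
    ∃ η : ℝ≥0∞, η ≠ 0 ∧ c * η ≤ δ := by
  refine ⟨δ / (c + 1), (ENNReal.div_pos hδ (by finiteness)).ne', ?_⟩
  calc c * (δ / (c + 1)) ≤ (c + 1) * (δ / (c + 1)) := by gcongr; exact le_self_add
    _ ≤ δ := ENNReal.mul_div_le

section Transforms

variable {Ω V : Type*} [NormedAddCommGroup V]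
  {mΩ : MeasurableSpace Ω} {μ : Measure Ω}

lemma eLpNorm_sum_signed_sub_le {p : ℝ≥0∞} (hp : 1 ≤ p) {d d' : ℕ → Ω → V}
    (hd : ∀ n, MemLp (d n) p μ) (hd' : ∀ n, MemLp (d' n) p μ) {η : ℝ≥0∞} {N : ℕ}
    (h : ∀ n ≤ N, eLpNorm (fun ω => d' n ω - d n ω) p μ ≤ η) (ε : ℕ → Bool) :
    eLpNorm (fun ω => ∑ n ∈ Finset.range N, signed (ε n) (d' n ω) -
      ∑ n ∈ Finset.range N, signed (ε n) (d n ω)) p μ ≤ N * η := by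
  have h1 : (fun ω => ∑ n ∈ Finset.range N, signed (ε n) (d' n ω) -
      ∑ n ∈ Finset.range N, signed (ε n) (d n ω)) =
      ∑ n ∈ Finset.range N, fun ω => signed (ε n) (d' n ω - d n ω) := by
    ext ω
    rw [Finset.sum_apply, ← Finset.sum_sub_distrib]
    refine Finset.sum_congr rfl fun n _ => ?_
    cases ε n <;> simp [signed]
    abel
  rw [h1]
  have hn : ∀ n, eLpNorm (fun ω => signed (ε n) (d' n ω - d n ω)) p μ =
      eLpNorm (fun ω => d' n ω - d n ω) p μ := fun n =>
    eLpNorm_congr_norm_ae (ae_of_all _ fun ω => norm_signed _ _)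
  refine (eLpNorm_sum_le (fun n _ => ?_) hp).trans ?_
  · have := ((hd' n).sub (hd n)).1
    cases ε n
    · exact this.neg
    · exact this
  · calc ∑ n ∈ Finset.range N, eLpNorm (fun ω => signed (ε n) (d' n ω - d n ω)) p μ
        ≤ ∑ n ∈ Finset.range N, η := Finset.sum_le_sum fun n hn' => by
          rw [hn]; exact h n (Finset.mem_range.1 hn').le
      _ = N * η := by simp

lemma eLpNorm_le_add_eLpNorm_sub {p : ℝ≥0∞} (hp : 1 ≤ p) {f g : Ω → V} (hf : MemLp f p μ)
    (hg : MemLp g p μ) : eLpNorm f p μ ≤ eLpNorm (fun ω => f ω - g ω) p μ + eLpNorm g p μ := by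
  have h := eLpNorm_add_le (hf.sub hg).1 hg.1 hp
  rwa [sub_add_cancel] at h

/-- An estimate for transforms by signs of approximating processes passes to the limit. -/
lemma eLpNorm_transform_le_of_approx {p : ℝ≥0∞} (hp : 1 ≤ p) {d : ℕ → Ω → V}
    (hd : ∀ n, MemLp (d n) p μ) {N : ℕ} (ε : ℕ → Bool) {β : ℝ≥0∞} (hβ : β ≠ ∞)
    (h : ∀ η : ℝ≥0∞, η ≠ 0 → ∃ d' : ℕ → Ω → V, (∀ n, MemLp (d' n) p μ) ∧
      (∀ n ≤ N, eLpNorm (fun ω => d' n ω - d n ω) p μ ≤ η) ∧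
      eLpNorm (fun ω => ∑ n ∈ Finset.range N, signed (ε n) (d' n ω)) p μ ≤
        β * eLpNorm (fun ω => ∑ n ∈ Finset.range N, d' n ω) p μ) :
    eLpNorm (fun ω => ∑ n ∈ Finset.range N, signed (ε n) (d n ω)) p μ ≤
      β * eLpNorm (fun ω => ∑ n ∈ Finset.range N, d n ω) p μ := by
  have hsigned : ∀ (d : ℕ → Ω → V), (∀ n, MemLp (d n) p μ) → ∀ ε : ℕ → Bool,
      MemLp (fun ω => ∑ n ∈ Finset.range N, signed (ε n) (d n ω)) p μ := by
    intro d hd ε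
    refine memLp_finsetSum _ fun n _ => ?_
    cases ε n
    · exact (hd n).neg
    · exact hd n
  refine ENNReal.le_of_forall_pos_le_add fun δ hδ _ => ?_
  obtain ⟨η, hη, hηδ⟩ := ENNReal.exists_ne_zero_mul_le (N * (1 + β)) (by finiteness)
    (ENNReal.coe_ne_zero.2 hδ.ne')
  obtain ⟨d', hd', happ, hle⟩ := h η hη
  have h3 := eLpNorm_sum_signed_sub_le hp hd' hd (N := N) (fun n hn => by
    rw [← eLpNorm_neg]
    have : (-fun ω => d n ω - d' n ω) = fun ω => d' n ω - d n ω := by ext ω; simp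
    rw [this]
    exact happ n hn) ε
  have h4 := eLpNorm_sum_signed_sub_le hp hd hd' (N := N) happ fun _ => true
  have h5 := eLpNorm_le_add_eLpNorm_sub hp (hsigned d hd ε) (hsigned d' hd' ε)
  have h6 := eLpNorm_le_add_eLpNorm_sub hp (hsigned d' hd' fun _ => true)
    (hsigned d hd fun _ => true)
  simp only [signed, if_true] at h4 h6
  calc eLpNorm (fun ω => ∑ n ∈ Finset.range N, signed (ε n) (d n ω)) p μ
      ≤ N * η + β * (N * η + eLpNorm (fun ω => ∑ n ∈ Finset.range N, d n ω) p μ) :=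
        h5.trans (add_le_add h3 (hle.trans (mul_le_mul_right (h6.trans (add_le_add_left h4 _)) _)))
    _ = β * eLpNorm (fun ω => ∑ n ∈ Finset.range N, d n ω) p μ + N * (1 + β) * η := by ring
    _ ≤ _ := by gcongr

variable [NormedSpace ℝ V]

/-- A Burkholder function gives the estimate for transforms by signs. -/
lemma IsBurkholderFunction.eLpNorm_transform_le [CompleteSpace V] [IsProbabilityMeasure μ]
    {r B : ℝ} (hr : 1 < r) (hB : 0 < B) {U : V → V → ℝ} (hU : IsBurkholderFunction r B U)
    {ℱ : Filtration ℕ mΩ} {d : ℕ → Ω → V} (hd : IsMartingaleDifference ℱ μ d)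
    (hLp : ∀ n, MemLp (d n) (ENNReal.ofReal r) μ) (ε : ℕ → Bool) (N : ℕ) :
    eLpNorm (fun ω => ∑ n ∈ Finset.range N, signed (ε n) (d n ω)) (ENNReal.ofReal r) μ ≤
      ENNReal.ofReal (B ^ (1 / r)) *
        eLpNorm (fun ω => ∑ n ∈ Finset.range N, d n ω) (ENNReal.ofReal r) μ := by
  have hr0 : 0 < r := by linarith
  have hp1 : (1 : ℝ≥0∞) ≤ ENNReal.ofReal r := by
    rw [← ENNReal.ofReal_one]; exact ENNReal.ofReal_le_ofReal hr.le
  refine eLpNorm_transform_le_of_approx hp1 hLp ε ENNReal.ofReal_ne_top fun η hη => ?_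
  obtain ⟨𝒢, d', hd', hfin, happ⟩ := hd.exists_finite_approx hr.le hLp N (η := η / 4)
    (ENNReal.div_pos hη (by finiteness)).ne'
  have hLp' : ∀ n, MemLp (d' n) (ENNReal.ofReal r) μ := by
    intro n
    obtain ⟨C, hC⟩ := ((hfin n).image fun v => ‖v‖).bddAbove
    exact MemLp.of_bound (hd'.integrable n).1 C (ae_of_all _ fun ω => hC ⟨_, ⟨ω, rfl⟩, rfl⟩)
  refine ⟨d', hLp', fun n hn => (happ n hn).trans ENNReal.mul_div_le, ?_⟩
  have h1 := hU.integral_transform_le_of_finite hd' hfin ε N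
  have hβr : (B ^ (1 / r)) ^ r = B := by
    rw [← Real.rpow_mul hB.le, one_div_mul_cancel hr0.ne', Real.rpow_one]
  have h2 : MemLp (fun ω => ∑ n ∈ Finset.range N, signed (ε n) (d' n ω)) (ENNReal.ofReal r) μ := by
    refine memLp_finsetSum _ fun n _ => ?_
    cases ε n
    · exact (hLp' n).neg
    · exact hLp' n
  have h3 : MemLp (fun ω => ∑ n ∈ Finset.range N, d' n ω) (ENNReal.ofReal r) μ :=
    memLp_finsetSum _ fun n _ => hLp' n
  rw [eLpNorm_le_ofReal_mul_iff hr0 (by positivity) h2 h3, hβr]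
  exact h1

/-- An estimate for transforms by signs extends to multipliers in `[-1, 1]` by convexity. -/
lemma eLpNorm_multiplier_le {p : ℝ≥0∞} (hp : 1 ≤ p) {d : ℕ → Ω → V}
    (hd : ∀ n, MemLp (d n) p μ) {N : ℕ} {C : ℝ≥0∞}
    (h : ∀ ε : ℕ → Bool,
      eLpNorm (fun ω => ∑ n ∈ Finset.range N, signed (ε n) (d n ω)) p μ ≤ C)
    (a : ℕ → ℝ) (ha : ∀ n, |a n| ≤ 1) :
    eLpNorm (fun ω => ∑ n ∈ Finset.range N, a n • d n ω) p μ ≤ C := by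
  classical
  have hmem : ∀ a : ℕ → ℝ, MemLp (fun ω => ∑ n ∈ Finset.range N, a n • d n ω) p μ := fun a =>
    memLp_finsetSum _ fun n _ => (hd n).const_smul (a n)
  -- Induction on the number of leading coefficients that may lie inside `[-1, 1]`: coefficient `k`
  -- is a convex combination of `1` and `-1`.
  have key : ∀ k, ∀ a : ℕ → ℝ, (∀ n, |a n| ≤ 1) → (∀ n, k ≤ n → a n = 1 ∨ a n = -1) →
      eLpNorm (fun ω => ∑ n ∈ Finset.range N, a n • d n ω) p μ ≤ C := by
    intro k
    induction k with
    | zero =>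
      intro a _ ha
      refine le_trans (le_of_eq ?_) (h fun n => decide (a n = 1))
      congr 1
      ext ω
      refine Finset.sum_congr rfl fun n _ => ?_
      rcases ha n n.zero_le with h1 | h1 <;> rw [h1] <;> norm_num [signed]
    | succ k ih =>
      intro a ha1 ha2
      have hupd : ∀ c : ℝ, c = 1 ∨ c = -1 →
          eLpNorm (fun ω => ∑ n ∈ Finset.range N, Function.update a k c n • d n ω) p μ ≤ C := by
        intro c hc
        refine ih _ (fun n => ?_) fun n hn => ?_
        · rcases eq_or_ne n k with rfl | hn
          · rcases hc with rfl | rfl <;> simp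
          · simpa [hn] using ha1 n
        · rcases eq_or_ne n k with rfl | hn'
          · simpa using hc
          · simpa [hn'] using ha2 n (by omega)
      have hak := abs_le.1 (ha1 k)
      set t := (1 + a k) / 2 with ht
      have ht0 : 0 ≤ t := by rw [ht]; linarith [hak.1]
      have ht1 : 0 ≤ 1 - t := by rw [ht]; linarith [hak.2]
      have e : (fun ω => ∑ n ∈ Finset.range N, a n • d n ω) =
          t • (fun ω => ∑ n ∈ Finset.range N, Function.update a k 1 n • d n ω) +
          (1 - t) • (fun ω => ∑ n ∈ Finset.range N, Function.update a k (-1) n • d n ω) := by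
        ext ω
        simp only [Pi.add_apply, Pi.smul_apply, Finset.smul_sum, ← Finset.sum_add_distrib,
          smul_smul, ← add_smul]
        refine Finset.sum_congr rfl fun n _ => ?_
        congr 1
        rcases eq_or_ne n k with rfl | hn
        · simp [ht]; ring
        · simp [hn]; ring
      rw [e]
      refine (eLpNorm_add_le ((hmem _).const_smul t).1 ((hmem _).const_smul (1 - t)).1 hp).trans ?_
      rw [eLpNorm_const_smul, eLpNorm_const_smul, Real.enorm_of_nonneg ht0,
        Real.enorm_of_nonneg ht1]
      calc ENNReal.ofReal t * _ + ENNReal.ofReal (1 - t) * _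
          ≤ ENNReal.ofReal t * C + ENNReal.ofReal (1 - t) * C := by
            gcongr
            · exact hupd 1 (Or.inl rfl)
            · exact hupd (-1) (Or.inr rfl)
        _ = C := by
            rw [← add_mul, ← ENNReal.ofReal_add ht0 ht1]
            simp
  have h1 := key N (fun n => if n < N then a n else 1) (fun n => by split_ifs <;> simp [ha n])
    (fun n hn => by simp [not_lt.2 hn])
  refine le_trans (le_of_eq ?_) h1
  congr 1
  ext ω
  exact Finset.sum_congr rfl fun n hn => by simp [Finset.mem_range.1 hn]

end Transforms

/-- A space with a Burkholder function is UMD. -/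
lemma IsBurkholderFunction.isUMD {𝕜 : Type v} {V : Type u} [RCLike 𝕜] [NormedAddCommGroup V]
    [NormedSpace ℝ V] [NormedSpace 𝕜 V] [IsScalarTower ℝ 𝕜 V] [CompleteSpace V]
    {r B : ℝ} (hr : 1 < r) (hB : 0 < B) {U : V → V → ℝ} (hU : IsBurkholderFunction r B U) :
    IsUMD.{w} 𝕜 V := by
  have hp1 : (1 : ℝ≥0∞) ≤ ENNReal.ofReal r := by
    rw [← ENNReal.ofReal_one]; exact ENNReal.ofReal_le_ofReal hr.le
  -- The factor `2` comes from treating the real and imaginary parts of the multipliers separately.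
  refine ⟨r, hr, 2 * B ^ (1 / r), by positivity, fun Ω mΩ μ _ ℱ d hd hLp N ε hε => ?_⟩
  set C := ENNReal.ofReal (B ^ (1 / r)) *
    eLpNorm (fun ω => ∑ n ∈ Finset.range N, d n ω) (ENNReal.ofReal r) μ with hC
  have hsign := fun ε : ℕ → Bool => hU.eLpNorm_transform_le hr hB hd hLp ε N
  have hre := eLpNorm_multiplier_le hp1 hLp hsign (fun n => RCLike.re (ε n))
    (fun n => (RCLike.abs_re_le_norm _).trans (hε n).le)
  have him := eLpNorm_multiplier_le hp1 hLp hsign (fun n => RCLike.im (ε n))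
    (fun n => (RCLike.abs_im_le_norm _).trans (hε n).le)
  have hmem : ∀ a : ℕ → ℝ,
      MemLp (fun ω => ∑ n ∈ Finset.range N, a n • d n ω) (ENNReal.ofReal r) μ := fun a =>
    memLp_finsetSum _ fun n _ => (hLp n).const_smul (a n)
  have e : (fun ω => ∑ n ∈ Finset.range N, ε n • d n ω) =
      (fun ω => ∑ n ∈ Finset.range N, RCLike.re (ε n) • d n ω) +
      (RCLike.I : 𝕜) • (fun ω => ∑ n ∈ Finset.range N, RCLike.im (ε n) • d n ω) := by
    ext ω
    simp only [Pi.add_apply, Pi.smul_apply, Finset.smul_sum, ← Finset.sum_add_distrib]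
    refine Finset.sum_congr rfl fun n _ => ?_
    conv_lhs => rw [← RCLike.re_add_im (ε n)]
    rw [add_smul, RCLike.real_smul_eq_coe_smul (K := 𝕜), RCLike.real_smul_eq_coe_smul (K := 𝕜),
      smul_smul, mul_comm]
  have hI : eLpNorm ((RCLike.I : 𝕜) • (fun ω => ∑ n ∈ Finset.range N, RCLike.im (ε n) • d n ω))
      (ENNReal.ofReal r) μ ≤
      eLpNorm (fun ω => ∑ n ∈ Finset.range N, RCLike.im (ε n) • d n ω) (ENNReal.ofReal r) μ := by
    refine eLpNorm_mono fun ω => ?_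
    rw [Pi.smul_apply, norm_smul]
    refine mul_le_of_le_one_left (norm_nonneg _) ?_
    by_cases h : (RCLike.I : 𝕜) = 0
    · simp [h]
    · exact (RCLike.norm_I_of_ne_zero h).le
  rw [e]
  refine (eLpNorm_add_le (hmem _).1 ((hmem _).1.const_smul _) hp1).trans ?_
  refine (add_le_add hre (hI.trans him)).trans (le_of_eq ?_)
  rw [← two_mul, ENNReal.ofReal_mul zero_le_two, ENNReal.ofReal_ofNat, mul_assoc]

/-! ### Decoupling: comparison with conditionally independent increments. -/

section Decoupling

variable {Ω V : Type*} [NormedAddCommGroup V] {m mΩ : MeasurableSpace Ω}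
  {μ : Measure Ω} {T : Finset V}

/-- The expected value of `Ψ` at the sum of `n` independent random vectors, the `k`-th of which
takes the value `v ∈ T` with probability `q k v`. -/
def independentMean (T : Finset V) (q : ℕ → V → ℝ) : ℕ → (V → ℝ) → ℝ
  | 0, Ψ => Ψ 0
  | n + 1, Ψ => independentMean T q n fun y => ∑ j ∈ T, q n j * Ψ (y + j)

variable {q : ℕ → V → ℝ}

lemma independentMean_mono (hq : ∀ n, ∀ v ∈ T, 0 ≤ q n v) (n : ℕ) {Ψ Ψ' : V → ℝ}
    (h : ∀ y, Ψ y ≤ Ψ' y) : independentMean T q n Ψ ≤ independentMean T q n Ψ' := by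
  induction n generalizing Ψ Ψ' with
  | zero => exact h 0
  | succ n ih =>
    exact ih fun y => Finset.sum_le_sum fun j hj => mul_le_mul_of_nonneg_left (h _) (hq n j hj)

lemma independentMean_sum {ι : Type*} (s : Finset ι) (c : ι → ℝ) (Ψ : ι → V → ℝ) (n : ℕ) :
    independentMean T q n (fun y => ∑ i ∈ s, c i * Ψ i y) =
      ∑ i ∈ s, c i * independentMean T q n (Ψ i) := by
  induction n generalizing Ψ with
  | zero => rfl
  | succ n ih =>
    simp only [independentMean]
    rw [← ih]
    congr 1
    ext y
    simp_rw [Finset.mul_sum]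
    rw [Finset.sum_comm]
    exact Finset.sum_congr rfl fun i _ => Finset.sum_congr rfl fun j _ => by ring

lemma independentMean_const (hq : ∀ n, ∑ v ∈ T, q n v = 1) (n : ℕ) (c : ℝ) :
    independentMean T q n (fun _ => c) = c := by
  induction n with
  | zero => rfl
  | succ n ih => simp only [independentMean, ← Finset.sum_mul, hq, one_mul, ih]

lemma independentMean_add_const_mul (c : ℝ) (Ψ Ψ' : V → ℝ) (n : ℕ) :
    independentMean T q n (fun y => Ψ y + c * Ψ' y) =
      independentMean T q n Ψ + c * independentMean T q n Ψ' := by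
  have h := independentMean_sum (T := T) (q := q) (Finset.univ : Finset Bool)
    (fun b => if b then 1 else c) (fun b => if b then Ψ else Ψ') n
  simpa using h

lemma BoundedMeasurable.independentMean {Q : ℕ → V → Ω → ℝ} (n : ℕ)
    (hQ : ∀ k < n, ∀ v ∈ T, BoundedMeasurable m (Q k v)) {Ψ : V → Ω → ℝ}
    (hΨ : ∀ y, BoundedMeasurable m (Ψ y)) :
    BoundedMeasurable m fun ω => independentMean T (fun k v => Q k v ω) n fun y => Ψ y ω := by
  induction n generalizing Ψ with
  | zero => exact hΨ 0
  | succ n ih =>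
    exact ih (fun k hk => hQ k (by omega)) (Ψ := fun y ω => ∑ j ∈ T, Q n j ω * Ψ (y + j) ω)
      fun y => BoundedMeasurable.sum T fun j hj => (hQ n n.lt_succ_self j hj).mul (hΨ _)

lemma finite_range_sum {D : ℕ → Ω → V} (hD : ∀ n ω, D n ω ∈ T) (n : ℕ) :
    (Set.range fun ω => ∑ k ∈ Finset.range n, D k ω).Finite := by
  induction n with
  | zero =>
    refine (Set.finite_singleton (0 : V)).subset ?_
    rintro _ ⟨ω, rfl⟩
    simp
  | succ n ih =>
    refine (ih.image2 (fun x v => x + v) T.finite_toSet).subset ?_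
    rintro _ ⟨ω, rfl⟩
    exact ⟨_, ⟨ω, rfl⟩, D n ω, hD n ω, by simp only [Finset.sum_range_succ]⟩

variable [NormedSpace ℝ V]

/-- A function of a process with finite-valued increments and of an independent copy of it
has a nonpositive mean if its value decreases under every perturbation of both arguments by
independent mean-zero vectors with the same law. -/
lemma integral_independentMean_le [IsProbabilityMeasure μ] {ℱ : Filtration ℕ mΩ}
    {Q : ℕ → V → Ω → ℝ} (hQ : ∀ n, IsMeanZeroWeight (ℱ n) T (Q n)) {D : ℕ → Ω → V}
    (hD : ∀ n ω, D n ω ∈ T) (hDm : ∀ n, StronglyMeasurable[ℱ (n + 1)] (D n))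
    (hQD : ∀ n, ∀ v ∈ T, Q n v =ᵐ[μ] μ⟦D n ⁻¹' {v} | ℱ n⟧) {H : V → V → ℝ}
    (hH : ∀ n ω x y, ∑ i ∈ T, ∑ j ∈ T, Q n i ω * (Q n j ω * H (x + i) (y + j)) ≤ H x y)
    (n : ℕ) :
    ∫ ω, independentMean T (fun k v => Q k v ω) n
      (H (∑ k ∈ Finset.range n, D k ω)) ∂μ ≤ H 0 0 := by
  induction n with
  | zero => simp [independentMean]
  | succ n ih =>
    refine le_trans ?_ ih
    set X : Ω → V := fun ω => ∑ k ∈ Finset.range n, D k ω with hX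
    have hXm : StronglyMeasurable[ℱ n] X := Finset.stronglyMeasurable_fun_sum _ fun k hk =>
      (hDm k).mono (ℱ.mono (Finset.mem_range.1 hk))
    have hXfin : (Set.range X).Finite := finite_range_sum hD n
    have hQb : ∀ k ≤ n, ∀ v ∈ T, BoundedMeasurable (ℱ n) (Q k v) := fun k hk v hv =>
      ((hQ k).boundedMeasurable hv).mono (ℱ.mono hk)
    have hF : ∀ F : V → ℝ, BoundedMeasurable (ℱ n) fun ω => F (X ω) := fun F =>
      BoundedMeasurable.comp_of_finite hXm hXfin F
    set G : V → Ω → ℝ := fun v ω => independentMean T (fun k v => Q k v ω) n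
      fun y => ∑ j ∈ T, Q n j ω * H (X ω + v) (y + j) with hG
    have hGb : ∀ v ∈ T, BoundedMeasurable (ℱ n) (G v) := fun v _ =>
      BoundedMeasurable.independentMean (Ψ := fun y ω => ∑ j ∈ T, Q n j ω * H (X ω + v) (y + j)) n
        (fun k hk => hQb k hk.le) fun y =>
        BoundedMeasurable.sum T fun j hj =>
          (hQb n le_rfl j hj).mul (hF fun x => H (x + v) (y + j))
    have h1 : ∀ ω, independentMean T (fun k v => Q k v ω) (n + 1)
        (H (∑ k ∈ Finset.range (n + 1), D k ω)) = G (D n ω) ω := by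
      intro ω
      rw [Finset.sum_range_succ]
      rfl
    simp_rw [h1]
    rw [integral_eq_integral_sum_weight (ℱ.le n) ((hDm n).mono (ℱ.le _)) (hD n) (hQ n) (hQD n) hGb]
    refine integral_mono ((BoundedMeasurable.sum T fun v hv =>
      (hQb n le_rfl v hv).mul (hGb v hv)).integrable (ℱ.le n))
      ((BoundedMeasurable.independentMean (Ψ := fun y ω => H (X ω) y) n
        (fun k hk => hQb k hk.le) fun y => hF fun x => H x y).integrable (ℱ.le n)) fun ω => ?_
    simp only [hG]
    -- The average over the value `i` of the true increment is moved inside the mean over the copy,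
    -- so that both perturbations of time `n` act at the same point `(X ω, y)` and `hH` applies.
    rw [← independentMean_sum]
    refine independentMean_mono (fun k v hv => (hQ k).nonneg v hv ω) n fun y => ?_
    simp_rw [Finset.mul_sum]
    exact hH n ω (X ω) y

/-- Comparison of a process with finite-valued increments with a decoupled copy, in both
directions. -/
lemma IsBurkholderFunction.decoupling [IsProbabilityMeasure μ] {r B : ℝ} {U : V → V → ℝ}
    (hU : IsBurkholderFunction r B U) {ℱ : Filtration ℕ mΩ}
    {Q : ℕ → V → Ω → ℝ} (hQ : ∀ n, IsMeanZeroWeight (ℱ n) T (Q n)) {D : ℕ → Ω → V}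
    (hD : ∀ n ω, D n ω ∈ T) (hDm : ∀ n, StronglyMeasurable[ℱ (n + 1)] (D n))
    (hQD : ∀ n, ∀ v ∈ T, Q n v =ᵐ[μ] μ⟦D n ⁻¹' {v} | ℱ n⟧) (N : ℕ) :
    (∫ ω, independentMean T (fun k v => Q k v ω) N (fun y => ‖y‖ ^ r) ∂μ ≤
      B * ∫ ω, ‖∑ k ∈ Finset.range N, D k ω‖ ^ r ∂μ) ∧
    ∫ ω, ‖∑ k ∈ Finset.range N, D k ω‖ ^ r ∂μ ≤
      B * ∫ ω, independentMean T (fun k v => Q k v ω) N (fun y => ‖y‖ ^ r) ∂μ := by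
  set X : Ω → V := fun ω => ∑ k ∈ Finset.range N, D k ω with hX
  have hXm : StronglyMeasurable[ℱ N] X := Finset.stronglyMeasurable_fun_sum _ fun k hk =>
    (hDm k).mono (ℱ.mono (Finset.mem_range.1 hk))
  have hXfin : (Set.range X).Finite := finite_range_sum hD N
  have hQb : ∀ k < N, ∀ v ∈ T, BoundedMeasurable (ℱ N) (Q k v) := fun k hk v hv =>
    ((hQ k).boundedMeasurable hv).mono (ℱ.mono hk.le)
  have hF : ∀ F : V → ℝ, BoundedMeasurable (ℱ N) fun ω => F (X ω) := fun F =>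
    BoundedMeasurable.comp_of_finite hXm hXfin F
  have hX_int : Integrable (fun ω => ‖X ω‖ ^ r) μ :=
    (hF fun x => ‖x‖ ^ r).integrable (ℱ.le N)
  have hI : ∀ H : V → V → ℝ,
      Integrable (fun ω => independentMean T (fun k v => Q k v ω) N (H (X ω))) μ := fun H =>
    (BoundedMeasurable.independentMean (Ψ := fun y ω => H (X ω) y) N hQb
      fun y => hF fun x => H x y).integrable (ℱ.le N)
  have hY_int := hI fun _ y => ‖y‖ ^ r
  have hnn : ∀ ω k, ∀ v ∈ T, 0 ≤ Q k v ω := fun ω k v hv => (hQ k).nonneg v hv ω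
  have hone : ∀ ω k, ∑ v ∈ T, Q k v ω = 1 := fun ω k => (hQ k).sum_eq_one ω
  have hexpand : ∀ ω (c c' : ℝ), independentMean T (fun k v => Q k v ω) N
      (fun y => c + c' * ‖y‖ ^ r) = c +
        c' * independentMean T (fun k v => Q k v ω) N (fun y => ‖y‖ ^ r) := by
    intro ω c c'
    rw [independentMean_add_const_mul c' (fun _ => c), independentMean_const (hone ω)]
  set F : V → V → ℝ := fun x y => U ((1 / 2 : ℝ) • (x + y)) ((1 / 2 : ℝ) • (x - y)) with hFdef
  have hF0 : F 0 0 ≤ 0 := by simpa [hFdef] using hU.zero_le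
  have hFle : ∀ x y, ‖y‖ ^ r - B * ‖x‖ ^ r ≤ F x y := by
    intro x y
    have h := hU.le ((1 / 2 : ℝ) • (x + y)) ((1 / 2 : ℝ) • (x - y))
    have e1 : (1 / 2 : ℝ) • (x + y) - (1 / 2 : ℝ) • (x - y) = y := by module
    have e2 : (1 / 2 : ℝ) • (x + y) + (1 / 2 : ℝ) • (x - y) = x := by module
    rwa [e1, e2] at h
  constructor
  · have h1 := integral_independentMean_le hQ hD hDm hQD (H := F)
      (fun n ω x y => hU.sum_sum_le (hQ n) ω x y) N
    have h2 : ∫ ω, ((-B) * ‖X ω‖ ^ r +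
        1 * independentMean T (fun k v => Q k v ω) N (fun y => ‖y‖ ^ r)) ∂μ ≤ 0 := by
      refine le_trans (integral_mono ((hX_int.const_mul (-B)).add (hY_int.const_mul 1))
        (hI F) fun ω => ?_) (h1.trans hF0)
      simp only
      rw [← hexpand]
      exact independentMean_mono (hnn ω) N fun y => by linarith [hFle (X ω) y]
    rw [integral_add (hX_int.const_mul (-B)) (hY_int.const_mul 1), integral_const_mul,
      integral_const_mul] at h2
    linarith
  -- The perturbation inequality is symmetric in the roles of the process and its copy, so
  -- exchanging them gives the reverse comparison.
  · have h1 := integral_independentMean_le hQ hD hDm hQD (H := fun x y => F y x)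
      (fun n ω x y => by
        refine le_trans (le_of_eq ?_) (hU.sum_sum_le (hQ n) ω y x)
        rw [Finset.sum_comm]
        exact Finset.sum_congr rfl fun i _ => Finset.sum_congr rfl fun j _ => by
          simp only [hFdef]; ring) N
    have h2 : ∫ ω, (‖X ω‖ ^ r +
        (-B) * independentMean T (fun k v => Q k v ω) N (fun y => ‖y‖ ^ r)) ∂μ ≤ 0 := by
      refine le_trans (integral_mono (hX_int.add (hY_int.const_mul (-B)))
        (hI fun x y => F y x) fun ω => ?_) (h1.trans hF0)
      simp only
      rw [← hexpand]
      exact independentMean_mono (hnn ω) N fun y => by linarith [hFle y (X ω)]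
    rw [integral_add hX_int (hY_int.const_mul (-B)), integral_const_mul] at h2
    linarith

end Decoupling

/-! ### Tangent processes: equality of conditional laws and the `L^r` comparison. -/

/-- `X` and `Y` have the same conditional law given `m`. -/
def SameCondLaw {Ω V : Type*} [MeasurableSpace V] (m : MeasurableSpace Ω)
    {_mΩ : MeasurableSpace Ω} (μ : Measure Ω) (X Y : Ω → V) : Prop :=
  ∀ A, MeasurableSet[m] A → ∀ B, MeasurableSet B → μ (A ∩ X ⁻¹' B) = μ (A ∩ Y ⁻¹' B)

namespace SameCondLaw

variable {Ω V : Type*} [MeasurableSpace V] {m mΩ : MeasurableSpace Ω} {μ : Measure Ω}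
  {X Y : Ω → V}

lemma setIntegral_indicator_preimage (hX : Measurable X) {A : Set Ω}
    {B : Set V} (hB : MeasurableSet B) :
    ∫ ω in A, (X ⁻¹' B).indicator (fun _ => (1 : ℝ)) ω ∂μ = μ.real (A ∩ X ⁻¹' B) := by
  rw [integral_indicator (hX hB), Measure.restrict_restrict (hX hB), setIntegral_const,
    smul_eq_mul, mul_one, Set.inter_comm]

lemma of_condExp [IsProbabilityMeasure μ] (hm : m ≤ mΩ) (hX : Measurable X) (hY : Measurable Y)
    (h : ∀ B, MeasurableSet B → μ⟦X ⁻¹' B | m⟧ =ᵐ[μ] μ⟦Y ⁻¹' B | m⟧) : SameCondLaw m μ X Y := by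
  intro A hA B hB
  rw [← measureReal_eq_measureReal_iff, ← setIntegral_indicator_preimage hX hB,
    ← setIntegral_indicator_preimage hY hB,
    ← setIntegral_condExp hm ((integrable_const (1 : ℝ)).indicator (hX hB)) hA,
    ← setIntegral_condExp (f := (Y ⁻¹' B).indicator _) hm
      ((integrable_const (1 : ℝ)).indicator (hY hB)) hA]
  exact setIntegral_congr_ae (hm A hA) ((h B hB).mono fun ω hω _ => hω)

lemma condExp_eq [IsProbabilityMeasure μ] (hm : m ≤ mΩ) (hX : Measurable X) (hY : Measurable Y)
    (h : SameCondLaw m μ X Y) {B : Set V} (hB : MeasurableSet B) :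
    μ⟦X ⁻¹' B | m⟧ =ᵐ[μ] μ⟦Y ⁻¹' B | m⟧ := by
  refine ae_eq_condExp_of_forall_setIntegral_eq hm ((integrable_const _).indicator (hY hB))
    (fun _ _ _ => integrable_condExp.integrableOn) (fun A hA _ => ?_)
    stronglyMeasurable_condExp.aestronglyMeasurable
  rw [setIntegral_condExp hm ((integrable_const _).indicator (hX hB)) hA,
    setIntegral_indicator_preimage hX hB, setIntegral_indicator_preimage hY hB, measureReal_def,
    h A hA B hB, measureReal_def]

lemma comp {W : Type*} [MeasurableSpace W] (h : SameCondLaw m μ X Y) {φ : V → W}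
    (hφ : Measurable φ) : SameCondLaw m μ (fun ω => φ (X ω)) fun ω => φ (Y ω) :=
  fun A hA _ hB => h A hA _ (hφ hB)

lemma indicator [Zero V] (hm : m ≤ mΩ) (h : SameCondLaw m μ X Y) {A : Set Ω}
    (hA : MeasurableSet[m] A) : SameCondLaw m μ (A.indicator X) (A.indicator Y) := by
  have key : ∀ (X : Ω → V) (A' : Set Ω) (B : Set V), μ (A' ∩ A.indicator X ⁻¹' B) =
      μ ((A' ∩ A) ∩ X ⁻¹' B) + μ ((A' \ A) ∩ {_ω : Ω | (0 : V) ∈ B}) := by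
    intro X A' B
    rw [← measure_inter_add_sdiff (A' ∩ A.indicator X ⁻¹' B) (hm A hA)]
    congr 2
    · ext ω
      by_cases hω : ω ∈ A <;> simp [hω]
    · ext ω
      by_cases hω : ω ∈ A <;> simp [hω]
  intro A' hA' B hB
  rw [key, key, h _ (hA'.inter hA) B hB]

end SameCondLaw

section Approximation

variable {V : Type*} [NormedAddCommGroup V] [NormedSpace ℝ V] [MeasurableSpace V] [BorelSpace V]

/-- Simple approximations `ψ` are replaced by `(ψ x - ψ (-x)) / 2`. Oddness preserves conditional
symmetry, and the linear bound serves dominated convergence. Since `V` may be nonseparable,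
convergence is asked only on a separable set, which will contain the ranges of the increments. -/
lemma exists_odd_simpleFunc_tendsto {A : Set V} (hA : TopologicalSpace.IsSeparable A) :
    ∃ φ : ℕ → SimpleFunc V V, (∀ k x, φ k (-x) = -φ k x) ∧ (∀ k x, ‖φ k x‖ ≤ 2 * ‖x‖) ∧
      ∀ x ∈ A, Filter.Tendsto (fun k => φ k x) Filter.atTop (nhds x) := by
  set s : Set V := insert 0 (A ∪ Neg.neg '' A) with hs
  have hsep : TopologicalSpace.IsSeparable s := by
    rw [hs, Set.insert_eq]
    exact (Set.finite_singleton _).isSeparable.union (hA.union (hA.image continuous_neg))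
  have := hsep.separableSpace
  have h0 : (0 : V) ∈ s := Set.mem_insert _ _
  set ψ : ℕ → SimpleFunc V V := fun k => SimpleFunc.approxOn id measurable_id s 0 h0 k with hψ
  have hψn : ∀ k x, ‖ψ k x‖ ≤ 2 * ‖x‖ := by
    intro k x
    have h := SimpleFunc.edist_approxOn_y0_le measurable_id h0 x k
    rw [id, edist_zero_left, edist_zero_left] at h
    rw [two_mul]
    exact_mod_cast h
  have hψt : ∀ x ∈ s, Filter.Tendsto (fun k => ψ k x) Filter.atTop (nhds x) := fun x hx =>
    SimpleFunc.tendsto_approxOn measurable_id h0 (subset_closure hx)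
  refine ⟨fun k => (ψ k - (ψ k).comp Neg.neg measurable_neg).map fun x => (1 / 2 : ℝ) • x,
    fun k x => ?_, fun k x => ?_, fun x hx => ?_⟩
  · simp only [SimpleFunc.map_apply, SimpleFunc.coe_sub, SimpleFunc.coe_comp, Pi.sub_apply,
      Function.comp_apply, neg_neg]
    module
  · simp only [SimpleFunc.map_apply, SimpleFunc.coe_sub, SimpleFunc.coe_comp, Pi.sub_apply,
      Function.comp_apply, norm_smul]
    have h1 := hψn k x
    have h2 := hψn k (-x)
    rw [norm_neg] at h2
    have h3 := norm_sub_le (ψ k x) (ψ k (-x))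
    rw [Real.norm_of_nonneg (by norm_num)]
    linarith
  · simp only [SimpleFunc.map_apply, SimpleFunc.coe_sub, SimpleFunc.coe_comp, Pi.sub_apply,
      Function.comp_apply]
    have h1 := hψt x (Set.mem_insert_of_mem _ (Or.inl hx))
    have h2 := hψt (-x) (Set.mem_insert_of_mem _ (Or.inr ⟨x, hx, rfl⟩))
    have h3 := (h1.sub h2).const_smul (1 / 2 : ℝ)
    have h4 : (1 / 2 : ℝ) • (x - -x) = x := by module
    rwa [h4] at h3

end Approximation

section Tangent

variable {Ω V : Type*} [NormedAddCommGroup V] [MeasurableSpace V] {mΩ : MeasurableSpace Ω}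
  {μ : Measure Ω}

/-- The increments of a conditionally symmetric process and of a tangent process. -/
structure IsTangentPair (ℱ : Filtration ℕ mΩ) (μ : Measure Ω) (d e : ℕ → Ω → V) : Prop where
  left_measurable : ∀ n, StronglyMeasurable[ℱ (n + 1)] (d n)
  right_measurable : ∀ n, StronglyMeasurable[ℱ (n + 1)] (e n)
  tangent : ∀ n, SameCondLaw (ℱ n) μ (d n) (e n)
  symmetric : ∀ n, SameCondLaw (ℱ n) μ (d n) fun ω => -d n ω

variable {ℱ : Filtration ℕ mΩ} {d e : ℕ → Ω → V}

lemma IsTangentPair.comp (h : IsTangentPair ℱ μ d e) {φ : V → V} (hφ : Measurable φ)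
    (hφs : ∀ (m : MeasurableSpace Ω) (X : Ω → V), StronglyMeasurable[m] X →
      StronglyMeasurable[m] fun ω => φ (X ω)) (hodd : ∀ x, φ (-x) = -φ x) :
    IsTangentPair ℱ μ (fun n ω => φ (d n ω)) fun n ω => φ (e n ω) where
  left_measurable n := hφs _ _ (h.left_measurable n)
  right_measurable n := hφs _ _ (h.right_measurable n)
  tangent n := (h.tangent n).comp hφ
  symmetric n := by
    have := (h.symmetric n).comp hφ
    simpa only [hodd] using this

lemma IsTangentPair.indicator (h : IsTangentPair ℱ μ d e) {A : ℕ → Set Ω}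
    (hA : ∀ n, MeasurableSet[ℱ n] (A n)) :
    IsTangentPair ℱ μ (fun n => (A n).indicator (d n)) fun n => (A n).indicator (e n) where
  left_measurable n := (h.left_measurable n).indicator (ℱ.mono n.le_succ _ (hA n))
  right_measurable n := (h.right_measurable n).indicator (ℱ.mono n.le_succ _ (hA n))
  tangent n := (h.tangent n).indicator (ℱ.le n) (hA n)
  symmetric n := by
    have := (h.symmetric n).indicator (ℱ.le n) (hA n)
    have h1 : (A n).indicator (fun ω => -d n ω) = fun ω => -(A n).indicator (d n) ω := by
      ext ω
      by_cases hω : ω ∈ A n <;> simp [hω]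
    rwa [h1] at this

variable [NormedSpace ℝ V] [BorelSpace V]

/-- Symmetry makes the conditional weights mean-zero, and tangency lets the weights of `d` serve for
`e` too. Both sums are compared with the same decoupled one, at the cost of one factor `B` each. -/
lemma IsBurkholderFunction.integral_tangent_le_simpleFunc [IsProbabilityMeasure μ] {r B : ℝ}
    (hB : 0 < B) {U : V → V → ℝ} (hU : IsBurkholderFunction r B U) (h : IsTangentPair ℱ μ d e)
    (φ : SimpleFunc V V) (hodd : ∀ x, φ (-x) = -φ x) (N : ℕ) :
    ∫ ω, ‖∑ k ∈ Finset.range N, φ (e k ω)‖ ^ r ∂μ ≤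
      B ^ 2 * ∫ ω, ‖∑ k ∈ Finset.range N, φ (d k ω)‖ ^ r ∂μ := by
  have h' := h.comp φ.measurable
    (fun _ _ hX => φ.stronglyMeasurable.comp_measurable hX.measurable) hodd
  have hmem : ∀ x, φ x ∈ φ.range := fun x => SimpleFunc.mem_range_self φ x
  have hneg : ∀ v ∈ φ.range, -v ∈ φ.range := by
    intro v hv
    obtain ⟨x, rfl⟩ := SimpleFunc.mem_range.1 hv
    rw [← hodd]
    exact hmem _
  have h0 : (0 : V) ∈ φ.range := by
    have h1 : φ 0 = -φ 0 := by simpa using hodd 0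
    have h2 : (2 : ℝ) • φ 0 = 0 := by
      rw [two_smul]
      nth_rewrite 1 [h1]
      exact neg_add_cancel _
    rw [← (smul_eq_zero_iff_right two_ne_zero).1 h2]
    exact hmem 0
  have hdm : ∀ n, Measurable fun ω => φ (d n ω) := fun n =>
    ((h'.left_measurable n).mono (ℱ.le _)).measurable
  have hem : ∀ n, Measurable fun ω => φ (e n ω) := fun n =>
    ((h'.right_measurable n).mono (ℱ.le _)).measurable
  have hQ : ∀ n, ∃ q : V → Ω → ℝ, IsMeanZeroWeight (ℱ n) φ.range q ∧
      ∀ v ∈ φ.range, q v =ᵐ[μ] μ⟦(fun ω => φ (d n ω)) ⁻¹' {v} | ℱ n⟧ := by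
    intro n
    refine exists_isMeanZeroWeight (ℱ.le n) ((h'.left_measurable n).mono (ℱ.le _))
      (fun ω => hmem _) h0 ?_
    have h1 : ∀ᵐ ω ∂μ, ∀ v ∈ φ.range, (μ⟦(fun ω => φ (d n ω)) ⁻¹' {v} | ℱ n⟧) ω =
        (μ⟦(fun ω => φ (d n ω)) ⁻¹' {-v} | ℱ n⟧) ω := by
      refine (ae_ball_iff φ.range.countable_toSet).2 fun v _ => ?_
      have h2 := (h'.symmetric n).condExp_eq (ℱ.le n) (hdm n) (hdm n).neg
        (measurableSet_singleton v)
      have h3 : (-fun ω => φ (d n ω)) ⁻¹' {v} = (fun ω => φ (d n ω)) ⁻¹' {-v} := by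
        ext ω
        simp [neg_eq_iff_eq_neg]
      rwa [h3] at h2
    filter_upwards [h1] with ω hω
    set S := ∑ v ∈ φ.range, (μ⟦(fun ω => φ (d n ω)) ⁻¹' {v} | ℱ n⟧) ω • v with hS
    have h2 : S = -S := by
      rw [hS, ← Finset.sum_neg_distrib]
      refine Finset.sum_nbij' Neg.neg Neg.neg hneg hneg (fun _ _ => neg_neg _)
        (fun _ _ => neg_neg _) fun v hv => ?_
      rw [hω v hv]
      simp
    have h3 : (2 : ℝ) • S = 0 := by
      rw [two_smul]
      nth_rewrite 1 [h2]
      exact neg_add_cancel _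
    exact (smul_eq_zero_iff_right two_ne_zero).1 h3
  choose Q hQ hQd using hQ
  have hd := hU.decoupling hQ (fun n ω => hmem _) h'.left_measurable hQd N
  have he := hU.decoupling hQ (fun n ω => hmem _) h'.right_measurable (fun n v hv =>
    (hQd n v hv).trans ((h'.tangent n).condExp_eq (ℱ.le n) (hdm n) (hem n)
      (measurableSet_singleton v))) N
  calc ∫ ω, ‖∑ k ∈ Finset.range N, φ (e k ω)‖ ^ r ∂μ ≤ B * (B * _) :=
        he.2.trans (mul_le_mul_of_nonneg_left hd.1 hB.le)
    _ = _ := by ring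

/-- The `L^r` estimate for tangent processes with bounded increments. -/
lemma IsBurkholderFunction.integral_tangent_le [IsProbabilityMeasure μ] {r B : ℝ} (hr : 0 < r)
    (hB : 0 < B) {U : V → V → ℝ} (hU : IsBurkholderFunction r B U) (h : IsTangentPair ℱ μ d e)
    {R : ℝ} (hd : ∀ n ω, ‖d n ω‖ ≤ R) (he : ∀ n ω, ‖e n ω‖ ≤ R) (N : ℕ) :
    ∫ ω, ‖∑ k ∈ Finset.range N, e k ω‖ ^ r ∂μ ≤
      B ^ 2 * ∫ ω, ‖∑ k ∈ Finset.range N, d k ω‖ ^ r ∂μ := by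
  have hsep : TopologicalSpace.IsSeparable
      ((⋃ n, Set.range (d n)) ∪ ⋃ n, Set.range (e n)) :=
    (TopologicalSpace.IsSeparable.iUnion fun n =>
      ((h.left_measurable n).mono (ℱ.le _)).isSeparable_range).union
    (TopologicalSpace.IsSeparable.iUnion fun n =>
      ((h.right_measurable n).mono (ℱ.le _)).isSeparable_range)
  obtain ⟨φ, hodd, hφn, hφt⟩ := exists_odd_simpleFunc_tendsto hsep
  have key : ∀ c : ℕ → Ω → V, (∀ n, StronglyMeasurable (c n)) → (∀ n ω, ‖c n ω‖ ≤ R) →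
      (∀ n ω, c n ω ∈ (⋃ n, Set.range (d n)) ∪ ⋃ n, Set.range (e n)) →
      Filter.Tendsto (fun k => ∫ ω, ‖∑ j ∈ Finset.range N, φ k (c j ω)‖ ^ r ∂μ) Filter.atTop
        (nhds (∫ ω, ‖∑ j ∈ Finset.range N, c j ω‖ ^ r ∂μ)) := by
    intro c hcm hcR hc
    refine tendsto_integral_of_dominated_convergence (fun _ => (N * (2 * R)) ^ r) (fun k => ?_)
      (integrable_const _) (fun k => ae_of_all _ fun ω => ?_) (ae_of_all _ fun ω => ?_)
    · have : StronglyMeasurable fun ω => ∑ j ∈ Finset.range N, φ k (c j ω) :=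
        Finset.stronglyMeasurable_fun_sum _ fun j _ =>
          (φ k).stronglyMeasurable.comp_measurable (hcm j).measurable
      exact (this.norm.measurable.pow_const r).aestronglyMeasurable
    · rw [Real.norm_of_nonneg (by positivity)]
      refine Real.rpow_le_rpow (norm_nonneg _) ((norm_sum_le _ _).trans ?_) hr.le
      calc ∑ j ∈ Finset.range N, ‖φ k (c j ω)‖ ≤ ∑ j ∈ Finset.range N, 2 * R :=
            Finset.sum_le_sum fun j _ =>
              (hφn _ _).trans (mul_le_mul_of_nonneg_left (hcR j ω) zero_le_two)
        _ = N * (2 * R) := by simp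
    · exact (tendsto_finsetSum _ fun j _ => hφt _ (hc j ω)).norm.rpow_const (Or.inr hr.le)
  refine le_of_tendsto_of_tendsto'
    (key e (fun n => (h.right_measurable n).mono (ℱ.le _)) he fun n ω =>
      Or.inr (Set.mem_iUnion.2 ⟨n, ω, rfl⟩))
    ((key d (fun n => (h.left_measurable n).mono (ℱ.le _)) hd fun n ω =>
      Or.inl (Set.mem_iUnion.2 ⟨n, ω, rfl⟩)).const_mul (B ^ 2)) fun k => ?_
  exact hU.integral_tangent_le_simpleFunc hB h (φ k) (hodd k) N

end Tangent

/-! ### Pathwise bounds for sums over a start-stop window and for truncated sums. -/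

section DeterministicSums

variable {V : Type*} [NormedAddCommGroup V]

/-- `B` means that the window has opened and `C` that it has not closed. A sum over a window is the
difference of two partial sums. -/
lemma sum_start_stop_bound {y : ℕ → V} {M : ℝ} {B C : ℕ → Prop} [∀ k, Decidable (B k ∧ C k)]
    (hy : ∀ n, ‖∑ k ∈ Finset.range n, y k‖ ≤ M) (hB : ∀ n, B n → B (n + 1))
    (hC : ∀ n, C (n + 1) → C n) (n : ℕ) :
    (¬B n → ∑ k ∈ Finset.range n, (if B k ∧ C k then y k else 0) = 0) ∧
      ‖∑ k ∈ Finset.range n, (if B k ∧ C k then y k else 0)‖ ≤ 2 * M := by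
  set F : ℕ → V := fun n => ∑ k ∈ Finset.range n, y k with hF
  set T : ℕ → V := fun n => ∑ k ∈ Finset.range n, (if B k ∧ C k then y k else 0) with hT
  have hFs : ∀ n, F (n + 1) = F n + y n := fun n => Finset.sum_range_succ _ _
  have hTs : ∀ n, T (n + 1) = T n + (if B n ∧ C n then y n else 0) := fun n =>
    Finset.sum_range_succ _ _
  have key : ∀ n, (¬B n → T n = 0) ∧ (C n → ∃ j, T n = F n - F j) ∧ ∃ i j, T n = F i - F j := by
    intro n
    induction n with
    | zero => exact ⟨fun _ => by simp [hT], fun _ => ⟨0, by simp [hT]⟩, 0, 0, by simp [hT]⟩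
    | succ n ih =>
      obtain ⟨h1, h2, h3⟩ := ih
      by_cases hBn : B n
      · by_cases hCn : C n
        · obtain ⟨j, hj⟩ := h2 hCn
          have h4 : T (n + 1) = F (n + 1) - F j := by
            rw [hTs, hFs, if_pos ⟨hBn, hCn⟩, hj]
            abel
          exact ⟨fun h => absurd (hB n hBn) h, fun _ => ⟨j, h4⟩, _, j, h4⟩
        · have h4 : T (n + 1) = T n := by rw [hTs, if_neg fun h => hCn h.2, add_zero]
          rw [h4]
          exact ⟨fun h => absurd (hB n hBn) h, fun h => absurd (hC n h) hCn, h3⟩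
      · have h4 : T (n + 1) = 0 := by rw [hTs, if_neg fun h => hBn h.1, add_zero, h1 hBn]
        rw [h4]
        exact ⟨fun _ => rfl, fun _ => ⟨n + 1, (sub_self _).symm⟩, 0, 0, (sub_self _).symm⟩
  obtain ⟨h1, -, i, j, h3⟩ := key n
  refine ⟨h1, ?_⟩
  change ‖T n‖ ≤ _
  rw [h3, two_mul]
  exact (norm_sub_le _ _).trans (add_le_add (hy i) (hy j))

/-- When the window opens, the partial sum has just passed `a` and is at most `a + ρ`. When it
closes, it exceeds `a + b + ρ`, so the window contributes at least `b`. -/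
lemma le_norm_sum_start_stop {x : ℕ → V} {a b ρ : ℝ} (ha : 0 ≤ a) (hb : 0 ≤ b)
    (hx : ∀ n, ‖x n‖ ≤ ρ) {B C : ℕ → Prop} [∀ k, Decidable (B k ∧ C k)]
    (hB : ∀ n, B n ↔ ∃ k ≤ n, a < ‖∑ j ∈ Finset.range k, x j‖)
    (hC : ∀ n, C n ↔ ∀ k ≤ n, ‖∑ j ∈ Finset.range k, x j‖ ≤ a + b + ρ) (n : ℕ) (hn : ¬C n) :
    b ≤ ‖∑ k ∈ Finset.range n, (if B k ∧ C k then x k else 0)‖ := by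
  set G : ℕ → V := fun n => ∑ k ∈ Finset.range n, x k with hG
  set S : ℕ → V := fun n => ∑ k ∈ Finset.range n, (if B k ∧ C k then x k else 0) with hS
  have hρ : 0 ≤ ρ := (norm_nonneg _).trans (hx 0)
  have hGs : ∀ n, G (n + 1) = G n + x n := fun n => Finset.sum_range_succ _ _
  have hSs : ∀ n, S (n + 1) = S n + (if B n ∧ C n then x n else 0) := fun n =>
    Finset.sum_range_succ _ _
  have hBs : ∀ n, B n → B (n + 1) := fun n h => by
    obtain ⟨k, hk, h⟩ := (hB n).1 h
    exact (hB _).2 ⟨k, hk.trans n.le_succ, h⟩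
  have hCs : ∀ n, C (n + 1) ↔ C n ∧ ‖G (n + 1)‖ ≤ a + b + ρ := fun n => by
    rw [hC, hC]
    refine ⟨fun h => ⟨fun k hk => h k (hk.trans n.le_succ), h _ le_rfl⟩, fun h k hk => ?_⟩
    rcases Nat.le_succ_iff.1 hk with hk | rfl
    exacts [h.1 k hk, h.2]
  have hnB : ∀ n, ¬B n → ‖G n‖ ≤ a ∧ C n := fun n h => by
    rw [hB] at h
    push Not at h
    exact ⟨h n le_rfl, (hC n).2 fun k hk => (h k hk).trans (by linarith)⟩
  have key : ∀ n, (¬B n → S n = 0) ∧ (C n → ‖G n - S n‖ ≤ a + ρ) ∧ (¬C n → b ≤ ‖S n‖) := by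
    intro n
    induction n with
    | zero =>
      refine ⟨fun _ => by simp [hS], fun _ => ?_, fun h => ?_⟩
      · simp only [hG, hS, Finset.range_zero, Finset.sum_empty, sub_zero, norm_zero]
        positivity
      · refine absurd ((hC 0).2 fun k hk => ?_) h
        rw [Nat.le_zero.1 hk]
        simp only [Finset.range_zero, Finset.sum_empty, norm_zero]
        positivity
    | succ n ih =>
      obtain ⟨h1, h2, h3⟩ := ih
      by_cases hBn : B n
      · refine ⟨fun h => absurd (hBs n hBn) h, ?_⟩
        by_cases hCn : C n
        · have h4 : G (n + 1) - S (n + 1) = G n - S n := by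
            rw [hGs, hSs, if_pos ⟨hBn, hCn⟩]
            abel
          refine ⟨fun _ => h4 ▸ h2 hCn, fun h => ?_⟩
          rw [hCs, not_and, not_le] at h
          have h5 := norm_sub_norm_le (G (n + 1)) (G (n + 1) - S (n + 1))
          rw [sub_sub_cancel, h4] at h5
          linarith [h hCn, h2 hCn]
        · have h4 : S (n + 1) = S n := by rw [hSs, if_neg fun h => hCn h.2, add_zero]
          exact ⟨fun h => absurd ((hCs n).1 h).1 hCn, fun _ => h4 ▸ h3 hCn⟩
      · have h4 : S (n + 1) = 0 := by rw [hSs, if_neg fun h => hBn h.1, add_zero, h1 hBn]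
        obtain ⟨h5, h6⟩ := hnB n hBn
        have h7 : ‖G (n + 1)‖ ≤ a + ρ := by
          rw [hGs]
          exact (norm_add_le _ _).trans (add_le_add h5 (hx n))
        exact ⟨fun _ => h4, fun _ => by rwa [h4, sub_zero],
          fun h => absurd ((hCs n).2 ⟨h6, by linarith⟩) h⟩
  exact (key n).2.2 hn

/-- While `f` stays in the ball the truncation is inactive and the sum equals `f`. The exit adds at
most one increment of norm `2 * s`, after which the sum is frozen. -/
lemma truncated_sum_bound {f : ℕ → V} (h0 : f 0 = 0) {s : ℝ} (hs : 0 ≤ s) {A : ℕ → Prop}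
    [DecidablePred A] (hA : ∀ n, A n ↔ ∀ k ≤ n, ‖f k‖ ≤ s) (n : ℕ) :
    ‖∑ k ∈ Finset.range n, (if A k then
      (if ‖f (k + 1) - f k‖ ≤ 2 * s then f (k + 1) - f k else 0) else 0)‖ ≤ 3 * s := by
  set F : ℕ → V := fun n => ∑ k ∈ Finset.range n, (if A k then
      (if ‖f (k + 1) - f k‖ ≤ 2 * s then f (k + 1) - f k else 0) else 0) with hF
  have hFs : ∀ n, F (n + 1) = F n + (if A n then
      (if ‖f (n + 1) - f n‖ ≤ 2 * s then f (n + 1) - f n else 0) else 0) := fun n =>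
    Finset.sum_range_succ _ _
  have key : ∀ n, (A n → F n = f n) ∧ ‖F n‖ ≤ 3 * s := by
    intro n
    induction n with
    | zero => exact ⟨fun _ => by simp [hF, h0], by simp [hF]; positivity⟩
    | succ n ih =>
      obtain ⟨h1, h2⟩ := ih
      by_cases hAn : A n
      · have h3 := (hA n).1 hAn n le_rfl
        rw [hFs, if_pos hAn, h1 hAn]
        refine ⟨fun h => ?_, ?_⟩
        · have h4 := (hA _).1 h _ le_rfl
          rw [if_pos ((norm_sub_le _ _).trans (by linarith)), add_sub_cancel]
        · refine (norm_add_le _ _).trans ?_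
          split_ifs with h5
          · linarith
          · rw [norm_zero]
            linarith
      · rw [hFs, if_neg hAn, add_zero]
        exact ⟨fun h => absurd ((hA n).2 fun k hk => (hA _).1 h k (hk.trans n.le_succ)) hAn, h2⟩
  exact (key n).2

end DeterministicSums

/-! ### Tail decay of every polynomial order for bounded increments. -/

section Tail

variable {Ω V : Type*} [NormedAddCommGroup V] [NormedSpace ℝ V] [MeasurableSpace V] [BorelSpace V]
  {mΩ : MeasurableSpace Ω} {μ : Measure Ω} [IsProbabilityMeasure μ] {ℱ : Filtration ℕ mΩ}
  {d e : ℕ → Ω → V} {r B : ℝ} {U : V → V → ℝ}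

/-- One step of the exponential decay of the tail of a sum with bounded increments whose tangent
sum is bounded. -/
lemma IsBurkholderFunction.measureReal_add_lt_le (hr : 0 < r) (hB : 0 < B)
    (hU : IsBurkholderFunction r B U) (h : IsTangentPair ℱ μ d e) {M ρ a b : ℝ}
    (hd : ∀ n ω, ‖d n ω‖ ≤ ρ) (he : ∀ n ω, ‖e n ω‖ ≤ ρ)
    (hdM : ∀ n ω, ‖∑ k ∈ Finset.range n, d k ω‖ ≤ M) (ha : 0 ≤ a) (hb : 0 < b) (N : ℕ) :
    μ.real {ω | ∃ n ≤ N, a + b + ρ < ‖∑ k ∈ Finset.range n, e k ω‖} ≤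
      B ^ 2 * (2 * M / b) ^ r *
        μ.real {ω | ∃ n ≤ N, a < ‖∑ k ∈ Finset.range n, e k ω‖} := by
  classical
  have hM : 0 ≤ M := by
    have : Nonempty Ω := μ.nonempty_of_neZero
    exact (norm_nonneg _).trans (hdM 0 (Classical.arbitrary Ω))
  set P : ℕ → Set Ω := fun n => {ω | ∃ k ≤ n, a < ‖∑ j ∈ Finset.range k, e j ω‖} with hP
  set C : ℕ → Set Ω := fun n => {ω | ∀ k ≤ n, ‖∑ j ∈ Finset.range k, e j ω‖ ≤ a + b + ρ} with hC
  have hGm : ∀ k n, k ≤ n → StronglyMeasurable[ℱ n] fun ω => ∑ j ∈ Finset.range k, e j ω :=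
    fun k n hk => Finset.stronglyMeasurable_fun_sum _ fun j hj =>
      (h.right_measurable j).mono (ℱ.mono ((Finset.mem_range.1 hj).trans_le hk))
  have hPm : ∀ n, MeasurableSet[ℱ n] (P n) := by
    intro n
    have : P n = ⋃ k ∈ Finset.range (n + 1), {ω | a < ‖∑ j ∈ Finset.range k, e j ω‖} := by
      ext ω
      simp [hP]
    rw [this]
    exact Finset.measurableSet_biUnion _ fun k hk => measurableSet_lt measurable_const
      (hGm k n (Nat.lt_succ_iff.1 (Finset.mem_range.1 hk))).norm.measurable
  have hCm : ∀ n, MeasurableSet[ℱ n] (C n) := by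
    intro n
    have : C n = ⋂ k ∈ Finset.range (n + 1),
        {ω | ‖∑ j ∈ Finset.range k, e j ω‖ ≤ a + b + ρ} := by
      ext ω
      simp [hC]
    rw [this]
    exact Finset.measurableSet_biInter _ fun k hk => measurableSet_le
      (hGm k n (Nat.lt_succ_iff.1 (Finset.mem_range.1 hk))).norm.measurable measurable_const
  have hbd : ∀ c : ℕ → Ω → V, (∀ n ω, ‖c n ω‖ ≤ ρ) →
      ∀ n ω, ‖(P n ∩ C n).indicator (c n) ω‖ ≤ ρ := fun c hc n ω =>
    (norm_indicator_le_norm_self _ _).trans (hc n ω)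
  -- The window depends only on the past, so the windowed increments remain tangent. The windowed
  -- sum of `d` vanishes unless level `a` is passed and is at most `2 * M`; that of `e` is at least
  -- `b` once level `a + b + ρ` is passed. Chebyshev's inequality combines the two.
  have hK := hU.integral_tangent_le hr hB (h.indicator fun n => (hPm n).inter (hCm n))
    (hbd d hd) (hbd e he) N
  have hite : ∀ (c : ℕ → Ω → V) ω, ∑ k ∈ Finset.range N, (P k ∩ C k).indicator (c k) ω =
      ∑ k ∈ Finset.range N, (if ω ∈ P k ∧ ω ∈ C k then c k ω else 0) := fun c ω =>
    Finset.sum_congr rfl fun k _ => by simp only [Set.indicator_apply, Set.mem_inter_iff]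
  simp only [hite] at hK
  have hd' : ∀ ω, ‖∑ k ∈ Finset.range N, (if ω ∈ P k ∧ ω ∈ C k then d k ω else 0)‖ ^ r ≤
      (P N).indicator (fun _ => (2 * M) ^ r) ω := by
    intro ω
    obtain ⟨h1, h2⟩ := sum_start_stop_bound (y := fun k => d k ω) (B := fun k => ω ∈ P k)
      (C := fun k => ω ∈ C k) (fun n => hdM n ω)
      (fun n ⟨k, hk, hn⟩ => ⟨k, hk.trans n.le_succ, hn⟩)
      (fun n hn k hk => hn k (hk.trans n.le_succ)) N
    by_cases hω : ω ∈ P N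
    · rw [Set.indicator_of_mem hω]
      exact Real.rpow_le_rpow (norm_nonneg _) h2 hr.le
    · rw [Set.indicator_of_notMem hω, h1 hω, norm_zero, Real.zero_rpow hr.ne']
  have he' : ∀ ω, ω ∉ C N →
      b ≤ ‖∑ k ∈ Finset.range N, (if ω ∈ P k ∧ ω ∈ C k then e k ω else 0)‖ := fun ω hω =>
    le_norm_sum_start_stop ha hb.le (fun n => he n ω) (B := fun k => ω ∈ P k)
      (C := fun k => ω ∈ C k) (fun n => Iff.rfl) (fun n => Iff.rfl) N hω
  have hmeas : ∀ c : ℕ → Ω → V, (∀ n, StronglyMeasurable (c n)) → StronglyMeasurable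
      fun ω => ∑ k ∈ Finset.range N, (if ω ∈ P k ∧ ω ∈ C k then c k ω else 0) := by
    intro c hc
    simp only [← hite]
    exact Finset.stronglyMeasurable_fun_sum _ fun k _ =>
      (hc k).indicator ((ℱ.le k _ (hPm k)).inter (ℱ.le k _ (hCm k)))
  have hint : ∀ c : ℕ → Ω → V, (∀ n, StronglyMeasurable (c n)) → (∀ n ω, ‖c n ω‖ ≤ ρ) →
      Integrable (fun ω => ‖∑ k ∈ Finset.range N,
        (if ω ∈ P k ∧ ω ∈ C k then c k ω else 0)‖ ^ r) μ := by
    intro c hc hcρ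
    refine Integrable.of_bound ((hmeas c hc).norm.measurable.pow_const r).aestronglyMeasurable
      ((N * ρ) ^ r) (ae_of_all _ fun ω => ?_)
    rw [Real.norm_of_nonneg (by positivity), ← hite]
    refine Real.rpow_le_rpow (norm_nonneg _) ((norm_sum_le _ _).trans ?_) hr.le
    refine (Finset.sum_le_sum fun k _ => hbd c hcρ k ω).trans (le_of_eq ?_)
    simp
  have hem := fun n => (h.right_measurable n).mono (ℱ.le (n + 1))
  have hdm := fun n => (h.left_measurable n).mono (ℱ.le (n + 1))
  have hcheb := mul_meas_ge_le_integral_of_nonneg (μ := μ)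
    (ae_of_all _ fun ω => by positivity) (hint e hem he) (b ^ r)
  have hsub : {ω | ∃ n ≤ N, a + b + ρ < ‖∑ k ∈ Finset.range n, e k ω‖} ⊆
      {ω | b ^ r ≤ ‖∑ k ∈ Finset.range N, (if ω ∈ P k ∧ ω ∈ C k then e k ω else 0)‖ ^ r} := by
    rintro ω ⟨n, hn, hω⟩
    exact Real.rpow_le_rpow hb.le (he' ω fun hc => (hc n hn).not_gt hω) hr.le
  have hleft := measureReal_mono (μ := μ) hsub
  have hright : ∫ ω, ‖∑ k ∈ Finset.range N, (if ω ∈ P k ∧ ω ∈ C k then d k ω else 0)‖ ^ r ∂μ ≤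
      (2 * M) ^ r * μ.real (P N) := by
    refine (integral_mono (hint d hdm hd) ((integrable_const _).indicator (ℱ.le N _ (hPm N)))
      hd').trans (le_of_eq ?_)
    rw [integral_indicator (ℱ.le N _ (hPm N)), setIntegral_const, smul_eq_mul, mul_comm]
  have hbr : 0 < b ^ r := Real.rpow_pos_of_pos hb r
  refine hleft.trans ?_
  rw [Real.div_rpow (by positivity) hb.le, mul_assoc, div_mul_eq_mul_div, ← mul_div_assoc,
    le_div_iff₀ hbr, mul_comm]
  exact (hcheb.trans hK).trans (mul_le_mul_of_nonneg_left hright (by positivity))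

lemma IsBurkholderFunction.measureReal_nsmul_lt_le (hr : 0 < r) (hB : 0 < B)
    (hU : IsBurkholderFunction r B U) (h : IsTangentPair ℱ μ d e) {M ρ b : ℝ}
    (hd : ∀ n ω, ‖d n ω‖ ≤ ρ) (he : ∀ n ω, ‖e n ω‖ ≤ ρ)
    (hdM : ∀ n ω, ‖∑ k ∈ Finset.range n, d k ω‖ ≤ M) (hρ : 0 ≤ ρ) (hM : 0 ≤ M) (hb : 0 < b)
    (N m : ℕ) :
    μ.real {ω | ∃ n ≤ N, m * (b + ρ) < ‖∑ k ∈ Finset.range n, e k ω‖} ≤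
      (B ^ 2 * (2 * M / b) ^ r) ^ m := by
  induction m with
  | zero => simp [measureReal_le_one]
  | succ m ih =>
    have h1 := hU.measureReal_add_lt_le hr hB h hd he hdM (a := m * (b + ρ)) (by positivity) hb N
    have h2 : ((m + 1 : ℕ) : ℝ) * (b + ρ) = m * (b + ρ) + b + ρ := by push_cast; ring
    rw [h2, pow_succ']
    exact h1.trans (mul_le_mul_of_nonneg_left ih (by positivity))

/-- The level `t` is climbed in `m > p / r` stages of height `t / m = b + 2 * s`, each contributing
a factor of order `(s / t) ^ r`. If `t ≤ 4 * m * s`, the bound exceeds `1`; otherwise `b ≥ t / (2 *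
m)`, whence the constant `12 * m`, and `s ≤ t` lets the exponent `r * m` be lowered to `p`. -/
lemma IsBurkholderFunction.exists_measureReal_lt_le {p : ℝ} (hp : 0 < p) (hr : 0 < r)
    (hB : 0 < B) (hU : IsBurkholderFunction r B U) :
    ∃ C : ℝ, 0 < C ∧ ∀ (Ω : Type w) (mΩ : MeasurableSpace Ω) (μ : Measure Ω)
      (_ : IsProbabilityMeasure μ) (ℱ : Filtration ℕ mΩ) (d e : ℕ → Ω → V) (s t : ℝ), 0 < s →
      0 < t → IsTangentPair ℱ μ d e → (∀ n ω, ‖d n ω‖ ≤ 2 * s) → (∀ n ω, ‖e n ω‖ ≤ 2 * s) →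
      (∀ n ω, ‖∑ k ∈ Finset.range n, d k ω‖ ≤ 3 * s) → ∀ N : ℕ,
      μ.real {ω | ∃ n ≤ N, t < ‖∑ k ∈ Finset.range n, e k ω‖} ≤ C * (s ^ p / t ^ p) := by
  obtain ⟨m, hm⟩ := exists_nat_gt (p / r)
  have hm0 : (0 : ℝ) < m := (by positivity : 0 < p / r).trans hm
  have hmp : p ≤ r * m := by
    rw [div_lt_iff₀ hr] at hm
    linarith
  refine ⟨(4 * m) ^ p + (B ^ 2 * (12 * m) ^ r) ^ m, by positivity, ?_⟩
  intro Ω mΩ μ _ ℱ d e s t hs ht h hd he hdM N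
  have hst : s ^ p / t ^ p = (s / t) ^ p := (Real.div_rpow hs.le ht.le p).symm
  rw [hst, add_mul]
  have hpos1 : 0 ≤ (4 * (m : ℝ)) ^ p * (s / t) ^ p := by positivity
  have hpos2 : 0 ≤ (B ^ 2 * (12 * (m : ℝ)) ^ r) ^ m * (s / t) ^ p := by positivity
  rcases le_total t (4 * m * s) with hle | hle
  · have h1 : 1 ≤ (4 * (m : ℝ)) ^ p * (s / t) ^ p := by
      rw [← Real.mul_rpow (by positivity) (by positivity)]
      refine Real.one_le_rpow ?_ hp.le
      rw [← mul_div_assoc, le_div_iff₀ ht, one_mul]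
      exact hle
    exact measureReal_le_one.trans (by linarith)
  · set b := t / m - 2 * s with hb
    have h1 : t / (2 * m) ≤ b := by
      have h2 : t / m = t / (2 * m) + t / (2 * m) := by field_simp; ring
      have h3 : 2 * s ≤ t / (2 * m) := by
        rw [le_div_iff₀ (by positivity)]
        linarith
      linarith
    have hb0 : 0 < b := (by positivity : 0 < t / (2 * m)).trans_le h1
    have h4 := hU.measureReal_nsmul_lt_le hr hB h hd he hdM (by positivity) (by positivity) hb0 N m
    have h5 : (m : ℝ) * (b + 2 * s) = t := by
      rw [hb]
      field_simp
      ring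
    rw [h5] at h4
    have h6 : 2 * (3 * s) / b ≤ 12 * m * (s / t) := by
      rw [div_le_iff₀ hb0]
      calc 2 * (3 * s) = 12 * m * (s / t) * (t / (2 * m)) := by field_simp; ring
        _ ≤ _ := mul_le_mul_of_nonneg_left h1 (by positivity)
    have h7 : (B ^ 2 * (2 * (3 * s) / b) ^ r) ^ m ≤
        (B ^ 2 * (12 * (m : ℝ)) ^ r) ^ m * (s / t) ^ p := by
      calc (B ^ 2 * (2 * (3 * s) / b) ^ r) ^ m ≤ (B ^ 2 * (12 * m * (s / t)) ^ r) ^ m := by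
            gcongr
        _ = (B ^ 2 * (12 * (m : ℝ)) ^ r) ^ m * (s / t) ^ (r * m) := by
            rw [Real.mul_rpow (by positivity) (by positivity), ← mul_assoc, mul_pow,
              Real.rpow_mul (by positivity), Real.rpow_natCast]
        _ ≤ _ := by
            refine mul_le_mul_of_nonneg_left (Real.rpow_le_rpow_of_exponent_ge (by positivity) ?_
              hmp) (by positivity)
            rw [div_le_one ht]
            have : (1 : ℝ) ≤ m := by exact_mod_cast Nat.one_le_iff_ne_zero.2 (by
              rintro rfl; simp at hm0)
            nlinarith
    linarith

end Tail

/-! ### Removal of large jumps and the final estimate. -/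

section Truncation

variable {Ω V : Type*} [NormedAddCommGroup V] [MeasurableSpace V] [BorelSpace V]
  {mΩ : MeasurableSpace Ω} {μ : Measure Ω} {ℱ : Filtration ℕ mΩ} {f g : ℕ → Ω → V}

lemma IsTangentPair.of_tangent [IsProbabilityMeasure μ] (hf : IsDiscreteProcess ℱ f)
    (hg : IsDiscreteProcess ℱ g) (hsym : ConditionallySymmetric ℱ μ f) (hfg : Tangent ℱ μ f g) :
    IsTangentPair ℱ μ (fun n ω => f (n + 1) ω - f n ω) fun n ω => g (n + 1) ω - g n ω := by
  have hm : ∀ h : ℕ → Ω → V, IsDiscreteProcess ℱ h → ∀ n,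
      StronglyMeasurable[ℱ (n + 1)] fun ω => h (n + 1) ω - h n ω := fun h hh n =>
    (hh.adapted (n + 1)).sub ((hh.adapted n).mono (ℱ.mono n.le_succ))
  have hm' : ∀ h : ℕ → Ω → V, IsDiscreteProcess ℱ h → ∀ n,
      Measurable fun ω => h (n + 1) ω - h n ω := fun h hh n =>
    ((hm h hh n).mono (ℱ.le _)).measurable
  refine ⟨hm f hf, hm g hg, fun n => SameCondLaw.of_condExp (ℱ.le n) (hm' f hf n) (hm' g hg n)
    (hfg n), fun n => SameCondLaw.of_condExp (ℱ.le n) (hm' f hf n) (hm' f hf n).neg fun B hB => ?_⟩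
  have h1 := hsym n B hB
  have h2 : (-f) (n + 1) - (-f) n = -fun ω => f (n + 1) ω - f n ω := by
    ext ω
    simp only [Pi.sub_apply, Pi.neg_apply]
    abel
  rwa [h2] at h1

omit [MeasurableSpace V] [BorelSpace V] in
lemma measurableSet_forall_norm_le (hf : StronglyAdapted ℱ f) (s : ℝ) (n : ℕ) :
    MeasurableSet[ℱ n] {ω | ∀ k ≤ n, ‖f k ω‖ ≤ s} := by
  have : {ω | ∀ k ≤ n, ‖f k ω‖ ≤ s} = ⋂ k ∈ Finset.range (n + 1), {ω | ‖f k ω‖ ≤ s} := by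
    ext ω
    simp
  rw [this]
  exact Finset.measurableSet_biInter _ fun k hk => measurableSet_le
    ((hf k).mono (ℱ.mono (Nat.lt_succ_iff.1 (Finset.mem_range.1 hk)))).norm.measurable
    measurable_const

/-- Before the first time that `f` leaves a ball, `g` is unlikely to make a large jump. -/
lemma measureReal_exists_jump_le [IsProbabilityMeasure μ] (hf : IsDiscreteProcess ℱ f)
    (hfg : IsTangentPair ℱ μ (fun n ω => f (n + 1) ω - f n ω) fun n ω => g (n + 1) ω - g n ω)
    (s : ℝ) (N : ℕ) :
    μ.real {ω | ∃ n < N, (∀ k ≤ n, ‖f k ω‖ ≤ s) ∧ 2 * s < ‖g (n + 1) ω - g n ω‖} ≤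
      μ.real {ω | ∃ n ≤ N, s < ‖f n ω‖} := by
  set A : ℕ → Set Ω := fun n => {ω | ∀ k ≤ n, ‖f k ω‖ ≤ s} with hA
  have hAm : ∀ n, MeasurableSet[ℱ n] (A n) := measurableSet_forall_norm_le hf.adapted s
  have hJ : MeasurableSet {v : V | 2 * s < ‖v‖} :=
    (isOpen_lt continuous_const continuous_norm).measurableSet
  have h1 : {ω | ∃ n < N, (∀ k ≤ n, ‖f k ω‖ ≤ s) ∧ 2 * s < ‖g (n + 1) ω - g n ω‖} =
      ⋃ n ∈ Finset.range N, A n ∩ (fun ω => g (n + 1) ω - g n ω) ⁻¹' {v : V | 2 * s < ‖v‖} := by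
    ext ω
    simp [hA, and_left_comm]
  have hanti : ∀ n, A (n + 1) ⊆ A n := fun n ω hω k hk => hω k (hk.trans n.le_succ)
  -- By tangency the jump of `g` has the same probability as one of `f`. A jump of `f` larger than
  -- `2 * s` from inside the ball leads out of it, that is, from `A n` to the complement of `A (n +
  -- 1)`; these events telescope.
  have h2 : ∀ n, μ.real (A n ∩ (fun ω => g (n + 1) ω - g n ω) ⁻¹' {v : V | 2 * s < ‖v‖}) ≤
      μ.real (A n) - μ.real (A (n + 1)) := by
    intro n
    rw [measureReal_def, ← hfg.tangent n _ (hAm n) _ hJ, ← measureReal_def,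
      ← measureReal_sdiff (hanti n) (ℱ.le _ _ (hAm (n + 1)))]
    refine measureReal_mono fun ω hω => ⟨hω.1, fun h => ?_⟩
    have h3 : 2 * s < ‖f (n + 1) ω - f n ω‖ := hω.2
    linarith [norm_sub_le (f (n + 1) ω) (f n ω), h _ le_rfl, hω.1 n le_rfl]
  have h3 : {ω | ∃ n ≤ N, s < ‖f n ω‖} = (A N)ᶜ := by
    ext ω
    simp [hA]
  rw [h1, h3, probReal_compl_eq_one_sub (ℱ.le _ _ (hAm N))]
  calc _ ≤ ∑ n ∈ Finset.range N, (μ.real (A n) - μ.real (A (n + 1))) :=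
        (measureReal_biUnion_finset_le _ _).trans (Finset.sum_le_sum fun n _ => h2 n)
    _ = μ.real (A 0) - μ.real (A N) := Finset.sum_range_sub' _ _
    _ ≤ 1 - μ.real (A N) := sub_le_sub_right measureReal_le_one _

variable [NormedSpace ℝ V]

/-- Unless `f` leaves the ball of radius `s`, or `g` jumps by more than `2 * s` before that, `g`
coincides with its truncated version. Each exceptional event has probability at most `P(f* > s)`,
hence the constant `C + 2`. The truncation is odd, so conditional symmetry survives. -/
lemma IsBurkholderFunction.exists_tail_estimate {p r B : ℝ} (hp : 0 < p) (hr : 0 < r)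
    (hB : 0 < B) {U : V → V → ℝ} (hU : IsBurkholderFunction r B U) :
    ∃ C : ℝ, 0 < C ∧
        ∀ (Ω : Type w) (mΩ : MeasurableSpace Ω) (μ : Measure Ω) (_ : IsProbabilityMeasure μ)
          (ℱ : Filtration ℕ mΩ) (f g : ℕ → Ω → V),
          IsDiscreteProcess ℱ f → IsDiscreteProcess ℱ g →
          ConditionallySymmetric ℱ μ f → Tangent ℱ μ f g →
          ∀ s t : ℝ, 0 < s → 0 < t →
            μ.real {ω | ENNReal.ofReal t < maximalFunction g ω} ≤
              C * (s ^ p / t ^ p + μ.real {ω | ENNReal.ofReal s < maximalFunction f ω}) := by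
  classical
  obtain ⟨C, hC, H⟩ := hU.exists_measureReal_lt_le.{w} hp hr hB
  refine ⟨C + 2, by positivity, ?_⟩
  intro Ω mΩ μ _ ℱ f g hf hg hsym hfg s t hs ht
  simp only [ofReal_lt_maximalFunction_iff hf.zero hs, ofReal_lt_maximalFunction_iff hg.zero ht]
  have h := IsTangentPair.of_tangent hf hg hsym hfg
  set A : ℕ → Set Ω := fun n => {ω | ∀ k ≤ n, ‖f k ω‖ ≤ s} with hA
  set φ : V → V := (Metric.closedBall 0 (2 * s)).indicator id with hφ
  have hφi : ∀ x, φ x = if ‖x‖ ≤ 2 * s then x else 0 := fun x => by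
    simp [hφ, Set.indicator_apply]
  have hφn : ∀ x, ‖φ x‖ ≤ 2 * s := fun x => by
    rw [hφi]
    split_ifs with hx
    · exact hx
    · rw [norm_zero]
      positivity
  have h' := (h.comp (φ := φ) (measurable_id.indicator measurableSet_closedBall)
    (fun m X hX => by
      have h1 : (fun ω => φ (X ω)) = (X ⁻¹' Metric.closedBall 0 (2 * s)).indicator X := by
        ext ω
        rw [hφ, Set.indicator_apply, Set.indicator_apply]
        rfl
      rw [h1]
      exact hX.indicator (hX.measurable measurableSet_closedBall))
    (fun x => by
      rw [hφi, hφi, norm_neg]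
      split_ifs
      exacts [rfl, neg_zero.symm])).indicator (measurableSet_forall_norm_le hf.adapted s)
  have hG := H Ω mΩ μ ‹_› ℱ _ _ s t hs ht h'
    (fun n ω => (norm_indicator_le_norm_self _ _).trans (hφn _))
    (fun n ω => (norm_indicator_le_norm_self _ _).trans (hφn _))
    (fun n ω => by
      have h1 := truncated_sum_bound (f := fun n => f n ω) (congrFun hf.zero ω) hs.le
        (A := fun n => ω ∈ A n) (fun n => Iff.rfl) n
      simpa only [Set.indicator_apply, hφi] using h1)
  have hfin : ∀ N : ℕ, μ.real {ω | ∃ n ≤ N, t < ‖g n ω‖} ≤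
      (C + 2) * (s ^ p / t ^ p + μ.real {ω | ∃ n, s < ‖f n ω‖}) := by
    intro N
    have hf_le : μ.real {ω | ∃ n ≤ N, s < ‖f n ω‖} ≤ μ.real {ω | ∃ n, s < ‖f n ω‖} :=
      measureReal_mono fun ω ⟨n, _, hn⟩ => ⟨n, hn⟩
    have hsub : {ω | ∃ n ≤ N, t < ‖g n ω‖} ⊆ {ω | ∃ n ≤ N, s < ‖f n ω‖} ∪
        ({ω | ∃ n < N, (∀ k ≤ n, ‖f k ω‖ ≤ s) ∧ 2 * s < ‖g (n + 1) ω - g n ω‖} ∪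
        {ω | ∃ n ≤ N, t < ‖∑ k ∈ Finset.range n,
          (A k).indicator (fun ω => φ (g (k + 1) ω - g k ω)) ω‖}) := by
      rintro ω ⟨n, hn, hω⟩
      by_contra hcon
      simp only [Set.mem_union, Set.mem_ofPred_eq, not_or, not_exists, not_and, not_lt] at hcon
      obtain ⟨h1, h2, h3⟩ := hcon
      refine (h3 n hn).not_gt (hω.trans_eq ?_)
      have h4 : ∀ k ∈ Finset.range n, (A k).indicator (fun ω => φ (g (k + 1) ω - g k ω)) ω =
          g (k + 1) ω - g k ω := fun k hk => by
        have hkN := (Finset.mem_range.1 hk).trans_le hn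
        have h5 : ω ∈ A k := fun j hj => h1 j (hj.trans hkN.le)
        rw [Set.indicator_of_mem h5, hφi, if_pos (h2 k hkN h5)]
      rw [Finset.sum_congr rfl h4, Finset.sum_range_sub fun k => g k ω, hg.zero]
      simp
    have h1 := (measureReal_mono (μ := μ) hsub).trans ((measureReal_union_le _ _).trans
      (add_le_add_right (measureReal_union_le _ _) _))
    have h2 := measureReal_exists_jump_le hf h s N
    have h3 := hG N
    have h4 : 0 ≤ s ^ p / t ^ p := by positivity
    have h5 : 0 ≤ C * μ.real {ω | ∃ n, s < ‖f n ω‖} := by positivity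
    linarith
  -- The bound is uniform in the horizon `N`, so continuity from below along these increasing events
  -- gives it for the full supremum.
  have hmono : Monotone fun N : ℕ => {ω | ∃ n ≤ N, t < ‖g n ω‖} :=
    fun N M hNM ω ⟨n, hn, hω⟩ => ⟨n, hn.trans hNM, hω⟩
  have hU' : {ω | ∃ n, t < ‖g n ω‖} = ⋃ N : ℕ, {ω | ∃ n ≤ N, t < ‖g n ω‖} := by
    ext ω
    simp only [Set.mem_ofPred_eq, Set.mem_iUnion]
    exact ⟨fun ⟨n, hn⟩ => ⟨n, n, le_rfl, hn⟩, fun ⟨_, n, _, hn⟩ => ⟨n, hn⟩⟩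
  rw [hU']
  have hlim := tendsto_measure_iUnion_atTop (μ := μ) hmono
  exact le_of_tendsto' ((ENNReal.tendsto_toReal (measure_ne_top _ _)).comp hlim) hfin

end Truncation

theorem proposition6 {𝕜 : Type v} {V : Type u} [RCLike 𝕜] [NormedAddCommGroup V]
    [NormedSpace ℝ V] [NormedSpace 𝕜 V] [IsScalarTower ℝ 𝕜 V] [CompleteSpace V]
    [MeasurableSpace V] [BorelSpace V] (p : ℝ) (hp : 0 < p) :
    IsUMD.{w} 𝕜 V ↔
      ∃ C : ℝ, 0 < C ∧
        ∀ (Ω : Type w) (mΩ : MeasurableSpace Ω) (μ : Measure Ω) (_ : IsProbabilityMeasure μ)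
          (ℱ : Filtration ℕ mΩ) (f g : ℕ → Ω → V),
          IsDiscreteProcess ℱ f → IsDiscreteProcess ℱ g →
          ConditionallySymmetric ℱ μ f → ConditionallySymmetric ℱ μ g → Tangent ℱ μ f g →
          ∀ s t : ℝ, 0 < s → 0 < t →
            μ.real {ω | ENNReal.ofReal t < maximalFunction g ω} ≤
              C * (s ^ p / t ^ p + μ.real {ω | ENNReal.ofReal s < maximalFunction f ω}) := by
  constructor
  · intro h
    obtain ⟨r, hr, B, hB, hS⟩ := SignTree.mean_le_zero_of_isUMD h
    obtain ⟨U, hU⟩ := exists_isBurkholderFunction (zero_lt_one.trans hr) hS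
    obtain ⟨C, hC, H⟩ := hU.exists_tail_estimate hp (zero_lt_one.trans hr) hB
    exact ⟨C, hC, fun Ω mΩ μ hμ ℱ f g hf hg hfs _ hfg => H Ω mΩ μ hμ ℱ f g hf hg hfs hfg⟩
  · rintro ⟨C, hC, H⟩
    obtain ⟨B, hB, hS⟩ := SignTree.exists_mean_sq_le hp hC (SignTree.tailBound_of_tangent H)
    obtain ⟨U, hU⟩ := exists_isBurkholderFunction (r := 2) (B := B) two_pos
      (by simpa only [Real.rpow_two] using hS)
    exact hU.isUMD one_lt_two hB
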